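/- Fix an o-minimal structure on $\mathbb{R}$ that contains the semialgebraic sets; its members are called definable. For a definable set $A\subseteq\mathbb{R}^n$ let $\chi(A)=\sum_i(-1)^{\dim C_i}$ for any finite partition of $A$ into definable cells $C_i$. If $\iota\colon X\to\mathbb{R}^n$ is a topological embedding with definable image and $f\colon X\to R$ is a function to a ring with finitely many values and definable fibres, put $\int_X f\,d\chi=\sum_{s\in R}\chi(\iota(f^{-1}(s)))\,s$. A topological groupoid $\mathcal{G}$ (with Hausdorff spaces of objects and arrows) with orbit map $\pi\colon\mathcal{G}_0\to|\mathcal{G}|$ is *orbit space definable* if it is equipped with a topological embedding $\iota\colon|\mathcal{G}|\to\mathbb{R}^n$ with definable image, every isotropy group $\mathcal{G}_x^x$ is a compact Lie group, there are only finitely many isomorphism classes of isotropy groups, and for each group $H$ the set $|\mathcal{G}|_{[H]}\subseteq|\mathcal{G}|$ of orbits of points with isotropy group isomorphic to $H$ is definable (that is, has definable image under $\iota$). It is *isotropy locally trivial* if $|\mathcal{G}|$ has a finite partition into cells (via $\iota$) such that each cell $C$ lies in some $|\mathcal{G}|_{[H]}$, where $H$ is an isotropy group of $\mathcal{G}$,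 and $\mathcal{G}_{|\pi^{-1}(C)}$ is topologically Morita equivalent to $H\ltimes C$ with trivial action. Let $\mathscr{R}$ be the commutative ring generated by variables $T^{[G]}$, one for each isomorphism class $[G]$ of compact Lie groups, subject to the relations $T^{[G]}T^{[H]}=T^{[G\times H]}$ and $T^{[e]}=1$, where $e$ is the trivial group. Let $R$ be a (unital, not necessarily commutative) ring and let $I$ be a topological invariant of orbit space definable groupoids with values in $R$, i.e. $I(\mathcal{G})=I(\mathcal{H})$ whenever $\mathcal{G}$ and $\mathcal{H}$ are topologically Morita equivalent. Say that $I$ is * *additive on isotropy locally trivial groupoids* if $I(\mathcal{G})=I(\mathcal{G}_{|\pi^{-1}(X)})+I(\mathcal{G}_{|\pi^{-1}(|\mathcal{G}|\smallsetminus X)})$ for every isotropy locally trivial $\mathcal{G}$ and every $X\subseteq|\mathcal{G}|$ such that both restrictions are orbit space definable via the restricted embedding; * *multiplicative on isotropy locally trivial groupoids* if $I(\mathcal{G}\times\mathcal{H})=I(\mathcal{G})I(\mathcal{H})$ for all isotropy locally trivial $\mathcal{G},\mathcal{H}$ for which $\mathcal{G}\times\mathcal{H}$ is orbit space definable via the product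 embedding. Then $I$ is additive and multiplicative on isotropy locally trivial groupoids if and only if there is a unique additive and multiplicative map $r\colon\mathscr{R}\to R$ (a ring homomorphism, not required to preserve $1$) such that $$I(\mathcal{G})=\int_{|\mathcal{G}|} r\bigl(T^{[\mathcal{G}_x^x]}\bigr)\,d\chi(\mathcal{G}x)$$ for every isotropy locally trivial orbit space definable groupoid $\mathcal{G}$. Likewise, $I$ is additive and multiplicative on isotropy locally trivial groupoids and takes the value $1$ on the groupoids with one object and one arrow if and only if there is a unique unital ring homomorphism $r\colon\mathscr{R}\to R$ with this property. -/

import Mathlib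

open Set Topology
open scoped Manifold ContDiff

universe u v

noncomputable section

/-! ### O-minimal structures, cells, and the Euler characteristic -/

/-- An o-minimal structure on `ℝ` that contains the semialgebraic sets: for each `n` a Boolean
algebra of subsets of `ℝⁿ`, stable under substitution of coordinates (this covers `A × ℝ`,
`ℝ × A` and permutations of coordinates) and under coordinate projections, such that every
definable subset of `ℝ` is a finite union of (possibly degenerate or unbounded) intervals. -/
structure OMinimalStructure where
  /-- `Definable A`: the set `A ⊆ ℝⁿ` belongs to the structure. -/
  Definable : ∀ {n : ℕ}, Set (Fin n → ℝ) → Prop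
  union : ∀ {n : ℕ} {A B : Set (Fin n → ℝ)}, Definable A → Definable B → Definable (A ∪ B)
  compl : ∀ {n : ℕ} {A : Set (Fin n → ℝ)}, Definable A → Definable Aᶜ
  substitution : ∀ {m n : ℕ} (σ : Fin m → Fin n) {A : Set (Fin m → ℝ)},
    Definable A → Definable {x : Fin n → ℝ | (fun i => x (σ i)) ∈ A}
  projection : ∀ {n : ℕ} {A : Set (Fin (n + 1) → ℝ)},
    Definable A → Definable ((fun x : Fin (n + 1) → ℝ => Fin.init (α := fun _ => ℝ) x) '' A)
  /-- Together with the Boolean operations this gives all semialgebraic sets. -/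
  polynomial_pos : ∀ {n : ℕ} (p : MvPolynomial (Fin n) ℝ),
    Definable {x : Fin n → ℝ | 0 < MvPolynomial.eval x p}
  tame : ∀ {A : Set (Fin 1 → ℝ)}, Definable A →
    ∃ F : Set (Set ℝ), F.Finite ∧ (∀ J ∈ F, J.OrdConnected) ∧
      ⋃₀ F = {t : ℝ | (fun _ => t) ∈ A}

namespace OMinimalStructure

variable (S : OMinimalStructure)

/-- `f` restricted to `Y` is a definable (its graph over `Y` is definable) continuous function. -/
def DefContOn {n : ℕ} (f : (Fin n → ℝ) → ℝ) (Y : Set (Fin n → ℝ)) : Prop :=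
  ContinuousOn f Y ∧
    S.Definable {x : Fin (n + 1) → ℝ |
      Fin.init (α := fun _ => ℝ) x ∈ Y ∧ x (Fin.last n) = f (Fin.init (α := fun _ => ℝ) x)}

/-- `S.IsCell C d`: the set `C ⊆ ℝⁿ` is a cell of dimension `d`. The only cell in `ℝ⁰` is the
point. In `band`, a missing lower bound `none` stands for `-∞`, a missing upper bound for `+∞`. -/
inductive IsCell : {n : ℕ} → Set (Fin n → ℝ) → ℕ → Prop
  | point : IsCell (n := 0) Set.univ 0
  | graph {n d : ℕ} {Y : Set (Fin n → ℝ)} (f : (Fin n → ℝ) → ℝ) :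
      IsCell Y d → S.DefContOn f Y →
      IsCell {x : Fin (n + 1) → ℝ |
        Fin.init (α := fun _ => ℝ) x ∈ Y ∧
          x (Fin.last n) = f (Fin.init (α := fun _ => ℝ) x)} d
  | band {n d : ℕ} {Y : Set (Fin n → ℝ)} (lo hi : Option ((Fin n → ℝ) → ℝ)) :
      IsCell Y d → (∀ f ∈ lo, S.DefContOn f Y) → (∀ g ∈ hi, S.DefContOn g Y) →
      (∀ f ∈ lo, ∀ g ∈ hi, ∀ y ∈ Y, f y < g y) →
      IsCell {x : Fin (n + 1) → ℝ |
        Fin.init (α := fun _ => ℝ) x ∈ Y ∧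
          (∀ f ∈ lo, f (Fin.init (α := fun _ => ℝ) x) < x (Fin.last n)) ∧
          (∀ g ∈ hi, x (Fin.last n) < g (Fin.init (α := fun _ => ℝ) x))} (d + 1)

/-- `P` is a finite partition of `A ⊆ ℝⁿ` into cells, each listed with its dimension. -/
structure IsCellPartition {n : ℕ} (A : Set (Fin n → ℝ)) (P : Finset (Set (Fin n → ℝ) × ℕ)) :
    Prop where
  isCell : ∀ c ∈ P, S.IsCell c.1 c.2
  disjoint : ∀ c ∈ P, ∀ c' ∈ P, c ≠ c' → Disjoint c.1 c'.1
  cover : ⋃ c ∈ P, c.1 = A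

open Classical in
/-- The Euler characteristic `∑ (-1) ^ dim Cᵢ` over a finite partition of `A` into cells
(which every definable set has). -/
def eulerChar {n : ℕ} (A : Set (Fin n → ℝ)) : ℤ :=
  if h : ∃ P, S.IsCellPartition A P then ∑ c ∈ h.choose, (-1) ^ c.2 else 0

/-- The integral of `f : X → R` with respect to the Euler characteristic, `∑ₛ χ(f⁻¹(s)) s`,
for a space `X` embedded by `ι` in `ℝⁿ`. -/
def eulerIntegral {X : Type u} {n : ℕ} (ι : X → Fin n → ℝ) {R : Type v} [AddCommGroup R]
    (f : X → R) : R :=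
  ∑ᶠ s : R, S.eulerChar (ι '' (f ⁻¹' {s})) • s

end OMinimalStructure

/-! ### Compact Lie groups and the ring of their isomorphism classes -/

/-- The topological group `H` is a compact Lie group: it is compact, Hausdorff, and isomorphic as a
topological group to a finite-dimensional smooth Lie group. -/
def IsCompactLieGroup (H : Type u) [Group H] [TopologicalSpace H] : Prop :=
  CompactSpace H ∧ T2Space H ∧
    ∃ (E : Type u) (_ : NormedAddCommGroup E) (_ : NormedSpace ℝ E) (_ : FiniteDimensional ℝ E)
      (L : Type u) (_ : Group L) (_ : TopologicalSpace L) (_ : ChartedSpace E L),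
      LieGroup 𝓘(ℝ, E) ∞ L ∧ Nonempty (H ≃ₜ* L)

theorem IsCompactLieGroup.prod {H K : Type u} [Group H] [TopologicalSpace H] [Group K]
    [TopologicalSpace K] (hH : IsCompactLieGroup H) (hK : IsCompactLieGroup K) :
    IsCompactLieGroup (H × K) := by
  obtain ⟨_, _, E, _, _, _, L, _, _, _, hL, ⟨e⟩⟩ := hH
  obtain ⟨_, _, F, _, _, _, M, _, _, _, hM, ⟨e'⟩⟩ := hK
  refine ⟨inferInstance, inferInstance, E × F, inferInstance, inferInstance, inferInstance,
    L × M, inferInstance, inferInstance, prodChartedSpace E L F M, ?_, ⟨?_⟩⟩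
  · rw [modelWithCornersSelf_prod]
    exact Prod.instLieGroup
  · exact { MulEquiv.prodCongr e.toMulEquiv e'.toMulEquiv with
      continuous_toFun := (e.continuous_toFun.prodMap e'.continuous_toFun)
      continuous_invFun := (e.continuous_invFun.prodMap e'.continuous_invFun) }

theorem isCompactLieGroup_punit : IsCompactLieGroup PUnit.{u + 1} := by
  refine ⟨inferInstance, inferInstance, PUnit, inferInstance, inferInstance, inferInstance,
    PUnit, inferInstance, inferInstance, inferInstance, ?_, ⟨ContinuousMulEquiv.refl _⟩⟩
  exact
    { contMDiff_mul := contMDiff_const (c := PUnit.unit)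
      contMDiff_inv := contMDiff_const (c := PUnit.unit) }

/-- A compact Lie group. -/
structure CompactLieGrp : Type (u + 1) where
  carrier : Type u
  [group : Group carrier]
  [top : TopologicalSpace carrier]
  isCompactLie : IsCompactLieGroup carrier

namespace CompactLieGrp

attribute [instance] CompactLieGrp.group CompactLieGrp.top

/-- The product of two compact Lie groups. -/
def prod (H K : CompactLieGrp.{u}) : CompactLieGrp.{u} :=
  ⟨H.carrier × K.carrier, H.isCompactLie.prod K.isCompactLie⟩

/-- The trivial group. -/
def trivial : CompactLieGrp.{u} := ⟨PUnit, isCompactLieGroup_punit⟩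

/-- Isomorphism of compact Lie groups (as topological groups, equivalently as Lie groups). -/
instance isoSetoid : Setoid CompactLieGrp.{u} where
  r H K := Nonempty (H.carrier ≃ₜ* K.carrier)
  iseqv :=
    { refl := fun _ => ⟨ContinuousMulEquiv.refl _⟩
      symm := fun ⟨e⟩ => ⟨e.symm⟩
      trans := fun ⟨e⟩ ⟨e'⟩ => ⟨e.trans e'⟩ }

/-- The isomorphism classes of compact Lie groups. -/
def IsoClass : Type (u + 1) := Quotient CompactLieGrp.isoSetoid.{u}

/-- The isomorphism class of a compact Lie group. -/
def cls (H : CompactLieGrp.{u}) : IsoClass.{u} := Quotient.mk _ H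

open MvPolynomial in
/-- The ideal that identifies `T^[G] T^[H]` with `T^[G × H]` and `T^[e]` with `1`. -/
def relations : Ideal (MvPolynomial IsoClass.{u} ℤ) :=
  Ideal.span ({p | ∃ H K : CompactLieGrp.{u}, p = X H.cls * X K.cls - X (H.prod K).cls} ∪
    {X (trivial.{u}).cls - 1})

/-- The ring `𝓡`, generated by variables `T^[G]` for the isomorphism classes of compact Lie
groups. -/
abbrev UnivRing : Type (u + 1) := MvPolynomial IsoClass.{u} ℤ ⧸ relations.{u}

/-- The element `T^c` of `𝓡`. -/
def T (c : IsoClass.{u}) : UnivRing.{u} := Ideal.Quotient.mk _ (MvPolynomial.X c)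

end CompactLieGrp

/-! ### Topological groupoids -/

/-- A (Hausdorff) topological groupoid; `mul g h` is the product `gh`, defined if `s g = t h`. -/
structure TopGroupoid : Type (u + 1) where
  Obj : Type u
  Arr : Type u
  [topObj : TopologicalSpace Obj]
  [topArr : TopologicalSpace Arr]
  [t2Obj : T2Space Obj]
  [t2Arr : T2Space Arr]
  src : Arr → Obj
  tgt : Arr → Obj
  unit : Obj → Arr
  inv : Arr → Arr
  mul : ∀ g h : Arr, src g = tgt h → Arr
  src_unit : ∀ x, src (unit x) = x
  tgt_unit : ∀ x, tgt (unit x) = x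
  src_inv : ∀ g, src (inv g) = tgt g
  tgt_inv : ∀ g, tgt (inv g) = src g
  src_mul : ∀ g h e, src (mul g h e) = src h
  tgt_mul : ∀ g h e, tgt (mul g h e) = tgt g
  mul_assoc : ∀ g h k (e : src g = tgt h) (e' : src h = tgt k),
    mul (mul g h e) k ((src_mul g h e).trans e') =
      mul g (mul h k e') (e.trans (tgt_mul h k e').symm)
  unit_mul : ∀ g, mul (unit (tgt g)) g (src_unit _) = g
  mul_unit : ∀ g, mul g (unit (src g)) (tgt_unit _).symm = g
  mul_inv : ∀ g, mul g (inv g) (tgt_inv g).symm = unit (tgt g)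
  inv_mul : ∀ g, mul (inv g) g (src_inv g) = unit (src g)
  continuous_src : Continuous src
  continuous_tgt : Continuous tgt
  continuous_unit : Continuous unit
  continuous_inv : Continuous inv
  continuous_mul : Continuous fun p : {p : Arr × Arr // src p.1 = tgt p.2} =>
    mul p.1.1 p.1.2 p.2

namespace TopGroupoid

attribute [instance] topObj topArr t2Obj t2Arr

variable (G H : TopGroupoid.{u})

/-- The isotropy group of `x`, with the subspace topology. -/
def Isotropy (x : G.Obj) : Type u := {g : G.Arr // G.src g = x ∧ G.tgt g = x}

instance (x : G.Obj) : TopologicalSpace (G.Isotropy x) :=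
  inferInstanceAs (TopologicalSpace {g : G.Arr // G.src g = x ∧ G.tgt g = x})

instance (x : G.Obj) : T2Space (G.Isotropy x) :=
  inferInstanceAs (T2Space {g : G.Arr // G.src g = x ∧ G.tgt g = x})

variable {G} in
theorem mul_congr {g g' h h' : G.Arr} (hg : g = g') (hh : h = h') (e : G.src g = G.tgt h) :
    G.mul g h e = G.mul g' h' (by rw [← hg, ← hh]; exact e) := by
  subst hg hh; rfl

variable {G} in
theorem unit_mul' {x : G.Obj} (g : G.Arr) (e : G.src (G.unit x) = G.tgt g) :
    G.mul (G.unit x) g e = g := by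
  have hx : x = G.tgt g := (G.src_unit x).symm.trans e
  subst hx; exact G.unit_mul g

variable {G} in
theorem mul_unit' {x : G.Obj} (g : G.Arr) (e : G.src g = G.tgt (G.unit x)) :
    G.mul g (G.unit x) e = g := by
  have hx : x = G.src g := (G.tgt_unit x).symm.trans e.symm
  subst hx; exact G.mul_unit g

instance (x : G.Obj) : Group (G.Isotropy x) where
  mul a b := ⟨G.mul a.1 b.1 (a.2.1.trans b.2.2.symm),
    (G.src_mul _ _ _).trans b.2.1, (G.tgt_mul _ _ _).trans a.2.2⟩
  one := ⟨G.unit x, G.src_unit x, G.tgt_unit x⟩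
  inv a := ⟨G.inv a.1, (G.src_inv _).trans a.2.2, (G.tgt_inv _).trans a.2.1⟩
  mul_assoc a b c := Subtype.ext (G.mul_assoc a.1 b.1 c.1 _ _)
  one_mul a := Subtype.ext (unit_mul' a.1 _)
  mul_one a := Subtype.ext (mul_unit' a.1 _)
  inv_mul_cancel a := Subtype.ext ((G.inv_mul a.1).trans (congrArg G.unit a.2.1))

/-- Two objects lie in the same orbit. -/
def orbitSetoid : Setoid G.Obj where
  r x y := ∃ g, G.src g = x ∧ G.tgt g = y
  iseqv :=
    { refl := fun x => ⟨G.unit x, G.src_unit x, G.tgt_unit x⟩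
      symm := fun ⟨g, h, h'⟩ => ⟨G.inv g, (G.src_inv g).trans h', (G.tgt_inv g).trans h⟩
      trans := fun ⟨g, h, h'⟩ ⟨k, e, e'⟩ =>
        ⟨G.mul k g (e.trans h'.symm), (G.src_mul _ _ _).trans h, (G.tgt_mul _ _ _).trans e'⟩ }

/-- The orbit space `|G|`. -/
def OrbitSpace : Type u := Quotient G.orbitSetoid

/-- The quotient topology on `|G|`. -/
instance : TopologicalSpace G.OrbitSpace :=
  inferInstanceAs (TopologicalSpace (Quotient G.orbitSetoid))

/-- The orbit map. -/
def orbit (x : G.Obj) : G.OrbitSpace := Quotient.mk _ x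

/-- The weak orbit type of `x` in `|G|`: the orbits of the points whose isotropy group is
isomorphic to that of `x`. -/
def weakOrbitType (x : G.Obj) : Set G.OrbitSpace :=
  G.orbit '' {y | Nonempty (G.Isotropy y ≃ₜ* G.Isotropy x)}

variable {G} in
/-- Conjugation by an arrow `g`, from the isotropy group of its source to that of its target. -/
def conj (g : G.Arr) {x y : G.Obj} (hx : G.src g = x) (hy : G.tgt g = y) (a : G.Isotropy x) :
    G.Isotropy y :=
  ⟨G.mul (G.mul g a.1 (hx.trans a.2.2.symm)) (G.inv g)
      (((G.src_mul _ _ _).trans a.2.1).trans (hx.symm.trans (G.tgt_inv g).symm)),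
    (G.src_mul _ _ _).trans ((G.src_inv g).trans hy),
    (G.tgt_mul _ _ _).trans ((G.tgt_mul _ _ _).trans hy)⟩

variable {G} in
theorem eq_conj_of_mul_eq {g : G.Arr} {x y : G.Obj} (hx : G.src g = x) (hy : G.tgt g = y)
    (a : G.Isotropy x) (b : G.Isotropy y)
    (h : G.mul b.1 g (b.2.1.trans hy.symm) = G.mul g a.1 (hx.trans a.2.2.symm)) :
    b = conj g hx hy a := by
  apply Subtype.ext
  change b.1 = G.mul (G.mul g a.1 _) (G.inv g) _
  rw [← mul_congr h rfl ((G.src_mul _ _ _).trans (G.tgt_inv g).symm),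
    G.mul_assoc _ _ _ _ (G.tgt_inv g).symm, mul_congr rfl (G.mul_inv g)]
  exact (mul_unit' _ _).symm

variable {G} in
theorem conj_mul_eq {g : G.Arr} {x y : G.Obj} (hx : G.src g = x) (hy : G.tgt g = y)
    (a : G.Isotropy x) :
    G.mul (conj g hx hy a).1 g ((conj g hx hy a).2.1.trans hy.symm) =
      G.mul g a.1 (hx.trans a.2.2.symm) := by
  change G.mul (G.mul (G.mul g a.1 _) (G.inv g) _) g _ = _
  rw [G.mul_assoc _ _ _ _ (G.src_inv g), mul_congr rfl (G.inv_mul g)]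
  exact mul_unit' _ _

variable {G} in
theorem conj_inv_conj {g k : G.Arr} {x y : G.Obj} (hx : G.src g = x) (hy : G.tgt g = y)
    (hy' : G.src k = y) (hx' : G.tgt k = x)
    (hk : G.mul k g (hy'.trans hy.symm) = G.unit x) (hk' : G.mul g k (hx.trans hx'.symm) = G.unit y)
    (a : G.Isotropy x) :
    conj k hy' hx' (conj g hx hy a) = a := by
  symm
  apply eq_conj_of_mul_eq
  have e := conj_mul_eq hx hy a
  have e2 : G.mul (G.mul k (conj g hx hy a).1 (hy'.trans (conj g hx hy a).2.2.symm)) g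
      ((G.src_mul _ _ _).trans ((conj g hx hy a).2.1.trans hy.symm)) = a.1 := by
    rw [G.mul_assoc _ _ _ _ ((conj g hx hy a).2.1.trans hy.symm), mul_congr rfl e,
      ← G.mul_assoc _ _ _ (hy'.trans hy.symm), mul_congr hk rfl]
    exact unit_mul' _ _
  have e3 : G.src (G.mul (G.mul k (conj g hx hy a).1 (hy'.trans (conj g hx hy a).2.2.symm)) g
      ((G.src_mul _ _ _).trans ((conj g hx hy a).2.1.trans hy.symm))) = G.tgt k :=
    (G.src_mul _ _ _).trans (hx.trans hx'.symm)
  rw [← mul_congr e2 rfl e3, G.mul_assoc _ _ _ _ (hx.trans hx'.symm), mul_congr rfl hk']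
  exact mul_unit' _ _

variable {G} in
theorem continuous_mul_of {X : Type*} [TopologicalSpace X] {f f' : X → G.Arr} (hf : Continuous f)
    (hf' : Continuous f') (e : ∀ x, G.src (f x) = G.tgt (f' x)) :
    Continuous fun x => G.mul (f x) (f' x) (e x) :=
  G.continuous_mul.comp ((hf.prodMk hf').subtype_mk e)

variable {G} in
theorem continuous_conj {g : G.Arr} {x y : G.Obj} (hx : G.src g = x) (hy : G.tgt g = y) :
    Continuous (conj g hx hy) :=
  Continuous.subtype_mk (continuous_mul_of
    (continuous_mul_of continuous_const continuous_subtype_val _) continuous_const _) _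

instance (x : G.Obj) : IsTopologicalGroup (G.Isotropy x) where
  continuous_mul := Continuous.subtype_mk (continuous_mul_of
    (continuous_subtype_val.comp continuous_fst) (continuous_subtype_val.comp continuous_snd) _) _
  continuous_inv := (G.continuous_inv.comp continuous_subtype_val).subtype_mk _

variable {G} in
/-- Conjugation by an arrow as an isomorphism of topological groups. -/
def conjEquiv (g : G.Arr) {x y : G.Obj} (hx : G.src g = x) (hy : G.tgt g = y) :
    G.Isotropy x ≃ₜ* G.Isotropy y where
  toFun := conj g hx hy
  invFun := conj (G.inv g) ((G.src_inv g).trans hy) ((G.tgt_inv g).trans hx)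
  left_inv := conj_inv_conj hx hy _ _ ((G.inv_mul g).trans (congrArg _ hx))
    ((G.mul_inv g).trans (congrArg _ hy))
  right_inv := conj_inv_conj _ _ hx hy ((G.mul_inv g).trans (congrArg _ hy))
    ((G.inv_mul g).trans (congrArg _ hx))
  map_mul' a b := by
    symm
    apply eq_conj_of_mul_eq
    change G.mul (G.mul (conj g hx hy a).1 (conj g hx hy b).1 _) g _ = G.mul g (G.mul a.1 b.1 _) _
    rw [G.mul_assoc _ _ _ _ ((conj g hx hy b).2.1.trans hy.symm),
      mul_congr rfl (conj_mul_eq hx hy b), ← G.mul_assoc _ _ _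
        ((conj g hx hy a).2.1.trans hy.symm) (hx.trans b.2.2.symm),
      mul_congr (conj_mul_eq hx hy a) rfl, G.mul_assoc]
  continuous_toFun := continuous_conj hx hy
  continuous_invFun := continuous_conj _ _

/-- The isomorphism class of the isotropy group, as a function on the orbit space. -/
def isotropyClass (hG : ∀ x, IsCompactLieGroup (G.Isotropy x)) :
    G.OrbitSpace → CompactLieGrp.IsoClass.{u} :=
  Quotient.lift (fun x => CompactLieGrp.cls ⟨G.Isotropy x, hG x⟩) fun _ _ ⟨g, hx, hy⟩ =>
    Quotient.sound ⟨conjEquiv g hx hy⟩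

/-- The restriction of `G` to a set `A` of objects, with all arrows between them. -/
def restrict (A : Set G.Obj) : TopGroupoid.{u} where
  Obj := A
  Arr := {g : G.Arr // G.src g ∈ A ∧ G.tgt g ∈ A}
  src g := ⟨G.src g.1, g.2.1⟩
  tgt g := ⟨G.tgt g.1, g.2.2⟩
  unit x := ⟨G.unit x.1, by rw [G.src_unit]; exact x.2, by rw [G.tgt_unit]; exact x.2⟩
  inv g := ⟨G.inv g.1, by rw [G.src_inv]; exact g.2.2, by rw [G.tgt_inv]; exact g.2.1⟩
  mul g h e := ⟨G.mul g.1 h.1 (congrArg Subtype.val e),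
    by rw [G.src_mul]; exact h.2.1, by rw [G.tgt_mul]; exact g.2.2⟩
  src_unit x := Subtype.ext (G.src_unit _)
  tgt_unit x := Subtype.ext (G.tgt_unit _)
  src_inv g := Subtype.ext (G.src_inv _)
  tgt_inv g := Subtype.ext (G.tgt_inv _)
  src_mul g h e := Subtype.ext (G.src_mul _ _ _)
  tgt_mul g h e := Subtype.ext (G.tgt_mul _ _ _)
  mul_assoc g h k e e' := Subtype.ext (G.mul_assoc _ _ _ _ _)
  unit_mul g := Subtype.ext (G.unit_mul _)
  mul_unit g := Subtype.ext (G.mul_unit _)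
  mul_inv g := Subtype.ext (G.mul_inv _)
  inv_mul g := Subtype.ext (G.inv_mul _)
  continuous_src := (G.continuous_src.comp continuous_subtype_val).subtype_mk _
  continuous_tgt := (G.continuous_tgt.comp continuous_subtype_val).subtype_mk _
  continuous_unit := (G.continuous_unit.comp continuous_subtype_val).subtype_mk _
  continuous_inv := (G.continuous_inv.comp continuous_subtype_val).subtype_mk _
  continuous_mul := by
    refine Continuous.subtype_mk ?_ _
    exact G.continuous_mul.comp (Continuous.subtype_mk
      (f := fun p : {p : {g : G.Arr // G.src g ∈ A ∧ G.tgt g ∈ A} ×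
          {g : G.Arr // G.src g ∈ A ∧ G.tgt g ∈ A} //
          (⟨G.src p.1.1, p.1.2.1⟩ : A) = ⟨G.tgt p.2.1, p.2.2.2⟩} => (p.1.1.1, p.1.2.1))
      (by fun_prop) (fun p => congrArg Subtype.val p.2))

/-- The restriction of `G` to the union of the orbits in `X`. -/
abbrev overOrbits (X : Set G.OrbitSpace) : TopGroupoid.{u} := G.restrict (G.orbit ⁻¹' X)

/-- The map `|G|_A| → |G|` induced by the inclusion of a restriction. -/
def restrictOrbit (A : Set G.Obj) : (G.restrict A).OrbitSpace → G.OrbitSpace :=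
  Quotient.map' (Subtype.val : A → G.Obj) fun _ _ ⟨g, h, h'⟩ =>
    ⟨g.1, congrArg Subtype.val h, congrArg Subtype.val h'⟩

/-- The product groupoid. -/
def prod : TopGroupoid.{u} where
  Obj := G.Obj × H.Obj
  Arr := G.Arr × H.Arr
  src g := (G.src g.1, H.src g.2)
  tgt g := (G.tgt g.1, H.tgt g.2)
  unit x := (G.unit x.1, H.unit x.2)
  inv g := (G.inv g.1, H.inv g.2)
  mul g h e := (G.mul g.1 h.1 (congrArg Prod.fst e), H.mul g.2 h.2 (congrArg Prod.snd e))
  src_unit x := Prod.ext (G.src_unit _) (H.src_unit _)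
  tgt_unit x := Prod.ext (G.tgt_unit _) (H.tgt_unit _)
  src_inv g := Prod.ext (G.src_inv _) (H.src_inv _)
  tgt_inv g := Prod.ext (G.tgt_inv _) (H.tgt_inv _)
  src_mul g h e := Prod.ext (G.src_mul _ _ _) (H.src_mul _ _ _)
  tgt_mul g h e := Prod.ext (G.tgt_mul _ _ _) (H.tgt_mul _ _ _)
  mul_assoc g h k e e' := Prod.ext (G.mul_assoc _ _ _ _ _) (H.mul_assoc _ _ _ _ _)
  unit_mul g := Prod.ext (G.unit_mul _) (H.unit_mul _)
  mul_unit g := Prod.ext (G.mul_unit _) (H.mul_unit _)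
  mul_inv g := Prod.ext (G.mul_inv _) (H.mul_inv _)
  inv_mul g := Prod.ext (G.inv_mul _) (H.inv_mul _)
  continuous_src := G.continuous_src.prodMap H.continuous_src
  continuous_tgt := G.continuous_tgt.prodMap H.continuous_tgt
  continuous_unit := G.continuous_unit.prodMap H.continuous_unit
  continuous_inv := G.continuous_inv.prodMap H.continuous_inv
  continuous_mul := by
    refine Continuous.prodMk ?_ ?_
    · exact G.continuous_mul.comp (Continuous.subtype_mk
        (f := fun p : {p : (G.Arr × H.Arr) × (G.Arr × H.Arr) //
          (G.src p.1.1, H.src p.1.2) = (G.tgt p.2.1, H.tgt p.2.2)} => (p.1.1.1, p.1.2.1))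
        (by fun_prop) (fun p => congrArg Prod.fst p.2))
    · exact H.continuous_mul.comp (Continuous.subtype_mk
        (f := fun p : {p : (G.Arr × H.Arr) × (G.Arr × H.Arr) //
          (G.src p.1.1, H.src p.1.2) = (G.tgt p.2.1, H.tgt p.2.2)} => (p.1.1.2, p.1.2.2))
        (by fun_prop) (fun p => congrArg Prod.snd p.2))

/-- The map `|G × H| → |G|` induced by the projection. -/
def fstOrbit : (G.prod H).OrbitSpace → G.OrbitSpace :=
  Quotient.map' (Prod.fst : G.Obj × H.Obj → G.Obj) fun _ _ ⟨g, h, h'⟩ =>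
    ⟨g.1, congrArg Prod.fst h, congrArg Prod.fst h'⟩

/-- The map `|G × H| → |H|` induced by the projection. -/
def sndOrbit : (G.prod H).OrbitSpace → H.OrbitSpace :=
  Quotient.map' (Prod.snd : G.Obj × H.Obj → H.Obj) fun _ _ ⟨g, h, h'⟩ =>
    ⟨g.2, congrArg Prod.snd h, congrArg Prod.snd h'⟩

/-- The translation groupoid `K ⋉ C` of the trivial action of a topological group `K` on a
space `C`. -/
def trivialAction (K : Type u) [Group K] [TopologicalSpace K] [IsTopologicalGroup K] [T2Space K]
    (C : Type u) [TopologicalSpace C] [T2Space C] : TopGroupoid.{u} where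
  Obj := C
  Arr := K × C
  src g := g.2
  tgt g := g.2
  unit x := (1, x)
  inv g := (g.1⁻¹, g.2)
  mul g h _ := (g.1 * h.1, h.2)
  src_unit _ := rfl
  tgt_unit _ := rfl
  src_inv _ := rfl
  tgt_inv _ := rfl
  src_mul _ _ _ := rfl
  tgt_mul _ _ e := e.symm
  mul_assoc _ _ _ _ _ := Prod.ext (_root_.mul_assoc _ _ _) rfl
  unit_mul _ := Prod.ext (one_mul _) rfl
  mul_unit _ := Prod.ext (mul_one _) rfl
  mul_inv _ := Prod.ext (mul_inv_cancel _) rfl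
  inv_mul _ := Prod.ext (inv_mul_cancel _) rfl
  continuous_src := continuous_snd
  continuous_tgt := continuous_snd
  continuous_unit := by fun_prop
  continuous_inv := by fun_prop
  continuous_mul := by fun_prop

/-- A homomorphism of topological groupoids. -/
structure Hom where
  obj : G.Obj → H.Obj
  arr : G.Arr → H.Arr
  continuous_obj : Continuous obj
  continuous_arr : Continuous arr
  src_arr : ∀ g, H.src (arr g) = obj (G.src g)
  tgt_arr : ∀ g, H.tgt (arr g) = obj (G.tgt g)
  arr_unit : ∀ x, arr (G.unit x) = H.unit (obj x)
  arr_inv : ∀ g, arr (G.inv g) = H.inv (arr g)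
  arr_mul : ∀ g h (e : G.src g = G.tgt h), arr (G.mul g h e) =
    H.mul (arr g) (arr h) ((src_arr g).trans ((congrArg obj e).trans (tgt_arr h).symm))

variable {G H} in
/-- A topological essential equivalence: `t ∘ pr₁ : H₁ ×_{H₀} G₀ → H₀` is a surjection admitting
local sections, and `G₁` is the fibred product of `G₀ × G₀` and `H₁` over `H₀ × H₀`. -/
structure Hom.IsEssentialEquivalence (Φ : G.Hom H) : Prop where
  surjective : ∀ y : H.Obj, ∃ p : {p : H.Arr × G.Obj // H.src p.1 = Φ.obj p.2},
    H.tgt p.1.1 = y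
  local_sections : ∀ y : H.Obj, ∃ U : Set H.Obj, IsOpen U ∧ y ∈ U ∧
    ∃ σ : U → {p : H.Arr × G.Obj // H.src p.1 = Φ.obj p.2},
      Continuous σ ∧ ∀ z : U, H.tgt (σ z).1.1 = z
  fibred_product : IsHomeomorph
    (fun g => ⟨((G.src g, G.tgt g), Φ.arr g), Φ.src_arr g, Φ.tgt_arr g⟩ :
      G.Arr → {p : (G.Obj × G.Obj) × H.Arr //
        H.src p.2 = Φ.obj p.1.1 ∧ H.tgt p.2 = Φ.obj p.1.2})

/-- Topological Morita equivalence. -/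
def MoritaEquivalent : Prop :=
  ∃ (K : TopGroupoid.{u}) (Φ : K.Hom G) (Ψ : K.Hom H),
    Φ.IsEssentialEquivalence ∧ Ψ.IsEssentialEquivalence

end TopGroupoid

/-! ### Orbit space definable groupoids and their invariants -/

/-- The groupoid `G` is orbit space definable by means of the map `ι : |G| → ℝⁿ`. -/
structure IsOrbitSpaceDefinable (S : OMinimalStructure) (G : TopGroupoid.{u}) {n : ℕ}
    (ι : G.OrbitSpace → Fin n → ℝ) : Prop where
  isEmbedding : IsEmbedding ι
  definable_range : S.Definable (range ι)
  compactLie : ∀ x, IsCompactLieGroup (G.Isotropy x)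
  finite_types : (range G.weakOrbitType).Finite
  definable_types : ∀ x, S.Definable (ι '' G.weakOrbitType x)

/-- An orbit space definable groupoid. -/
structure OSDGroupoid (S : OMinimalStructure) : Type (u + 1) where
  gpd : TopGroupoid.{u}
  dim : ℕ
  ι : gpd.OrbitSpace → Fin dim → ℝ
  isOSD : IsOrbitSpaceDefinable S gpd ι

namespace OSDGroupoid

variable {S : OMinimalStructure}

instance (G : OSDGroupoid.{u} S) : T2Space G.gpd.OrbitSpace :=
  G.isOSD.isEmbedding.t2Space

/-- `G` is isotropy locally trivial: there is a finite partition of `|G|` into cells, each of them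
contained in a weak orbit type `|G|_[H]` and such that the restriction of `G` to the cell `C` is
topologically Morita equivalent to `H ⋉ C` with trivial action. -/
def IsotropyLocallyTrivial (G : OSDGroupoid.{u} S) : Prop :=
  ∃ P, S.IsCellPartition (range G.ι) P ∧
    ∀ c ∈ P, ∃ x : G.gpd.Obj, G.ι ⁻¹' c.1 ⊆ G.gpd.weakOrbitType x ∧
      (G.gpd.overOrbits (G.ι ⁻¹' c.1)).MoritaEquivalent
        (TopGroupoid.trivialAction (G.gpd.Isotropy x) (G.ι ⁻¹' c.1))

/-- The embedding of the orbit space of the restriction of `G` to the orbits in `X`. -/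
def restrictι (G : OSDGroupoid.{u} S) (X : Set G.gpd.OrbitSpace) :
    (G.gpd.overOrbits X).OrbitSpace → Fin G.dim → ℝ :=
  fun o => G.ι (G.gpd.restrictOrbit _ o)

/-- The product of the embeddings of `|G|` and `|H|`. -/
def prodι (G H : OSDGroupoid.{u} S) :
    (G.gpd.prod H.gpd).OrbitSpace → Fin (G.dim + H.dim) → ℝ :=
  fun o => Fin.append (G.ι (G.gpd.fstOrbit H.gpd o)) (H.ι (G.gpd.sndOrbit H.gpd o))

variable {R : Type v}

/-- `I` is a topological invariant: it takes the same value on Morita equivalent groupoids. -/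
def IsTopologicalInvariant (I : OSDGroupoid.{u} S → R) : Prop :=
  ∀ G H : OSDGroupoid.{u} S, G.gpd.MoritaEquivalent H.gpd → I G = I H

/-- `I` is additive on the groupoids in the class `𝒞`: if `|G|` is the disjoint union of the orbit
spaces of two orbit space definable subgroupoids, `I(G)` is the sum of their invariants. -/
def AdditiveOn [Add R] (𝒞 : OSDGroupoid.{u} S → Prop) (I : OSDGroupoid.{u} S → R) : Prop :=
  ∀ G : OSDGroupoid.{u} S, 𝒞 G → ∀ (X : Set G.gpd.OrbitSpace)
    (h₁ : IsOrbitSpaceDefinable S (G.gpd.overOrbits X) (G.restrictι X))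
    (h₂ : IsOrbitSpaceDefinable S (G.gpd.overOrbits Xᶜ) (G.restrictι Xᶜ)),
    I G = I ⟨_, _, _, h₁⟩ + I ⟨_, _, _, h₂⟩

/-- `I` is multiplicative on the groupoids in the class `𝒞`. -/
def MultiplicativeOn [Mul R] (𝒞 : OSDGroupoid.{u} S → Prop) (I : OSDGroupoid.{u} S → R) : Prop :=
  ∀ G H : OSDGroupoid.{u} S, 𝒞 G → 𝒞 H →
    ∀ h : IsOrbitSpaceDefinable S (G.gpd.prod H.gpd) (G.prodι H),
      I ⟨_, _, _, h⟩ = I G * I H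

/-- `I` takes the value `1` on groupoids with one object and one arrow. -/
def Normalized [One R] (I : OSDGroupoid.{u} S → R) : Prop :=
  ∀ G : OSDGroupoid.{u} S, Nonempty G.gpd.Obj → Subsingleton G.gpd.Arr → I G = 1

/-- The function `Gx ↦ T^[G_x^x]` on the orbit space. -/
def isotropyT (G : OSDGroupoid.{u} S) (o : G.gpd.OrbitSpace) : CompactLieGrp.UnivRing.{u} :=
  CompactLieGrp.T (G.gpd.isotropyClass G.isOSD.compactLie o)

end OSDGroupoid

end

/-! Over a cell `C` of the orbit space an isotropy locally trivial groupoid looks like `H ⋉ C` with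
trivial action. An additive invariant should therefore be the sum over such cells of `(-1) ^ dim C`
times its value on `H`, regarded as a groupoid over a point. This sum is the integral in the
theorem, with `r(T^[H]) = I(H ⋉ pt)`.

For the direct implication fix `H`. The function `D ↦ I(H ⋉ D)` on definable sets is additive and
invariant under all homeomorphisms, definable or not. A cylinder `Y × ℝ` consists of `Y × 0` and two
open halves, each homeomorphic to the whole cylinder, so its value is minus that of `Y`. Bands
behave in the same way, hence the value on `D` is `χ(D) • I(H ⋉ pt)` (`IsAdditiveInvariant.cell`,
`IsAdditiveInvariant.eq_sum`).

A general groupoid has to be cut into pieces over which it is trivial. Here the topology matters: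
the orbit space of a restriction carries its own quotient topology, which may be finer than the
subspace topology, and additivity applies only if both pieces are orbit space definable. The two
topologies agree over locally closed sets. Cells are locally closed but unions of cells need not be,
so the cutting is done along finitely many open sets, one after the other, until each piece lies in
one cell (`eq_isotropyIntegral_of_pattern`). Multiplicativity on one-object groupoids makes `[H] ↦
I(H ⋉ pt)` multiplicative. As the `T^[H]` span the universal ring additively, this extends to a
homomorphism `r`, and `r` is unique because the formula at `H ⋉ pt` prescribes `r(T^[H])`.

Conversely, the integral is additive because definable sets of orbits have cell partitions refining
the given one, and multiplicative because products of cells are cells whose dimensions add up, while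
`T` turns products of groups into products (`isotropyIntegral_add`, `isotropyIntegral_mul`).

Two facts of o-minimal geometry are proved on the way. The first is cell decomposition
(`hasCellDecomposition`), by induction on the ambient dimension. A Baire category argument shows
that a definable family of finite subsets of `ℝ` varies continuously near a dense set of parameters;
this does the work of the monotonicity and uniform finiteness theorems. The second is that the Euler
characteristic does not depend on the partition: the alternating sum over the cells is an iterated
integral of the indicator function of their union (`IsCellPartition.sum_eq_iteratedIntegral`). -/

noncomputable section

/-! ### Definability calculus -/

/-- A type with a chosen coordinate system, identifying it with some `ℝⁿ`. -/
class DefSpace (E : Type) where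
  dim : ℕ
  coord : E ≃ (Fin dim → ℝ)

namespace DefSpace

instance instPi (n : ℕ) : DefSpace (Fin n → ℝ) := ⟨n, Equiv.refl _⟩

instance instReal : DefSpace ℝ := ⟨1, (Equiv.funUnique (Fin 1) ℝ).symm⟩

instance instProd (E F : Type) [DefSpace E] [DefSpace F] : DefSpace (E × F) :=
  ⟨dim E + dim F, (Equiv.prodCongr coord coord).trans (Fin.appendEquiv _ _)⟩

/-- A map each of whose coordinates is one of the coordinates of its argument. -/
def Reindex {E F : Type} [DefSpace E] [DefSpace F] (φ : E → F) : Prop :=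
  ∃ σ : Fin (dim F) → Fin (dim E), ∀ e i, coord (φ e) i = coord e (σ i)

variable {E F G : Type} [DefSpace E] [DefSpace F] [DefSpace G]

theorem coord_prod (p : E × F) : coord p = Fin.append (coord p.1) (coord p.2) := rfl

theorem reindex_id : Reindex (fun e : E => e) := ⟨id, fun _ _ => rfl⟩

theorem Reindex.comp {φ : F → G} {ψ : E → F} (h : Reindex φ) (h' : Reindex ψ) :
    Reindex fun e => φ (ψ e) := by
  obtain ⟨σ, hσ⟩ := h
  obtain ⟨τ, hτ⟩ := h'
  exact ⟨fun i => τ (σ i), fun e i => by rw [hσ, hτ]⟩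

theorem reindex_fst : Reindex (Prod.fst : E × F → E) :=
  ⟨Fin.castAdd _, fun e i => by rw [coord_prod, Fin.append_left]⟩

theorem reindex_snd : Reindex (Prod.snd : E × F → F) :=
  ⟨Fin.natAdd _, fun e i => by rw [coord_prod, Fin.append_right]⟩

theorem Reindex.prodMk {φ : E → F} {ψ : E → G} (h : Reindex φ) (h' : Reindex ψ) :
    Reindex fun e => (φ e, ψ e) := by
  obtain ⟨σ, hσ⟩ := h
  obtain ⟨τ, hτ⟩ := h'
  refine ⟨Fin.addCases σ τ, fun e i => ?_⟩
  rw [coord_prod]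
  induction i using Fin.addCases with
  | left i => rw [Fin.append_left, hσ]; simp
  | right i => rw [Fin.append_right, hτ]; simp

theorem reindex_pi {n : ℕ} {φ : E → Fin n → ℝ} (h : ∀ i, Reindex fun e => φ e i) :
    Reindex φ := by
  choose σ hσ using h
  exact ⟨fun i => σ i 0, fun e i => hσ i e 0⟩

theorem reindex_apply {n : ℕ} (i : Fin n) : Reindex fun x : Fin n → ℝ => x i :=
  ⟨fun _ => i, fun _ _ => rfl⟩

theorem Reindex.apply {n : ℕ} {φ : E → Fin n → ℝ} (h : Reindex φ) (i : Fin n) :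
    Reindex fun e => φ e i :=
  (reindex_apply i).comp h

end DefSpace

/-! ### First-order closure properties of definable sets and maps. -/

namespace OMinimalStructure

open DefSpace

variable (S : OMinimalStructure)

variable {S} in
theorem definable_congr {n : ℕ} {A B : Set (Fin n → ℝ)} (hA : S.Definable A)
    (h : ∀ x, x ∈ B ↔ x ∈ A) : S.Definable B := by
  rwa [Set.ext h]

theorem definable_append_exists {m : ℕ} : ∀ {n : ℕ} {A : Set (Fin (m + n) → ℝ)},
    S.Definable A → S.Definable {x : Fin m → ℝ | ∃ y : Fin n → ℝ, Fin.append x y ∈ A}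
  | 0, A, hA => by
    refine definable_congr hA fun x => ?_
    constructor
    · rintro ⟨y, hy⟩
      have e : Fin.append x y = x := by
        rw [Subsingleton.elim y Fin.elim0, Fin.append_elim0]; rfl
      rw [← e]; exact hy
    · intro hx
      refine ⟨Fin.elim0, ?_⟩
      have e : Fin.append x Fin.elim0 = x := by
        rw [Fin.append_elim0]; rfl
      rw [e]; exact hx
  | n + 1, A, hA => by
    have h := definable_append_exists (S.projection (n := m + n) hA)
    refine definable_congr h fun x => ?_
    constructor
    · rintro ⟨y, hy⟩
      refine ⟨Fin.init (α := fun _ => ℝ) y, _, hy, ?_⟩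
      ext i
      induction i using Fin.addCases with
      | left i =>
        rw [Fin.append_left]
        exact Fin.append_left x y i
      | right i =>
        rw [Fin.append_right]
        exact Fin.append_right x y i.castSucc
    · rintro ⟨y, z, hz, e⟩
      refine ⟨fun j => z (Fin.natAdd m j), ?_⟩
      have : Fin.append x (fun j : Fin (n + 1) => z (Fin.natAdd m j)) = z := by
       ext i
       induction i using Fin.addCases with
       | left i =>
         rw [Fin.append_left]
         have := congrFun e (Fin.castAdd n i)
         rw [Fin.append_left] at this
         exact this.symm
       | right i => rw [Fin.append_right]
      rw [this]
      exact hz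

/-- Definability of subsets of a space with coordinates. -/
def Def {E : Type} [DefSpace E] (A : Set E) : Prop :=
  S.Definable {x : Fin (dim E) → ℝ | coord.symm x ∈ A}

/-- Definability of maps between spaces with coordinates. -/
def DefFun {E F : Type} [DefSpace E] [DefSpace F] (φ : E → F) : Prop :=
  S.Def {p : E × F | p.2 = φ p.1}

variable {S} {E F G : Type} [DefSpace E] [DefSpace F] [DefSpace G]

theorem def_iff {n : ℕ} {A : Set (Fin n → ℝ)} : S.Def A ↔ S.Definable A := Iff.rfl

theorem Def.congr {A B : Set E} (hA : S.Def A) (h : ∀ x, x ∈ B ↔ x ∈ A) : S.Def B := by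
  rwa [Set.ext h]

theorem Def.reindex {A : Set F} (hA : S.Def A) {φ : E → F} (hφ : Reindex φ) :
    S.Def {e | φ e ∈ A} := by
  obtain ⟨σ, hσ⟩ := hφ
  have := S.substitution σ hA
  refine definable_congr this fun x => ?_
  have e : coord.symm (fun i => x (σ i)) = φ (coord.symm x) := by
    rw [Equiv.symm_apply_eq]
    ext i
    rw [hσ, Equiv.apply_symm_apply]
  change φ (coord.symm x) ∈ A ↔ coord.symm (fun i => x (σ i)) ∈ A
  rw [e]

theorem Def.and {p q : E → Prop} (hp : S.Def {e | p e}) (hq : S.Def {e | q e}) :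
    S.Def {e | p e ∧ q e} := by
  have := S.compl (S.union (S.compl hp) (S.compl hq))
  refine definable_congr this fun x => ?_
  simp

theorem Def.or {p q : E → Prop} (hp : S.Def {e | p e}) (hq : S.Def {e | q e}) :
    S.Def {e | p e ∨ q e} := S.union hp hq

theorem Def.not {p : E → Prop} (hp : S.Def {e | p e}) : S.Def {e | ¬ p e} := S.compl hp

theorem Def.imp {p q : E → Prop} (hp : S.Def {e | p e}) (hq : S.Def {e | q e}) :
    S.Def {e | p e → q e} := by
  exact (hp.not.or hq).congr fun x => imp_iff_not_or

theorem def_univ : S.Def (univ : Set E) := by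
  have := S.polynomial_pos (n := dim E) 1
  refine definable_congr this fun x => ?_
  simp

theorem Def.compl {A : Set E} (hA : S.Def A) : S.Def Aᶜ := S.compl hA

theorem Def.inter {A B : Set E} (hA : S.Def A) (hB : S.Def B) : S.Def (A ∩ B) := Def.and hA hB

theorem Def.union {A B : Set E} (hA : S.Def A) (hB : S.Def B) : S.Def (A ∪ B) := Def.or hA hB

theorem Def.diff {A B : Set E} (hA : S.Def A) (hB : S.Def B) : S.Def (A \ B) :=
  hA.inter hB.compl

theorem Def.ball_finset {ι : Type*} (s : Finset ι) {p : ι → E → Prop}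
    (hp : ∀ i ∈ s, S.Def {e | p i e}) : S.Def {e | ∀ i ∈ s, p i e} := by
  classical
  induction s using Finset.induction_on with
  | empty => simpa using def_univ
  | insert a s ha ih =>
    simp only [Finset.forall_mem_insert]
    exact (hp a (by simp)).and (ih fun i hi => hp i (by simp [hi]))

theorem Def.bex_finset {ι : Type*} (s : Finset ι) {p : ι → E → Prop}
    (hp : ∀ i ∈ s, S.Def {e | p i e}) : S.Def {e | ∃ i ∈ s, p i e} := by
  exact (Def.ball_finset s (p := fun i e => ¬ p i e) fun i hi => (hp i hi).not).not.congr
    fun x => by simp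

theorem Def.forall_fin {n : ℕ} {p : Fin n → E → Prop}
    (hp : ∀ i, S.Def {e | p i e}) : S.Def {e | ∀ i, p i e} := by
  simpa using Def.ball_finset Finset.univ (p := p) fun i _ => hp i

/-- Quantification over a space with coordinates is a repeated coordinate projection. With the
Boolean operations and substitution, definability can then be read off from the shape of a
first-order formula; the later definability proofs follow this pattern. -/
theorem Def.ex {p : E → F → Prop} (hp : S.Def {q : E × F | p q.1 q.2}) :
    S.Def {e | ∃ f, p e f} := by
  have := S.definable_append_exists (m := dim E) (n := dim F) hp
  refine definable_congr this fun x => ?_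
  have key : ∀ y : Fin (dim F) → ℝ,
      (coord.symm (Fin.append x y) : E × F) = (coord.symm x, coord.symm y) := fun y => by
    rw [Equiv.symm_apply_eq, coord_prod]; simp
  constructor
  · rintro ⟨f, hf⟩
    refine ⟨coord f, ?_⟩
    change (coord.symm (Fin.append x (coord f)) : E × F) ∈ {q : E × F | p q.1 q.2}
    rw [key]; simpa using hf
  · rintro ⟨y, hy⟩
    change (coord.symm (Fin.append x y) : E × F) ∈ {q : E × F | p q.1 q.2} at hy
    rw [key] at hy
    exact ⟨_, hy⟩

theorem Def.all {p : E → F → Prop} (hp : S.Def {q : E × F | p q.1 q.2}) :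
    S.Def {e | ∀ f, p e f} := by
  exact (Def.ex (p := fun e f => ¬ p e f) hp.not).not.congr fun x => by simp

theorem def_lt_coord : S.Def {p : ℝ × ℝ | p.1 < p.2} := by
  have := S.polynomial_pos (n := 2) (MvPolynomial.X 1 - MvPolynomial.X 0)
  refine definable_congr this fun x => ?_
  simp only [mem_ofPred_eq, map_sub, MvPolynomial.eval_X, sub_pos]
  exact Iff.rfl

theorem def_eq_coord : S.Def {p : ℝ × ℝ | p.1 = p.2} := by
  refine ((def_lt_coord (S := S)).not.and
    ((def_lt_coord (S := S)).reindex (reindex_snd.prodMk reindex_fst)).not).congr fun p => ?_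
  simp only [mem_ofPred_eq, not_lt]
  exact ⟨fun h => ⟨h.ge, h.le⟩, fun h => le_antisymm h.2 h.1⟩

theorem def_sub_coord : S.Def {p : (ℝ × ℝ) × ℝ | p.2 = p.1.1 - p.1.2} := by
  have h1 := S.polynomial_pos (n := 3)
    (MvPolynomial.X 2 - MvPolynomial.X 0 + MvPolynomial.X 1)
  have h2 := S.polynomial_pos (n := 3)
    (-(MvPolynomial.X 2 - MvPolynomial.X 0 + MvPolynomial.X 1))
  refine definable_congr ((def_iff.2 h1).compl.inter (def_iff.2 h2).compl) fun x => ?_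
  simp only [mem_inter_iff, mem_compl_iff]
  simp only [mem_ofPred_eq, map_sub, map_add, map_neg, MvPolynomial.eval_X, not_lt]
  change x 2 = x 0 - x 1 ↔ x 2 - x 0 + x 1 ≤ 0 ∧ -(x 2 - x 0 + x 1) ≤ 0
  constructor
  · intro h; rw [h]; constructor <;> linarith
  · rintro ⟨h, h'⟩; linarith

theorem _root_.DefSpace.Reindex.defFun {φ : E → F} (h : Reindex φ) : S.DefFun φ := by
  obtain ⟨σ, hσ⟩ := h
  have : S.Def {p : E × F | ∀ i, coord p.2 i = coord p.1 (σ i)} := by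
    refine Def.forall_fin fun i => ?_
    refine (def_eq_coord (S := S)).reindex (φ := fun p : E × F => (coord p.2 i, coord p.1 (σ i)))
      (Reindex.prodMk ?_ ?_)
    · exact Reindex.comp (φ := fun f : F => coord f i) ⟨fun _ => i, fun _ _ => rfl⟩ reindex_snd
    · exact Reindex.comp (φ := fun f : E => coord f (σ i)) ⟨fun _ => σ i, fun _ _ => rfl⟩
        reindex_fst
  refine this.congr fun p => ?_
  simp only [mem_ofPred_eq]
  rw [← coord.injective.eq_iff, funext_iff]
  simp only [hσ]

theorem Def.preimage {A : Set F} (hA : S.Def A) {φ : E → F} (hφ : S.DefFun φ) :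
    S.Def {e | φ e ∈ A} := by
  have : S.Def {e | ∃ f, f = φ e ∧ f ∈ A} :=
    Def.ex (p := fun e f => f = φ e ∧ f ∈ A) (Def.and hφ (hA.reindex reindex_snd))
  simpa using this

theorem DefFun.comp {φ : F → G} {ψ : E → F} (h : S.DefFun φ) (h' : S.DefFun ψ) :
    S.DefFun fun e => φ (ψ e) := by
  have : S.Def {p : E × G | ∃ f, f = ψ p.1 ∧ p.2 = φ f} := by
    refine Def.ex (p := fun (p : E × G) (f : F) => f = ψ p.1 ∧ p.2 = φ f) (Def.and ?_ ?_)
    · exact Def.reindex h' (φ := fun q : (E × G) × F => (q.1.1, q.2))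
        ((reindex_fst.comp reindex_fst).prodMk reindex_snd)
    · exact Def.reindex h (φ := fun q : (E × G) × F => (q.2, q.1.2))
        (reindex_snd.prodMk (reindex_snd.comp reindex_fst))
  simpa [DefFun] using this

theorem defFun_id : S.DefFun (fun e : E => e) := reindex_id.defFun

theorem defFun_fst : S.DefFun (Prod.fst : E × F → E) := reindex_fst.defFun

theorem defFun_snd : S.DefFun (Prod.snd : E × F → F) := reindex_snd.defFun

theorem DefFun.fst {φ : E → F × G} (h : S.DefFun φ) : S.DefFun fun e => (φ e).1 :=
  defFun_fst.comp h

theorem DefFun.snd {φ : E → F × G} (h : S.DefFun φ) : S.DefFun fun e => (φ e).2 :=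
  defFun_snd.comp h

theorem DefFun.prodMk {φ : E → F} {ψ : E → G} (h : S.DefFun φ) (h' : S.DefFun ψ) :
    S.DefFun fun e => (φ e, ψ e) := by
  have : S.Def {p : E × (F × G) | p.2.1 = φ p.1 ∧ p.2.2 = ψ p.1} := by
    refine Def.and ?_ ?_
    · exact Def.reindex h (φ := fun p : E × (F × G) => (p.1, p.2.1))
        (reindex_fst.prodMk (reindex_fst.comp reindex_snd))
    · exact Def.reindex h' (φ := fun p : E × (F × G) => (p.1, p.2.2))
        (reindex_fst.prodMk (reindex_snd.comp reindex_snd))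
  simpa only [DefFun, Prod.ext_iff] using this

theorem DefFun.apply {n : ℕ} {φ : E → Fin n → ℝ} (h : S.DefFun φ) (i : Fin n) :
    S.DefFun fun e => φ e i :=
  (reindex_apply i).defFun.comp h

theorem defFun_pi {n : ℕ} {φ : E → Fin n → ℝ} (h : ∀ i, S.DefFun fun e => φ e i) :
    S.DefFun φ := by
  have : S.Def {p : E × (Fin n → ℝ) | ∀ i, p.2 i = φ p.1 i} := by
    refine Def.forall_fin fun i => ?_
    exact Def.reindex (h i) (φ := fun p : E × (Fin n → ℝ) => (p.1, p.2 i))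
        (reindex_fst.prodMk (reindex_snd.apply i))
  simpa only [DefFun, funext_iff] using this

theorem def_lt {f g : E → ℝ} (hf : S.DefFun f) (hg : S.DefFun g) : S.Def {e | f e < g e} :=
  (def_lt_coord (S := S)).preimage (hf.prodMk hg)

theorem def_eq {f g : E → ℝ} (hf : S.DefFun f) (hg : S.DefFun g) : S.Def {e | f e = g e} :=
  (def_eq_coord (S := S)).preimage (hf.prodMk hg)

theorem def_eq_pi {n : ℕ} {f g : E → Fin n → ℝ} (hf : S.DefFun f) (hg : S.DefFun g) :
    S.Def {e | f e = g e} := by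
  simp only [funext_iff]
  exact Def.forall_fin fun i => def_eq (hf.apply i) (hg.apply i)

theorem DefFun.sub {f g : E → ℝ} (hf : S.DefFun f) (hg : S.DefFun g) :
    S.DefFun fun e => f e - g e :=
  DefFun.comp (φ := fun p : ℝ × ℝ => p.1 - p.2) def_sub_coord (hf.prodMk hg)

theorem defFun_const (c : ℝ) : S.DefFun fun _ : E => c := by
  have h : S.DefFun fun _ : Fin 0 → ℝ => c := by
    have h1 := S.polynomial_pos (n := 1) (MvPolynomial.X 0 - MvPolynomial.C c)
    have h2 := S.polynomial_pos (n := 1) (-(MvPolynomial.X 0 - MvPolynomial.C c))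
    have := ((def_iff.2 h1).compl.inter (def_iff.2 h2).compl).reindex (φ := fun p : (Fin 0 → ℝ) × ℝ => fun _ => p.2)
        (reindex_pi fun _ => reindex_snd)
    refine this.congr fun p => ?_
    simp only [mem_inter_iff, mem_compl_iff]
    simp only [mem_ofPred_eq, map_sub, map_neg, MvPolynomial.eval_X, MvPolynomial.eval_C, not_lt]
    constructor
    · intro h; rw [h]; constructor <;> linarith
    · rintro ⟨h, h'⟩; linarith
  exact DefFun.comp (φ := fun _ : Fin 0 → ℝ => c) (ψ := fun _ : E => Fin.elim0) h
    (defFun_pi fun i => i.elim0)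

theorem DefFun.init {n : ℕ} {φ : E → Fin (n + 1) → ℝ} (h : S.DefFun φ) :
    S.DefFun fun e => Fin.init (α := fun _ => ℝ) (φ e) :=
  defFun_pi fun i => h.apply i.castSucc

theorem DefFun.snoc {n : ℕ} {φ : E → Fin n → ℝ} {f : E → ℝ} (h : S.DefFun φ)
    (hf : S.DefFun f) : S.DefFun fun e => Fin.snoc (α := fun _ => ℝ) (φ e) (f e) :=
  defFun_pi fun i => by
    induction i using Fin.lastCases with
    | last => simpa using hf
    | cast i => simpa using h.apply i

theorem Def.snoc {n : ℕ} {A : Set (Fin (n + 1) → ℝ)} (hA : S.Def A) {φ : E → Fin n → ℝ}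
    {f : E → ℝ} (h : S.DefFun φ) (hf : S.DefFun f) :
    S.Def {e | Fin.snoc (α := fun _ => ℝ) (φ e) (f e) ∈ A} :=
  hA.preimage (h.snoc hf)

theorem def_abs_sub_lt {f g h : E → ℝ} (hf : S.DefFun f) (hg : S.DefFun g) (hh : S.DefFun h) :
    S.Def {e | |f e - g e| < h e} := by
  refine ((def_lt (hg.sub hf) hh).and (def_lt (hf.sub hg) hh)).congr fun e => ?_
  simp only [mem_ofPred_eq, abs_lt]
  rw [neg_lt, neg_sub]

/-- In the sup metric a ball is a finite conjunction of coordinate conditions. Positivity of the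
radius belongs to the condition because for `n = 0` the conjunction is empty. -/
theorem def_dist_lt {n : ℕ} {f g : E → Fin n → ℝ} {h : E → ℝ} (hf : S.DefFun f)
    (hg : S.DefFun g) (hh : S.DefFun h) : S.Def {e | 0 < h e ∧ dist (f e) (g e) < h e} := by
  have : S.Def {e | 0 < h e ∧ ∀ i, |f e i - g e i| < h e} :=
    (def_lt (defFun_const 0) hh).and
      (Def.forall_fin fun i => def_abs_sub_lt (hf.apply i) (hg.apply i) hh)
  refine this.congr fun e => ?_
  refine and_congr_right fun h0 => ?_
  rw [dist_pi_lt_iff h0]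
  rfl

theorem Def.closure {n : ℕ} {A : Set (Fin n → ℝ)} (hA : S.Def A) : S.Def (closure A) := by
  have : S.Def {x : Fin n → ℝ | ∀ ε : ℝ, 0 < ε → ∃ y, y ∈ A ∧ 0 < ε ∧ dist x y < ε} := by
    refine Def.all (p := fun (x : Fin n → ℝ) (ε : ℝ) =>
      0 < ε → ∃ y, y ∈ A ∧ 0 < ε ∧ dist x y < ε) (Def.imp (def_lt (defFun_const 0) defFun_snd) ?_)
    refine Def.ex (p := fun (q : (Fin n → ℝ) × ℝ) (y : Fin n → ℝ) =>
      y ∈ A ∧ 0 < q.2 ∧ dist q.1 y < q.2) (Def.and (hA.preimage defFun_snd) ?_)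
    exact def_dist_lt defFun_fst.fst defFun_snd defFun_fst.snd
  refine this.congr fun x => ?_
  rw [Metric.mem_closure_iff]
  simp only [mem_ofPred_eq]
  exact forall_congr' fun ε => ⟨fun h h0 => let ⟨y, hy, hd⟩ := h h0; ⟨y, hy, h0, hd⟩,
    fun h h0 => let ⟨y, hy, _, hd⟩ := h h0; ⟨y, hy, hd⟩⟩

theorem DefContOn.def_graph {n : ℕ} {f : (Fin n → ℝ) → ℝ} {Y : Set (Fin n → ℝ)}
    (h : S.DefContOn f Y) {φ : E → Fin n → ℝ} {g : E → ℝ} (hφ : S.DefFun φ) (hg : S.DefFun g) :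
    S.Def {e | φ e ∈ Y ∧ g e = f (φ e)} := by
  have := Def.snoc (def_iff.2 h.2) hφ hg
  simpa using this

/-- Only the graph of `f` over `Y` is definable, not `f` as a total function, so the value `f (φ e)`
enters through an existential quantifier over that graph. -/
theorem DefContOn.def_rel {n : ℕ} {f : (Fin n → ℝ) → ℝ} {Y : Set (Fin n → ℝ)}
    (h : S.DefContOn f Y) {φ : E → Fin n → ℝ} (hφ : S.DefFun φ) {p : E → ℝ → Prop}
    (hp : S.Def {q : E × ℝ | p q.1 q.2}) : S.Def {e | φ e ∈ Y ∧ p e (f (φ e))} := by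
  have : S.Def {e | ∃ t, (φ e ∈ Y ∧ t = f (φ e)) ∧ p e t} :=
    Def.ex (p := fun e t => (φ e ∈ Y ∧ t = f (φ e)) ∧ p e t)
      (Def.and (h.def_graph (hφ.comp defFun_fst) defFun_snd) hp)
  refine this.congr fun e => ?_
  simp only [mem_ofPred_eq]
  aesop

theorem IsCell.def {n d : ℕ} {C : Set (Fin n → ℝ)} (h : S.IsCell C d) : S.Def C := by
  induction h with
  | point => exact def_univ
  | graph f hY hf ih =>
    exact hf.2
  | @band n d Y lo hi hY hlo hhi hlt ih =>
    have h0 : S.Def {x : Fin (n + 1) → ℝ | Fin.init (α := fun _ => ℝ) x ∈ Y} :=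
      ih.preimage defFun_id.init
    have h1 : S.Def {x : Fin (n + 1) → ℝ | Fin.init (α := fun _ => ℝ) x ∈ Y ∧
        ∀ f ∈ lo, f (Fin.init (α := fun _ => ℝ) x) < x (Fin.last n)} := by
      cases lo with
      | none => simpa using h0
      | some f =>
        simp only [Option.mem_def, Option.some.injEq, forall_eq']
        exact (hlo f rfl).def_rel (p := fun x t => t < x (Fin.last n)) defFun_id.init
          (def_lt defFun_snd (defFun_fst.apply _))
    have h2 : S.Def {x : Fin (n + 1) → ℝ | Fin.init (α := fun _ => ℝ) x ∈ Y ∧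
        ∀ f ∈ hi, x (Fin.last n) < f (Fin.init (α := fun _ => ℝ) x)} := by
      cases hi with
      | none => simpa using h0
      | some f =>
        simp only [Option.mem_def, Option.some.injEq, forall_eq']
        exact (hhi f rfl).def_rel (p := fun x t => x (Fin.last n) < t) defFun_id.init
          (def_lt (defFun_fst.apply _) defFun_snd)
    refine Def.congr (E := Fin (n + 1) → ℝ) (h1.and h2) fun x => ?_
    simp only [mem_ofPred_eq]
    tauto

/-- A definable subset of a cell restricts definable continuous functions. -/
theorem DefContOn.mono {n : ℕ} {f : (Fin n → ℝ) → ℝ} {Y Z : Set (Fin n → ℝ)}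
    (h : S.DefContOn f Y) (hZ : S.Def Z) (hZY : Z ⊆ Y) : S.DefContOn f Z := by
  refine ⟨h.1.mono hZY, def_iff.1 ?_⟩
  refine ((def_iff.2 h.2).inter (hZ.preimage (φ := fun x : Fin (n + 1) → ℝ =>
    Fin.init (α := fun _ => ℝ) x) defFun_id.init)).congr fun x => ?_
  simp only [mem_inter_iff]
  simp only [mem_ofPred_eq]
  exact ⟨fun h => ⟨⟨hZY h.1, h.2⟩, h.1⟩, fun h => ⟨h.2, h.1.2⟩⟩

end OMinimalStructure

end

noncomputable section

/-! ### Topology of cells -/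

local notation "ini" => Fin.init (α := fun _ => ℝ)
local notation "snc" => Fin.snoc (α := fun _ => ℝ)

theorem continuous_fin_init {n : ℕ} : Continuous fun x : Fin (n + 1) → ℝ => ini x :=
  continuous_pi fun i => continuous_apply i.castSucc

theorem continuous_fin_snoc {n : ℕ} :
    Continuous fun p : (Fin n → ℝ) × ℝ => (snc p.1 p.2 : Fin (n + 1) → ℝ) := by
  refine continuous_pi fun i => ?_
  induction i using Fin.lastCases with
  | last => simpa using continuous_snd
  | cast i => simp only [Fin.snoc_castSucc]; fun_prop

namespace OMinimalStructure

variable {S : OMinimalStructure}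

theorem exists_isOpen_lt {n : ℕ} {Y : Set (Fin n → ℝ)} {f : (Fin n → ℝ) → ℝ}
    (hf : ContinuousOn f Y) : ∃ u : Set (Fin (n + 1) → ℝ), IsOpen u ∧
      ∀ x : Fin (n + 1) → ℝ, ini x ∈ Y → (x ∈ u ↔ f (ini x) < x (Fin.last n)) := by
  have hg : ContinuousOn (fun x : Fin (n + 1) → ℝ => x (Fin.last n) - f (ini x))
      {x | ini x ∈ Y} :=
    (continuous_apply _).continuousOn.sub (hf.comp continuous_fin_init.continuousOn fun x hx => hx)
  obtain ⟨u, hu, h⟩ := continuousOn_iff'.1 hg (Ioi 0) isOpen_Ioi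
  refine ⟨u, hu, fun x hx => ?_⟩
  have := Set.ext_iff.1 h x
  simp only [mem_inter_iff, mem_preimage, mem_Ioi, sub_pos, mem_ofPred_eq] at this
  tauto

theorem exists_isOpen_gt {n : ℕ} {Y : Set (Fin n → ℝ)} {f : (Fin n → ℝ) → ℝ}
    (hf : ContinuousOn f Y) : ∃ u : Set (Fin (n + 1) → ℝ), IsOpen u ∧
      ∀ x : Fin (n + 1) → ℝ, ini x ∈ Y → (x ∈ u ↔ x (Fin.last n) < f (ini x)) := by
  have hg : ContinuousOn (fun x : Fin (n + 1) → ℝ => f (ini x) - x (Fin.last n))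
      {x | ini x ∈ Y} :=
    (hf.comp continuous_fin_init.continuousOn fun x hx => hx).sub (continuous_apply _).continuousOn
  obtain ⟨u, hu, h⟩ := continuousOn_iff'.1 hg (Ioi 0) isOpen_Ioi
  refine ⟨u, hu, fun x hx => ?_⟩
  have := Set.ext_iff.1 h x
  simp only [mem_inter_iff, mem_preimage, mem_Ioi, sub_pos, mem_ofPred_eq] at this
  tauto

/-- A band over `Y` is relatively open in the cylinder over `Y`. -/
theorem exists_isOpen_band {n : ℕ} {Y : Set (Fin n → ℝ)} {lo hi : Option ((Fin n → ℝ) → ℝ)}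
    (hlo : ∀ f ∈ lo, ContinuousOn f Y) (hhi : ∀ g ∈ hi, ContinuousOn g Y) :
    ∃ u : Set (Fin (n + 1) → ℝ), IsOpen u ∧
      {x : Fin (n + 1) → ℝ | ini x ∈ Y ∧ (∀ f ∈ lo, f (ini x) < x (Fin.last n)) ∧
        (∀ g ∈ hi, x (Fin.last n) < g (ini x))} = {x | ini x ∈ Y} ∩ u := by
  have h1 : ∃ u : Set (Fin (n + 1) → ℝ), IsOpen u ∧ ∀ x : Fin (n + 1) → ℝ, ini x ∈ Y →
      (x ∈ u ↔ ∀ f ∈ lo, f (ini x) < x (Fin.last n)) := by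
    cases lo with
    | none => exact ⟨univ, isOpen_univ, fun x _ => by simp⟩
    | some f => simpa using exists_isOpen_lt (hlo f rfl)
  have h2 : ∃ u : Set (Fin (n + 1) → ℝ), IsOpen u ∧ ∀ x : Fin (n + 1) → ℝ, ini x ∈ Y →
      (x ∈ u ↔ ∀ f ∈ hi, x (Fin.last n) < f (ini x)) := by
    cases hi with
    | none => exact ⟨univ, isOpen_univ, fun x _ => by simp⟩
    | some f => simpa using exists_isOpen_gt (hhi f rfl)
  obtain ⟨u, hu, hu'⟩ := h1
  obtain ⟨w, hw, hw'⟩ := h2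
  refine ⟨u ∩ w, hu.inter hw, ?_⟩
  ext x
  simp only [mem_ofPred_eq, mem_inter_iff]
  refine and_congr_right fun hx => ?_
  rw [hu' x hx, hw' x hx]

/-- A graph is relatively closed and a band relatively open in the cylinder over the base. Local
closedness is used twice: in the Baire category argument, and for the topology of the orbit space of
a restricted groupoid. -/
theorem IsCell.isLocallyClosed {n d : ℕ} {C : Set (Fin n → ℝ)} (h : S.IsCell C d) :
    IsLocallyClosed C := by
  induction h with
  | point => exact isOpen_univ.isLocallyClosed
  | @graph n d Y f hY hf ih =>
    have hW : IsLocallyClosed {x : Fin (n + 1) → ℝ | ini x ∈ Y} :=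
      ih.preimage continuous_fin_init
    have hg : ContinuousOn (fun x : Fin (n + 1) → ℝ => x (Fin.last n) - f (ini x))
        {x | ini x ∈ Y} :=
      (continuous_apply _).continuousOn.sub
        (hf.1.comp continuous_fin_init.continuousOn fun x hx => hx)
    obtain ⟨u, hu, h⟩ := continuousOn_iff_isClosed.1 hg {0} isClosed_singleton
    have : {x : Fin (n + 1) → ℝ | ini x ∈ Y ∧ x (Fin.last n) = f (ini x)} =
        u ∩ {x | ini x ∈ Y} := by
      rw [← h]
      ext x
      simp only [mem_ofPred_eq, mem_inter_iff, mem_preimage, mem_singleton_iff, sub_eq_zero]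
      tauto
    rw [this]
    exact hu.isLocallyClosed.inter hW
  | @band n d Y lo hi hY hlo hhi hlt ih =>
    have hW : IsLocallyClosed {x : Fin (n + 1) → ℝ | ini x ∈ Y} :=
      ih.preimage continuous_fin_init
    obtain ⟨u, hu, h⟩ := exists_isOpen_band (fun f hf => (hlo f hf).1) (fun f hf => (hhi f hf).1)
    rw [h]
    exact hW.inter hu.isLocallyClosed

theorem IsCell.dim_le {n d : ℕ} {C : Set (Fin n → ℝ)} (h : S.IsCell C d) : d ≤ n := by
  induction h with
  | point => exact le_rfl
  | graph f hY hf ih => exact ih.trans (Nat.le_succ _)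
  | band lo hi hY hlo hhi hlt ih => exact Nat.succ_le_succ ih

/-- Full dimension excludes graphs, so that every step of the construction is a band. -/
theorem IsCell.isOpen_of_dim_eq {n d : ℕ} {C : Set (Fin n → ℝ)} (h : S.IsCell C d)
    (hd : d = n) : IsOpen C := by
  induction h with
  | point => exact isOpen_univ
  | graph f hY hf ih => exact absurd hY.dim_le (by omega)
  | @band n d Y lo hi hY hlo hhi hlt ih =>
    obtain ⟨u, hu, h⟩ := exists_isOpen_band (fun f hf => (hlo f hf).1) (fun f hf => (hhi f hf).1)
    rw [h]
    exact ((ih (by omega)).preimage continuous_fin_init).inter hu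

/-- One parametrisation by `Y × J` for the four kinds of bands. It shows at once that bands over
connected sets are connected and that all their fibres are nonempty. -/
theorem band_eq_image {n : ℕ} {Y : Set (Fin n → ℝ)} {lo hi : Option ((Fin n → ℝ) → ℝ)}
    (hlo : ∀ f ∈ lo, ContinuousOn f Y) (hhi : ∀ g ∈ hi, ContinuousOn g Y)
    (hlt : ∀ f ∈ lo, ∀ g ∈ hi, ∀ y ∈ Y, f y < g y) :
    ∃ (J : Set ℝ) (φ : (Fin n → ℝ) × ℝ → ℝ), IsConnected J ∧ ContinuousOn φ (Y ×ˢ J) ∧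
      {x : Fin (n + 1) → ℝ | ini x ∈ Y ∧ (∀ f ∈ lo, f (ini x) < x (Fin.last n)) ∧
        (∀ g ∈ hi, x (Fin.last n) < g (ini x))} =
      (fun p => (snc p.1 (φ p) : Fin (n + 1) → ℝ)) '' (Y ×ˢ J) := by
  have key : ∀ (J : Set ℝ) (φ : (Fin n → ℝ) × ℝ → ℝ),
      (∀ y ∈ Y, ∀ t, ((∀ f ∈ lo, f y < t) ∧ (∀ g ∈ hi, t < g y)) ↔ ∃ s ∈ J, φ (y, s) = t) →
      {x : Fin (n + 1) → ℝ | ini x ∈ Y ∧ (∀ f ∈ lo, f (ini x) < x (Fin.last n)) ∧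
        (∀ g ∈ hi, x (Fin.last n) < g (ini x))} =
      (fun p => (snc p.1 (φ p) : Fin (n + 1) → ℝ)) '' (Y ×ˢ J) := by
    intro J φ h
    ext x
    constructor
    · rintro ⟨hx, h'⟩
      obtain ⟨s, hs, e⟩ := (h _ hx _).1 h'
      exact ⟨(ini x, s), ⟨hx, hs⟩, by simp [e]⟩
    · rintro ⟨⟨y, s⟩, ⟨hy, hs⟩, rfl⟩
      have := (h y hy _).2 ⟨s, hs, rfl⟩
      simpa using ⟨hy, this⟩
  cases lo with
  | none =>
    cases hi with
    | none =>
      exact ⟨univ, Prod.snd, isConnected_univ, continuous_snd.continuousOn,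
        key _ _ fun y _ t => by simp⟩
    | some g =>
      refine ⟨Ioi 0, fun p => g p.1 - p.2, isConnected_Ioi,
        ((hhi g rfl).comp continuous_fst.continuousOn fun p hp => hp.1).sub
          continuous_snd.continuousOn, key _ _ fun y _ t => ?_⟩
      simp only [Option.mem_def, reduceCtorEq, IsEmpty.forall_iff, implies_true,
        Option.some.injEq, forall_eq', true_and, mem_Ioi]
      exact ⟨fun h => ⟨g y - t, by linarith, by ring⟩, fun ⟨s, hs, e⟩ => by linarith⟩
  | some f =>
    cases hi with
    | none =>
      refine ⟨Ioi 0, fun p => f p.1 + p.2, isConnected_Ioi,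
        ((hlo f rfl).comp continuous_fst.continuousOn fun p hp => hp.1).add
          continuous_snd.continuousOn, key _ _ fun y _ t => ?_⟩
      simp only [Option.mem_def, reduceCtorEq, IsEmpty.forall_iff, implies_true,
        Option.some.injEq, forall_eq', and_true, mem_Ioi]
      exact ⟨fun h => ⟨t - f y, by linarith, by ring⟩, fun ⟨s, hs, e⟩ => by linarith⟩
    | some g =>
      have hf := (hlo f rfl).comp (s := Y ×ˢ Ioo (0 : ℝ) 1) continuous_fst.continuousOn
        fun p hp => hp.1
      have hg := (hhi g rfl).comp (s := Y ×ˢ Ioo (0 : ℝ) 1) continuous_fst.continuousOn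
        fun p hp => hp.1
      refine ⟨Ioo 0 1, fun p => f p.1 + p.2 * (g p.1 - f p.1), isConnected_Ioo one_pos,
        hf.add (continuous_snd.continuousOn.mul (hg.sub hf)), key _ _ fun y hy t => ?_⟩
      have h0 := sub_pos.2 (hlt f rfl g rfl y hy)
      simp only [Option.mem_def, Option.some.injEq, forall_eq', mem_Ioo]
      constructor
      · rintro ⟨h1, h2⟩
        refine ⟨(t - f y) / (g y - f y), ⟨div_pos (by linarith) h0, ?_⟩, by field_simp; ring⟩
        rw [div_lt_one h0]; linarith
      · rintro ⟨s, ⟨hs, hs'⟩, rfl⟩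
        constructor <;> nlinarith

theorem IsCell.isConnected {n d : ℕ} {C : Set (Fin n → ℝ)} (h : S.IsCell C d) :
    IsConnected C := by
  induction h with
  | point => exact ⟨univ_nonempty, isPreconnected_univ⟩
  | @graph n d Y f hY hf ih =>
    have : {x : Fin (n + 1) → ℝ | ini x ∈ Y ∧ x (Fin.last n) = f (ini x)} =
        (fun y => (snc y (f y) : Fin (n + 1) → ℝ)) '' Y := by
      ext x
      constructor
      · rintro ⟨hx, h'⟩
        exact ⟨ini x, hx, by simp [← h']⟩
      · rintro ⟨y, hy, rfl⟩
        simpa using hy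
    rw [this]
    exact ih.image _ (continuous_fin_snoc.comp_continuousOn (continuousOn_id.prodMk hf.1))
  | @band n d Y lo hi hY hlo hhi hlt ih =>
    obtain ⟨J, φ, hJ, hφ, e⟩ := band_eq_image (fun f hf => (hlo f hf).1)
      (fun f hf => (hhi f hf).1) hlt
    rw [e]
    exact (ih.prod hJ).image _
      (continuous_fin_snoc.comp_continuousOn (continuous_fst.continuousOn.prodMk hφ))

theorem IsCell.nonempty {n d : ℕ} {C : Set (Fin n → ℝ)} (h : S.IsCell C d) : C.Nonempty :=
  h.isConnected.1

/-- The data of a coordinate projection that maps a cell `C` homeomorphically to an open cell `D`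
in such a way that the cells in `D` correspond to cells in `C`. -/
structure IsCellChart (S : OMinimalStructure) {n d : ℕ} (C : Set (Fin n → ℝ)) (σ : Fin d → Fin n)
    (D : Set (Fin d → ℝ)) (q : (Fin d → ℝ) → Fin n → ℝ) : Prop where
  isCell : S.IsCell D d
  continuousOn : ContinuousOn q D
  mapsTo : ∀ z ∈ D, q z ∈ C
  mapsTo' : ∀ x ∈ C, x ∘ σ ∈ D
  left_inv : ∀ x ∈ C, q (x ∘ σ) = x
  right_inv : ∀ z ∈ D, q z ∘ σ = z
  isCell_preimage : ∀ {B e}, S.IsCell B e → B ⊆ D → S.IsCell {x | x ∈ C ∧ x ∘ σ ∈ B} e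

/-- The section `q` is not assumed definable. Its value at `z` is described instead as the point `y`
of `C` with `y ∘ σ = z`. -/
theorem DefContOn.comp_section {n d : ℕ} {C : Set (Fin n → ℝ)} {σ : Fin d → Fin n}
    {D : Set (Fin d → ℝ)} {q : (Fin d → ℝ) → Fin n → ℝ} (h : IsCellChart S C σ D q)
    {f : (Fin n → ℝ) → ℝ} (hf : S.DefContOn f C) : S.DefContOn (fun z => f (q z)) D := by
  refine ⟨hf.1.comp h.continuousOn h.mapsTo, ?_⟩
  have : S.Def {x : Fin (d + 1) → ℝ | ∃ y : Fin n → ℝ,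
      (y ∘ σ = ini x) ∧ (y ∈ C ∧ x (Fin.last d) = f y)} := by
    refine Def.ex (p := fun (x : Fin (d + 1) → ℝ) (y : Fin n → ℝ) =>
      (y ∘ σ = ini x) ∧ (y ∈ C ∧ x (Fin.last d) = f y)) (Def.and ?_ ?_)
    · exact def_eq_pi (defFun_pi fun i => defFun_snd.apply _) defFun_fst.init
    · exact hf.def_graph defFun_snd (defFun_fst.apply _)
  refine def_iff.1 (this.congr fun x => ?_)
  simp only [mem_ofPred_eq]
  constructor
  · rintro ⟨hx, e⟩
    exact ⟨q (ini x), h.right_inv _ hx, h.mapsTo _ hx, e⟩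
  · rintro ⟨y, e, hy, e'⟩
    rw [← e, h.left_inv _ hy]
    exact ⟨h.mapsTo' _ hy, e'⟩

theorem DefContOn.comp_coord {n d : ℕ} {C : Set (Fin n → ℝ)} {σ : Fin d → Fin n}
    {B : Set (Fin d → ℝ)} (hC : S.Def C)
    {f : (Fin d → ℝ) → ℝ} (hf : S.DefContOn f B) :
    S.DefContOn (fun x => f (x ∘ σ)) {x | x ∈ C ∧ x ∘ σ ∈ B} := by
  have hc : Continuous fun x : Fin n → ℝ => x ∘ σ := by fun_prop
  refine ⟨hf.1.comp hc.continuousOn fun x hx => hx.2, ?_⟩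
  have h1 : S.Def {x : Fin (n + 1) → ℝ | ini x ∈ C} := hC.preimage defFun_id.init
  have h2 : S.Def {x : Fin (n + 1) → ℝ | ini x ∘ σ ∈ B ∧ x (Fin.last n) = f (ini x ∘ σ)} :=
    hf.def_graph (defFun_pi fun i => defFun_id.init.apply _) (defFun_id.apply _)
  refine def_iff.1 ((h1.and h2).congr fun x => ?_)
  simp only [mem_ofPred_eq]
  tauto

/-- The coordinates to keep are those added by bands; at a graph step the last coordinate is a
function of the others and is dropped. This reduces questions about a cell of dimension `d` to an
open cell of `ℝᵈ`. -/
theorem IsCell.exists_chart {n d : ℕ} {C : Set (Fin n → ℝ)} (h : S.IsCell C d) :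
    ∃ σ D q, IsCellChart S (d := d) C σ D q := by
  induction h with
  | point =>
    refine ⟨id, univ, id, .point, continuousOn_id, fun _ _ => mem_univ _, fun _ _ => mem_univ _,
      fun _ _ => rfl, fun _ _ => rfl, fun {B e} hB _ => ?_⟩
    simpa using hB
  | @graph n d Y f hY hf ih =>
    obtain ⟨σ, D, q, hq⟩ := ih
    refine ⟨fun i => (σ i).castSucc, D, fun z => snc (q z) (f (q z)), hq.isCell, ?_, ?_, ?_, ?_,
      ?_, ?_⟩
    · exact continuous_fin_snoc.comp_continuousOn
        (hq.continuousOn.prodMk (hf.1.comp hq.continuousOn hq.mapsTo))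
    · intro z hz
      simpa using hq.mapsTo z hz
    · rintro x ⟨hx, -⟩
      exact hq.mapsTo' _ hx
    · rintro x ⟨hx, h'⟩
      have := hq.left_inv _ hx
      change snc (q (ini x ∘ σ)) (f (q (ini x ∘ σ))) = x
      rw [this, ← h']
      simp
    · intro z hz
      conv_rhs => rw [← hq.right_inv z hz]
      ext i; simp
    · intro B e hB hBD
      have h1 := hq.isCell_preimage hB hBD
      have h2 := IsCell.graph f h1 (hf.mono h1.def fun x hx => hx.1)
      convert h2 using 1
      ext x
      change (_ ∧ _) ∧ ini x ∘ σ ∈ B ↔ (_ ∧ _) ∧ _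
      tauto
  | @band n d Y lo hi hY hlo hhi hlt ih =>
    obtain ⟨σ, D, q, hq⟩ := ih
    have hτ : ∀ x : Fin (n + 1) → ℝ,
        x ∘ (Fin.snoc (α := fun _ => Fin (n + 1)) (fun i => (σ i).castSucc) (Fin.last n) :
          Fin (d + 1) → Fin (n + 1)) = snc (ini x ∘ σ) (x (Fin.last n)) := by
      intro x
      ext i
      induction i using Fin.lastCases with
      | last => simp
      | cast i => simp [Fin.init]
    have hD := IsCell.band (lo.map fun f z => f (q z)) (hi.map fun f z => f (q z)) hq.isCell
      (by
        intro g hg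
        obtain ⟨f, hf, rfl⟩ := Option.mem_map.1 hg
        exact (hlo f hf).comp_section hq)
      (by
        intro g hg
        obtain ⟨f, hf, rfl⟩ := Option.mem_map.1 hg
        exact (hhi f hf).comp_section hq)
      (by
        intro g hg g' hg' z hz
        obtain ⟨f, hf, rfl⟩ := Option.mem_map.1 hg
        obtain ⟨f', hf', rfl⟩ := Option.mem_map.1 hg'
        exact hlt f hf f' hf' _ (hq.mapsTo z hz))
    refine ⟨Fin.snoc (α := fun _ => Fin (n + 1)) (fun i => (σ i).castSucc) (Fin.last n), _,
      fun z => snc (q (ini z)) (z (Fin.last d)), hD, ?_, ?_, ?_, ?_, ?_, ?_⟩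
    · refine continuous_fin_snoc.comp_continuousOn
        ((hq.continuousOn.comp continuous_fin_init.continuousOn fun z hz => hz.1).prodMk
          (continuous_apply _).continuousOn)
    · rintro z ⟨hz, h1, h2⟩
      simp only [Option.mem_map, forall_exists_index, and_imp, forall_apply_eq_imp_iff₂] at h1 h2
      simpa using ⟨hq.mapsTo _ hz, h1, h2⟩
    · rintro x ⟨hx, h1, h2⟩
      rw [hτ]
      simp only [mem_ofPred_eq, Fin.init_snoc, Fin.snoc_last, Option.mem_map, forall_exists_index,
        and_imp, forall_apply_eq_imp_iff₂]
      rw [hq.left_inv _ hx]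
      exact ⟨hq.mapsTo' _ hx, h1, h2⟩
    · rintro x ⟨hx, -⟩
      rw [hτ]
      simp [hq.left_inv _ hx]
    · rintro z ⟨hz, -⟩
      rw [hτ]
      simp [hq.right_inv _ hz]
    · intro B e hB hBD
      simp only [hτ]
      cases hB with
      | @graph _ _ Z g hZ hg =>
        have hZD : Z ⊆ D := fun z hz => by
          have : (snc z (g z) : Fin (d + 1) → ℝ) ∈ {x : Fin (d + 1) → ℝ |
            ini x ∈ Z ∧ x (Fin.last d) = g (ini x)} := by simpa using hz
          simpa using (hBD this).1
        have h1 := hq.isCell_preimage hZ hZD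
        have h2 := IsCell.graph _ h1 (hg.comp_coord hY.def)
        convert h2 using 1
        ext x
        simp only [mem_ofPred_eq, Fin.init_snoc, Fin.snoc_last]
        constructor
        · rintro ⟨h, h', h''⟩
          exact ⟨⟨h.1, h'⟩, h''⟩
        · rintro ⟨⟨h, h'⟩, h''⟩
          refine ⟨⟨h, ?_⟩, h', h''⟩
          have : (snc (ini x ∘ σ) (x (Fin.last n)) : Fin (d + 1) → ℝ) ∈ {x : Fin (d + 1) → ℝ |
            ini x ∈ Z ∧ x (Fin.last d) = g (ini x)} := by simpa using ⟨h', h''⟩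
          simpa [hq.left_inv _ h] using (hBD this).2
      | @band _ e Z lo' hi' hZ hlo' hhi' hlt' =>
        -- The fibre of the band over `z` is nonempty, so the inclusion of the cells passes to their
        -- bases.
        have hZD : Z ⊆ D := fun z hz => by
          obtain ⟨J, φ, hJ, -, eq⟩ := band_eq_image (fun f hf => (hlo' f hf).1)
            (fun f hf => (hhi' f hf).1) hlt'
          obtain ⟨s, hs⟩ := hJ.1
          have := eq.ge (mem_image_of_mem _ (mk_mem_prod hz hs))
          simpa using (hBD this).1
        have h1 := hq.isCell_preimage hZ hZD
        have h2 := IsCell.band (lo'.map fun f x => f (x ∘ σ)) (hi'.map fun f x => f (x ∘ σ)) h1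
          (by
            intro g hg
            obtain ⟨f, hf, rfl⟩ := Option.mem_map.1 hg
            exact (hlo' f hf).comp_coord hY.def)
          (by
            intro g hg
            obtain ⟨f, hf, rfl⟩ := Option.mem_map.1 hg
            exact (hhi' f hf).comp_coord hY.def)
          (by
            intro g hg g' hg' z hz
            obtain ⟨f, hf, rfl⟩ := Option.mem_map.1 hg
            obtain ⟨f', hf', rfl⟩ := Option.mem_map.1 hg'
            exact hlt' f hf f' hf' _ hz.2)
        convert h2 using 1
        ext x
        simp only [mem_ofPred_eq, Fin.init_snoc, Fin.snoc_last, Option.mem_map,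
          forall_exists_index, and_imp, forall_apply_eq_imp_iff₂]
        constructor
        · rintro ⟨h, h', h''⟩
          exact ⟨⟨h.1, h'⟩, h''⟩
        · rintro ⟨⟨h, h'⟩, h''⟩
          refine ⟨⟨h, ?_⟩, h', h''⟩
          have : (snc (ini x ∘ σ) (x (Fin.last n)) : Fin (d + 1) → ℝ) ∈ {x : Fin (d + 1) → ℝ |
            ini x ∈ Z ∧ (∀ f ∈ lo', f (ini x) < x (Fin.last d)) ∧
              (∀ g ∈ hi', x (Fin.last d) < g (ini x))} := by simpa using ⟨h', h''⟩
          simpa [hq.left_inv _ h] using (hBD this).2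

end OMinimalStructure

end

noncomputable section

/-! ### Finite sets of reals, counted from below -/

/-- The number of elements of `s` below `t`. -/
def countBelow (s : Set ℝ) (t : ℝ) : ℕ := (s ∩ Iio t).ncard

open Classical in
/-- The element of `s` with exactly `i` elements of `s` below it. -/
def nthPoint (s : Set ℝ) (i : ℕ) : ℝ :=
  if h : ∃ t ∈ s, countBelow s t = i then h.choose else 0

section Count

variable {s : Set ℝ}

theorem countBelow_mono (hs : s.Finite) {r t : ℝ} (h : r ≤ t) :
    countBelow s r ≤ countBelow s t :=
  ncard_le_ncard (inter_subset_inter_right _ (Iio_subset_Iio h)) (hs.inter_of_left _)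

theorem countBelow_lt (hs : s.Finite) {r t : ℝ} (hr : r ∈ s) (h : r < t) :
    countBelow s r < countBelow s t :=
  ncard_lt_ncard ⟨inter_subset_inter_right _ (Iio_subset_Iio h.le),
    fun H => lt_irrefl r (H ⟨hr, h⟩).2⟩ (hs.inter_of_left _)

theorem countBelow_le (hs : s.Finite) (t : ℝ) : countBelow s t ≤ s.ncard :=
  ncard_le_ncard inter_subset_left hs

theorem countBelow_lt_ncard (hs : s.Finite) {r : ℝ} (hr : r ∈ s) : countBelow s r < s.ncard :=
  ncard_lt_ncard ⟨inter_subset_left, fun H => lt_irrefl r (H hr).2⟩ hs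

theorem countBelow_injOn (hs : s.Finite) : InjOn (countBelow s) s := by
  intro r hr t ht e
  rcases lt_trichotomy r t with h | h | h
  · exact absurd e (countBelow_lt hs hr h).ne
  · exact h
  · exact absurd e (countBelow_lt hs ht h).ne'

theorem exists_countBelow_eq (hs : s.Finite) {i : ℕ} (hi : i < s.ncard) :
    ∃ t ∈ s, countBelow s t = i := by
  classical
  have h1 : hs.toFinset.image (countBelow s) = Finset.range s.ncard := by
    apply Finset.eq_of_subset_of_card_le
    · intro j hj
      obtain ⟨t, ht, rfl⟩ := Finset.mem_image.1 hj
      exact Finset.mem_range.2 (countBelow_lt_ncard hs (hs.mem_toFinset.1 ht))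
    · rw [Finset.card_image_of_injOn, Finset.card_range, ncard_eq_toFinset_card s hs]
      simpa using countBelow_injOn hs
  have : i ∈ hs.toFinset.image (countBelow s) := h1 ▸ Finset.mem_range.2 hi
  simpa using this

theorem nthPoint_spec (hs : s.Finite) {i : ℕ} (hi : i < s.ncard) :
    nthPoint s i ∈ s ∧ countBelow s (nthPoint s i) = i := by
  rw [nthPoint, dif_pos (exists_countBelow_eq hs hi)]
  exact (exists_countBelow_eq hs hi).choose_spec

theorem eq_nthPoint_iff (hs : s.Finite) {i : ℕ} (hi : i < s.ncard) {t : ℝ} :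
    t = nthPoint s i ↔ t ∈ s ∧ countBelow s t = i := by
  constructor
  · rintro rfl
    exact nthPoint_spec hs hi
  · rintro ⟨h, h'⟩
    exact countBelow_injOn hs h (nthPoint_spec hs hi).1 (h'.trans (nthPoint_spec hs hi).2.symm)

theorem nthPoint_lt_iff (hs : s.Finite) {i : ℕ} (hi : i < s.ncard) {t : ℝ} :
    nthPoint s i < t ↔ i < countBelow s t := by
  obtain ⟨h1, h2⟩ := nthPoint_spec hs hi
  constructor
  · intro h
    exact h2 ▸ countBelow_lt hs h1 h
  · intro h
    by_contra! h'
    have := countBelow_mono hs h'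
    omega

theorem le_nthPoint_iff (hs : s.Finite) {i : ℕ} (hi : i < s.ncard) {t : ℝ} :
    t ≤ nthPoint s i ↔ countBelow s t ≤ i := by
  rw [← not_lt, nthPoint_lt_iff hs hi, not_lt]

/-- This recursion on `i` expresses counting by quantifiers over `ℝ`, which makes the counting
conditions on a definable family definable. -/
theorem succ_le_countBelow_iff (hs : s.Finite) {i : ℕ} {t : ℝ} :
    i + 1 ≤ countBelow s t ↔ ∃ r ∈ s, r < t ∧ i ≤ countBelow s r := by
  constructor
  · intro h
    have hi : i < s.ncard := h.trans (countBelow_le hs t)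
    exact ⟨_, (nthPoint_spec hs hi).1, (nthPoint_lt_iff hs hi).2 h, (nthPoint_spec hs hi).2.ge⟩
  · rintro ⟨r, hr, hrt, h⟩
    exact (Nat.succ_le_succ h).trans (countBelow_lt hs hr hrt)

theorem succ_le_ncard_iff (hs : s.Finite) {i : ℕ} :
    i + 1 ≤ s.ncard ↔ ∃ r ∈ s, i ≤ countBelow s r := by
  constructor
  · intro h
    exact ⟨_, (nthPoint_spec hs h).1, (nthPoint_spec hs h).2.ge⟩
  · rintro ⟨r, hr, h⟩
    exact (Nat.succ_le_succ h).trans (countBelow_lt_ncard hs hr)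

/-- A point of `s` between two points of the gap would make the count at the right-hand one larger.
Gaps are thus connected; they become the fibres of the bands in a cell decomposition. -/
theorem ordConnected_gap (hs : s.Finite) (i : ℕ) :
    OrdConnected {t | t ∉ s ∧ countBelow s t = i} := by
  refine ⟨fun a ha b hb t ht => ?_⟩
  have h1 := countBelow_mono hs ht.1
  have h2 := countBelow_mono hs ht.2
  have e : countBelow s t = i := by
    have := ha.2; have := hb.2; omega
  refine ⟨fun h => ?_, e⟩
  rcases ht.2.eq_or_lt with h' | h'
  · exact hb.1 (h' ▸ h)
  · have := countBelow_lt hs h h'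
    have := hb.2
    omega

end Count

/-! ### Definable families of finite subsets of the line. -/

namespace OMinimalStructure

open DefSpace

variable {S : OMinimalStructure} {E : Type} [DefSpace E]

/-- The fibre of a subset of `E × ℝ`. -/
def fibre (A : Set (E × ℝ)) (y : E) : Set ℝ := {t | (y, t) ∈ A}

theorem def_le_countBelow {A : Set (E × ℝ)} (hA : S.Def A) (hfin : ∀ y, (fibre A y).Finite) :
    ∀ i : ℕ, S.Def {p : E × ℝ | i ≤ countBelow (fibre A p.1) p.2}
  | 0 => by simpa using def_univ
  | i + 1 => by
    have ih := def_le_countBelow hA hfin i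
    have : S.Def {p : E × ℝ | ∃ r : ℝ, (p.1, r) ∈ A ∧ r < p.2 ∧
        i ≤ countBelow (fibre A p.1) r} := by
      refine Def.ex (p := fun (p : E × ℝ) (r : ℝ) => (p.1, r) ∈ A ∧ r < p.2 ∧
        i ≤ countBelow (fibre A p.1) r) (Def.and ?_ (Def.and ?_ ?_))
      · exact hA.preimage (defFun_fst.fst.prodMk defFun_snd)
      · exact def_lt defFun_snd defFun_fst.snd
      · exact ih.preimage (φ := fun q : (E × ℝ) × ℝ => (q.1.1, q.2))
          (defFun_fst.fst.prodMk defFun_snd)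
    refine this.congr fun p => ?_
    exact succ_le_countBelow_iff (hfin p.1)

theorem def_countBelow_eq {A : Set (E × ℝ)} (hA : S.Def A) (hfin : ∀ y, (fibre A y).Finite)
    (i : ℕ) : S.Def {p : E × ℝ | countBelow (fibre A p.1) p.2 = i} := by
  refine ((def_le_countBelow hA hfin i).and (def_le_countBelow hA hfin (i + 1)).not).congr
    fun p => ?_
  simp only [mem_ofPred_eq]
  omega

theorem def_ncard_eq {A : Set (E × ℝ)} (hA : S.Def A) (hfin : ∀ y, (fibre A y).Finite)
    (i : ℕ) : S.Def {y : E | (fibre A y).ncard = i} := by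
  have h : ∀ i, S.Def {y : E | i ≤ (fibre A y).ncard} := by
    intro i
    cases i with
    | zero => simpa using def_univ
    | succ i =>
      have : S.Def {y : E | ∃ r : ℝ, (y, r) ∈ A ∧ i ≤ countBelow (fibre A y) r} :=
        Def.ex (p := fun (y : E) (r : ℝ) => (y, r) ∈ A ∧ i ≤ countBelow (fibre A y) r)
          (Def.and hA (def_le_countBelow hA hfin i))
      refine this.congr fun p => ?_
      exact succ_le_ncard_iff (hfin p)
  refine ((h i).and (h (i + 1)).not).congr fun p => ?_
  simp only [mem_ofPred_eq]
  omega

/-- The fibre of `A` varies continuously at `y`, without splitting or loss of points. -/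
def GoodAt {n : ℕ} (A : Set ((Fin n → ℝ) × ℝ)) (y : Fin n → ℝ) : Prop :=
  ∃ ε₀ : ℝ, 0 < ε₀ ∧ ∀ ε : ℝ, 0 < ε ∧ ε < ε₀ → ∃ δ : ℝ, 0 < δ ∧ ∀ y' : Fin n → ℝ,
    (0 < δ ∧ dist y' y < δ) →
    (∀ r : ℝ, (y, r) ∈ A → ∃ r' : ℝ, (y', r') ∈ A ∧ |r - r'| < ε ∧
      ∀ r'' : ℝ, (y', r'') ∈ A → |r - r''| < ε → r'' = r') ∧
    (∀ r' : ℝ, (y', r') ∈ A → ∃ r : ℝ, (y, r) ∈ A ∧ |r - r'| < ε)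

/-- `GoodAt` is an ε–δ formula with quantifiers over `ℝ` and `ℝⁿ` only, and its definability is
checked quantifier by quantifier. The repeated `0 < δ` gives the ball condition the form required by
`def_dist_lt`. -/
theorem def_goodAt {n : ℕ} {A : Set ((Fin n → ℝ) × ℝ)} (hA : S.Def A) :
    S.Def {y | GoodAt A y} := by
  unfold GoodAt
  refine Def.ex (E := Fin n → ℝ) (F := ℝ) (p := fun _ _ => _)
    (Def.and (def_lt (defFun_const 0) defFun_snd) ?_)
  refine Def.all (E := (Fin n → ℝ) × ℝ) (F := ℝ) (p := fun _ _ => _)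
    (Def.imp (Def.and (def_lt (defFun_const 0) defFun_snd) (def_lt defFun_snd defFun_fst.snd)) ?_)
  refine Def.ex (E := ((Fin n → ℝ) × ℝ) × ℝ) (F := ℝ) (p := fun _ _ => _)
    (Def.and (def_lt (defFun_const 0) defFun_snd) ?_)
  refine Def.all (E := (((Fin n → ℝ) × ℝ) × ℝ) × ℝ) (F := Fin n → ℝ) (p := fun _ _ => _)
    (Def.imp (def_dist_lt defFun_snd defFun_fst.fst.fst.fst defFun_fst.snd) (Def.and ?_ ?_))
  · refine Def.all (E := ((((Fin n → ℝ) × ℝ) × ℝ) × ℝ) × (Fin n → ℝ)) (F := ℝ)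
      (p := fun _ _ => _)
      (Def.imp (hA.preimage (defFun_fst.fst.fst.fst.fst.prodMk defFun_snd)) ?_)
    refine Def.ex (E := (((((Fin n → ℝ) × ℝ) × ℝ) × ℝ) × (Fin n → ℝ)) × ℝ) (F := ℝ)
      (p := fun _ _ => _) (Def.and (hA.preimage (defFun_fst.fst.snd.prodMk defFun_snd)) (Def.and
        (def_abs_sub_lt defFun_fst.snd defFun_snd defFun_fst.fst.fst.fst.snd) ?_))
    refine Def.all (E := ((((((Fin n → ℝ) × ℝ) × ℝ) × ℝ) × (Fin n → ℝ)) × ℝ) × ℝ) (F := ℝ)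
      (p := fun _ _ => _) (Def.imp (hA.preimage (defFun_fst.fst.fst.snd.prodMk defFun_snd))
        (Def.imp (def_abs_sub_lt defFun_fst.fst.snd defFun_snd defFun_fst.fst.fst.fst.fst.snd)
          (def_eq defFun_snd defFun_fst.snd)))
  · refine Def.all (E := ((((Fin n → ℝ) × ℝ) × ℝ) × ℝ) × (Fin n → ℝ)) (F := ℝ)
      (p := fun _ _ => _) (Def.imp (hA.preimage (defFun_fst.snd.prodMk defFun_snd)) ?_)
    exact Def.ex (E := (((((Fin n → ℝ) × ℝ) × ℝ) × ℝ) × (Fin n → ℝ)) × ℝ) (F := ℝ)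
      (p := fun _ _ => _)
      (Def.and (hA.preimage (defFun_fst.fst.fst.fst.fst.fst.prodMk defFun_snd))
        (def_abs_sub_lt defFun_snd defFun_fst.snd defFun_fst.fst.fst.fst.snd))

/-- A positive lower bound for the distances between the points of a finite set. -/
theorem _root_.Set.Finite.exists_separation {s : Set ℝ} (hs : s.Finite) :
    ∃ ε : ℝ, 0 < ε ∧ ∀ a ∈ s, ∀ b ∈ s, |a - b| < ε → a = b := by
  have hf : (s ×ˢ s ∩ {p | p.1 ≠ p.2}).Finite := (hs.prod hs).inter_of_left _
  rcases (s ×ˢ s ∩ {p | p.1 ≠ p.2}).eq_empty_or_nonempty with h | h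
  · refine ⟨1, one_pos, fun a ha b hb _ => ?_⟩
    by_contra hab
    exact (h ▸ (⟨⟨ha, hb⟩, hab⟩ : (a, b) ∈ s ×ˢ s ∩ {p | p.1 ≠ p.2}) : (a, b) ∈ (∅ : Set _))
  · obtain ⟨p, hp, hmin⟩ := hf.exists_minimalFor (fun p : ℝ × ℝ => |p.1 - p.2|) _ h
    refine ⟨|p.1 - p.2|, abs_pos.2 (sub_ne_zero.2 hp.2), fun a ha b hb hab => ?_⟩
    by_contra hne
    have := hmin (j := (a, b)) ⟨⟨ha, hb⟩, hne⟩ hab.le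
    exact absurd hab (not_lt.2 this)

/-- Goodness matches the points of the fibre at `y` bijectively with nearby points of the fibre at
`y'`, and points closer than `η` lie on the same side of `J`. The cases needed are the whole line
and `Iio t`. -/
theorem GoodAt.eventually_ncard {n : ℕ} {A : Set ((Fin n → ℝ) × ℝ)} {y : Fin n → ℝ}
    (h : GoodAt A y) (hfin : (fibre A y).Finite) {J : Set ℝ} {η : ℝ} (hη : 0 < η)
    (hJ : ∀ r ∈ fibre A y, ∀ r', |r - r'| < η → (r ∈ J ↔ r' ∈ J)) :
    ∀ᶠ y' in 𝓝 y, (fibre A y' ∩ J).ncard = (fibre A y ∩ J).ncard := by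
  obtain ⟨ε₀, hε₀, h⟩ := h
  obtain ⟨γ, hγ, hsep⟩ := hfin.exists_separation
  -- The last bound makes the matching injective: two points within `ε` of the same point are less
  -- than `γ` apart.
  obtain ⟨ε, hε, hε'⟩ : ∃ ε, 0 < ε ∧ ε < ε₀ ∧ ε < η ∧ 2 * ε < γ := by
    refine ⟨min ε₀ (min η γ) / 3, by positivity, ?_, ?_, ?_⟩ <;>
    · have h1 := min_le_left ε₀ (min η γ)
      have h2 := (min_le_right ε₀ (min η γ)).trans (min_le_left _ _)
      have h3 := (min_le_right ε₀ (min η γ)).trans (min_le_right _ _)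
      have h4 : 0 < min ε₀ (min η γ) := by positivity
      linarith
  obtain ⟨δ, hδ, h⟩ := h ε ⟨hε, hε'.1⟩
  filter_upwards [Metric.ball_mem_nhds y hδ] with y' hy'
  obtain ⟨h1, h2⟩ := h y' ⟨hδ, hy'⟩
  choose! g hgA hgε hg using h1
  symm
  refine ncard_congr (fun r _ => g r) ?_ ?_ ?_
  · rintro r ⟨hr, hrJ⟩
    exact ⟨hgA r hr, (hJ r hr _ ((hgε r hr).trans hε'.2.1)).1 hrJ⟩
  · rintro a b ⟨ha, -⟩ ⟨hb, -⟩ e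
    refine hsep a ha b hb ?_
    have h1 := hgε a ha
    have h2 := hgε b hb
    have e' : g a = g b := e
    rw [← e', abs_sub_comm] at h2
    have := abs_sub_le a (g a) b
    linarith
  · rintro r' ⟨hr', hrJ⟩
    obtain ⟨r, hr, hrr⟩ := h2 r' hr'
    exact ⟨r, ⟨hr, (hJ r hr r' (hrr.trans hε'.2.1)).2 hrJ⟩, (hg r hr r' hr' hrr).symm⟩

theorem GoodAt.eventually_countBelow {n : ℕ} {A : Set ((Fin n → ℝ) × ℝ)} {y : Fin n → ℝ}
    (h : GoodAt A y) (hfin : (fibre A y).Finite) {t : ℝ} (ht : t ∉ fibre A y) :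
    ∀ᶠ y' in 𝓝 y, countBelow (fibre A y') t = countBelow (fibre A y) t := by
  obtain ⟨γ, hγ, hsep⟩ := (hfin.insert t).exists_separation
  refine h.eventually_ncard hfin (J := Iio t) hγ fun r hr r' hrr => ?_
  have h1 : γ ≤ |r - t| := by
    by_contra! H
    exact ht (hsep r (mem_insert_of_mem _ hr) t (mem_insert _ _) H ▸ hr)
  simp only [mem_Iio]
  rw [abs_lt] at hrr
  rcases le_abs.1 h1 with h1 | h1 <;> constructor <;> intro h2 <;> linarith [hrr.1, hrr.2]

/-- Continuity is checked in the order topology. Given a bound on one side of the `i`-th point, a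
number `t` off the finite fibre is placed in between; the count below `t` is locally constant in
`y`, and it decides on which side of `t` the `i`-th point lies. -/
theorem GoodAt.continuousAt_nthPoint {n : ℕ} {A : Set ((Fin n → ℝ) × ℝ)} {y : Fin n → ℝ}
    (h : GoodAt A y) (hfin : ∀ y, (fibre A y).Finite) {i : ℕ} (hi : i < (fibre A y).ncard) :
    ContinuousAt (fun y => nthPoint (fibre A y) i) y := by
  have hev : ∀ᶠ y' in 𝓝 y, i < (fibre A y').ncard := by
    filter_upwards [h.eventually_ncard (hfin y) (J := univ) one_pos fun _ _ _ _ => by simp]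
      with y' hy'
    rw [inter_univ, inter_univ] at hy'
    exact hy' ▸ hi
  have hdense : ∀ a b : ℝ, a < b → ∃ t, t ∉ fibre A y ∧ a < t ∧ t < b := by
    intro a b hab
    by_contra! H
    have : Ioo a b ⊆ fibre A y := fun t ht => by
      by_contra h'
      exact absurd (H t h' ht.1) (not_le.2 ht.2)
    exact Ioo_infinite hab ((hfin y).subset this)
  rw [ContinuousAt, tendsto_order]
  constructor
  · intro a ha
    obtain ⟨t, ht, hat, htn⟩ := hdense _ _ ha
    filter_upwards [hev, h.eventually_countBelow (hfin y) ht] with y' h1 h2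
    refine hat.trans_le ((le_nthPoint_iff (hfin y') h1).2 ?_)
    rw [h2]
    exact (le_nthPoint_iff (hfin y) hi).1 htn.le
  · intro b hb
    obtain ⟨t, ht, hat, htn⟩ := hdense _ _ hb
    filter_upwards [hev, h.eventually_countBelow (hfin y) ht] with y' h1 h2
    refine lt_trans ((nthPoint_lt_iff (hfin y') h1).2 ?_) htn
    rw [h2]
    exact (nthPoint_lt_iff (hfin y) hi).1 hat

/-- Over `C` the fibres of `A` have constant cardinality and their points depend continuously on
the base point. -/
def NiceOn {n : ℕ} (A : Set ((Fin n → ℝ) × ℝ)) (C : Set (Fin n → ℝ)) : Prop :=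
  ∃ k : ℕ, (∀ y ∈ C, (fibre A y).ncard = k) ∧
    ∀ i < k, ContinuousOn (fun y => nthPoint (fibre A y) i) C

/-- The number of points is locally constant on `C`, hence constant by connectedness. No bound on
the size of the fibres has to be known beforehand. -/
theorem niceOn_of_goodAt {n : ℕ} {A : Set ((Fin n → ℝ) × ℝ)} (hfin : ∀ y, (fibre A y).Finite)
    {C : Set (Fin n → ℝ)} (hC : IsConnected C) (h : ∀ y ∈ C, GoodAt A y) : NiceOn A C := by
  obtain ⟨y₀, hy₀⟩ := hC.1
  have hcont : ContinuousOn (fun y => (fibre A y).ncard) C := by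
    intro y hy
    refine ContinuousAt.continuousWithinAt (continuousAt_const.congr (f := fun _ =>
      (fibre A y).ncard) ?_)
    filter_upwards [(h y hy).eventually_ncard (hfin y) (J := univ) one_pos fun _ _ _ _ => by simp]
      with y' hy'
    rw [inter_univ, inter_univ] at hy'
    exact hy'.symm
  have hconst : ∀ y ∈ C, (fibre A y).ncard = (fibre A y₀).ncard := fun y hy =>
    hC.isPreconnected.constant hcont hy hy₀
  exact ⟨_, hconst, fun i hi y hy => ((h y hy).continuousAt_nthPoint hfin
    (by rw [hconst y hy]; exact hi)).continuousWithinAt⟩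

end OMinimalStructure

end

noncomputable section

/-! ### Cell decomposition -/

local notation "ini" => Fin.init (α := fun _ => ℝ)
local notation "snc" => Fin.snoc (α := fun _ => ℝ)

namespace OMinimalStructure

open DefSpace

variable {S : OMinimalStructure}

variable (S) in
/-- Every finite family of definable subsets of `ℝⁿ` is compatible with a finite partition of `ℝⁿ`
into cells. -/
def HasCellDecomposition (n : ℕ) : Prop :=
  ∀ F : Finset (Set (Fin n → ℝ)), (∀ A ∈ F, S.Def A) →
    ∃ P, S.IsCellPartition univ P ∧ ∀ c ∈ P, ∀ A ∈ F, c.1 ⊆ A ∨ Disjoint c.1 A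

open Classical in
-- `X` is added to the family, and the cells inside `X` are kept.
theorem HasCellDecomposition.exists_partition {n : ℕ} (h : S.HasCellDecomposition n)
    {X : Set (Fin n → ℝ)} (hX : S.Def X) (F : Finset (Set (Fin n → ℝ)))
    (hF : ∀ A ∈ F, S.Def A) :
    ∃ P, S.IsCellPartition X P ∧ ∀ c ∈ P, ∀ A ∈ F, c.1 ⊆ A ∨ Disjoint c.1 A := by
  obtain ⟨P, hP, hPF⟩ := h (insert X F) (by
    intro A hA
    rcases Finset.mem_insert.1 hA with rfl | hA
    exacts [hX, hF A hA])
  refine ⟨P.filter fun c => c.1 ⊆ X, ⟨fun c hc => hP.isCell c (Finset.mem_filter.1 hc).1,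
    fun c hc c' hc' => hP.disjoint c (Finset.mem_filter.1 hc).1 c' (Finset.mem_filter.1 hc').1,
    ?_⟩, fun c hc A hA => hPF c (Finset.mem_filter.1 hc).1 A (Finset.mem_insert_of_mem hA)⟩
  ext x
  simp only [mem_iUnion, Finset.mem_filter, exists_prop]
  constructor
  · rintro ⟨c, ⟨-, hc⟩, hx⟩
    exact hc hx
  · intro hx
    have : x ∈ ⋃ c ∈ P, c.1 := by rw [hP.cover]; trivial
    simp only [mem_iUnion, exists_prop] at this
    obtain ⟨c, hc, hxc⟩ := this
    refine ⟨c, ⟨hc, ?_⟩, hxc⟩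
    rcases hPF c hc X (Finset.mem_insert_self _ _) with h | h
    · exact h
    · exact absurd hx (disjoint_left.1 h hxc)

open Classical in
theorem IsCellPartition.biUnion {ι : Type*} {n : ℕ} {s : Finset ι} {X : ι → Set (Fin n → ℝ)}
    {P : ι → Finset (Set (Fin n → ℝ) × ℕ)} (hP : ∀ i ∈ s, S.IsCellPartition (X i) (P i))
    (hX : ∀ i ∈ s, ∀ j ∈ s, i ≠ j → Disjoint (X i) (X j)) :
    S.IsCellPartition (⋃ i ∈ s, X i) (s.biUnion P) := by
  have hsub : ∀ i ∈ s, ∀ c ∈ P i, c.1 ⊆ X i := fun i hi c hc => by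
    rw [← (hP i hi).cover]
    exact subset_biUnion_of_mem (u := fun c : Set (Fin n → ℝ) × ℕ => c.1) hc
  refine ⟨?_, ?_, ?_⟩
  · intro c hc
    obtain ⟨i, hi, hc⟩ := Finset.mem_biUnion.1 hc
    exact (hP i hi).isCell c hc
  · intro c hc c' hc' hne
    obtain ⟨i, hi, hc⟩ := Finset.mem_biUnion.1 hc
    obtain ⟨j, hj, hc'⟩ := Finset.mem_biUnion.1 hc'
    by_cases hij : i = j
    · subst hij
      exact (hP i hi).disjoint c hc c' hc' hne
    · exact (hX i hi j hj hij).mono (hsub i hi c hc) (hsub j hj c' hc')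
  · ext x
    simp only [mem_iUnion, Finset.mem_biUnion, exists_prop]
    constructor
    · rintro ⟨c, ⟨i, hi, hc⟩, hx⟩
      exact ⟨i, hi, hsub i hi c hc hx⟩
    · rintro ⟨i, hi, hx⟩
      rw [← (hP i hi).cover] at hx
      simp only [mem_iUnion, exists_prop] at hx
      obtain ⟨c, hc, hx⟩ := hx
      exact ⟨c, ⟨i, hi, hc⟩, hx⟩

open Classical in
/-- Refining each cell of a partition. -/
theorem IsCellPartition.refine {n : ℕ} {X : Set (Fin n → ℝ)}
    {P : Finset (Set (Fin n → ℝ) × ℕ)} (hP : S.IsCellPartition X P)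
    {Q : Set (Fin n → ℝ) × ℕ → Finset (Set (Fin n → ℝ) × ℕ)}
    (hQ : ∀ c ∈ P, S.IsCellPartition c.1 (Q c)) : S.IsCellPartition X (P.biUnion Q) := by
  have := IsCellPartition.biUnion hQ hP.disjoint
  rwa [hP.cover] at this

theorem IsCellPartition.subset {n : ℕ} {X : Set (Fin n → ℝ)}
    {P : Finset (Set (Fin n → ℝ) × ℕ)} (hP : S.IsCellPartition X P) {c} (hc : c ∈ P) :
    c.1 ⊆ X := by
  rw [← hP.cover]
  exact subset_biUnion_of_mem (u := fun c : Set (Fin n → ℝ) × ℕ => c.1) hc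

theorem IsCellPartition.exists_mem {n : ℕ} {X : Set (Fin n → ℝ)}
    {P : Finset (Set (Fin n → ℝ) × ℕ)} (hP : S.IsCellPartition X P) {x} (hx : x ∈ X) :
    ∃ c ∈ P, x ∈ c.1 := by
  rw [← hP.cover] at hx
  simpa using hx

theorem IsCellPartition.eq_of_mem {n : ℕ} {X : Set (Fin n → ℝ)}
    {P : Finset (Set (Fin n → ℝ) × ℕ)} (hP : S.IsCellPartition X P) {c c' x} (hc : c ∈ P)
    (hc' : c' ∈ P) (hx : x ∈ c.1) (hx' : x ∈ c'.1) : c = c' := by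
  by_contra h
  exact disjoint_left.1 (hP.disjoint c hc c' hc' h) hx hx'

theorem isCellPartition_singleton {n d : ℕ} {C : Set (Fin n → ℝ)} (hC : S.IsCell C d) :
    S.IsCellPartition C {(C, d)} :=
  ⟨by simpa using hC, by simp, by simp⟩

theorem hasCellDecomposition_zero : S.HasCellDecomposition 0 := by
  refine fun F _ => ⟨{(univ, 0)}, isCellPartition_singleton .point, fun c hc A _ => ?_⟩
  rw [Finset.mem_singleton] at hc
  subst hc
  by_cases h : default ∈ A
  · left
    intro x _
    rwa [Subsingleton.elim x default]
  · right
    rw [disjoint_left]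
    intro x _ hx
    rw [Subsingleton.elim x default] at hx
    exact h hx

/-- The frontier of the closed set `closure l` is nowhere dense. Off this frontier a point of `l` is
interior to `closure l`, and `l` is relatively open in its closure. -/
theorem _root_.IsLocallyClosed.mem_interior_residual {X : Type*} [TopologicalSpace X] {l : Set X}
    (hl : IsLocallyClosed l) : {x | x ∈ l → x ∈ interior l} ∈ residual X := by
  have h : (frontier (closure l))ᶜ ∈ residual X := by
    refine residual_of_dense_open isClosed_frontier.isOpen_compl ?_
    rw [← interior_eq_empty_iff_dense_compl]
    exact interior_frontier isClosed_closure
  filter_upwards [h] with x hx hxl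
  obtain ⟨U, Z, hU, hZ, rfl⟩ := hl
  have hx' : x ∈ interior (closure (U ∩ Z)) := by
    by_contra h'
    exact hx ⟨subset_closure (subset_closure hxl), h'⟩
  rw [mem_interior]
  refine ⟨interior (closure (U ∩ Z)) ∩ U, fun y hy => ⟨hy.2, ?_⟩, isOpen_interior.inter hU,
    hx', hxl.1⟩
  exact closure_minimal inter_subset_right hZ (interior_subset hy.1)

/-- A definable set is a finite union of locally closed cells, so a generic point of `ℝⁿ` that lies
in it is an interior point. -/
theorem HasCellDecomposition.mem_interior_residual {n : ℕ} (h : S.HasCellDecomposition n)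
    {A : Set (Fin n → ℝ)} (hA : S.Def A) : {x | x ∈ A → x ∈ interior A} ∈ residual (Fin n → ℝ) := by
  obtain ⟨P, hP, -⟩ := h.exists_partition hA ∅ (by simp)
  have : ∀ᶠ x in residual (Fin n → ℝ), ∀ c ∈ P, x ∈ c.1 → x ∈ interior c.1 := by
    rw [Filter.eventually_all_finset]
    exact fun c hc => (hP.isCell c hc).isLocallyClosed.mem_interior_residual
  filter_upwards [this] with x hx hxA
  obtain ⟨c, hc, hxc⟩ := hP.exists_mem hxA
  exact interior_mono (hP.subset hc) (hx c hc hxc)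

/-- By Baire, a generic `y` is an interior point of each set that contains it among countably many
definable ones: those fixing the number of points of the fibre, and those requiring exactly one
point in a given rational interval. Near such a `y` each point of the fibre persists within `ε` and
the total number does not change, which is goodness. -/
theorem HasCellDecomposition.dense_goodAt {n : ℕ} (h : S.HasCellDecomposition n)
    {A : Set ((Fin n → ℝ) × ℝ)} (hA : S.Def A) (hfin : ∀ y, (fibre A y).Finite) :
    Dense {y | GoodAt A y} := by
  have hfin' : ∀ (a b : ℝ) (y : Fin n → ℝ),
      (fibre (A ∩ {p | a < p.2 ∧ p.2 < b}) y).Finite := fun a b y =>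
    (hfin y).subset fun t ht => ht.1
  have hdef : ∀ a b : ℝ, S.Def (A ∩ {p : (Fin n → ℝ) × ℝ | a < p.2 ∧ p.2 < b}) := fun a b =>
    hA.inter ((def_lt (defFun_const a) defFun_snd).and (def_lt defFun_snd (defFun_const b)))
  have h1 : ∀ᶠ y in residual (Fin n → ℝ), ∀ k : ℕ, (fibre A y).ncard = k →
      y ∈ interior {y | (fibre A y).ncard = k} :=
    eventually_countable_forall.2 fun k => h.mem_interior_residual (def_ncard_eq hA hfin k)
  have h2 : ∀ᶠ y in residual (Fin n → ℝ), ∀ a b : ℚ,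
      (fibre (A ∩ {p | (a : ℝ) < p.2 ∧ p.2 < b}) y).ncard = 1 →
      y ∈ interior {y | (fibre (A ∩ {p | (a : ℝ) < p.2 ∧ p.2 < b}) y).ncard = 1} :=
    eventually_countable_forall.2 fun a => eventually_countable_forall.2 fun b =>
      h.mem_interior_residual (def_ncard_eq (hdef a b) (hfin' a b) 1)
  refine (dense_of_mem_residual (h1.and h2)).mono ?_
  rintro y ⟨h1, h2⟩
  obtain ⟨γ, hγ, hsep⟩ := (hfin y).exists_separation
  refine ⟨γ / 2, by positivity, fun ε ⟨hε, hεγ⟩ => ?_⟩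
  have h3 : ∀ᶠ y' in 𝓝 y, (fibre A y').ncard = (fibre A y).ncard :=
    mem_interior_iff_mem_nhds.1 (h1 _ rfl)
  have h4 : ∀ᶠ y' in 𝓝 y, ∀ r ∈ fibre A y, ∃ r' ∈ fibre A y', |r - r'| < ε := by
    rw [Filter.eventually_all_finite (hfin y)]
    intro r hr
    obtain ⟨a, ha, ha'⟩ := exists_rat_btwn (show r - ε < r by linarith)
    obtain ⟨b, hb, hb'⟩ := exists_rat_btwn (show r < r + ε by linarith)
    have e : fibre (A ∩ {p | (a : ℝ) < p.2 ∧ p.2 < b}) y = {r} := by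
      ext t
      constructor
      · rintro ⟨ht, h1, h2⟩
        refine hsep t ht r hr ?_
        simp only at h1 h2
        rw [abs_lt]; constructor <;> linarith
      · rintro rfl
        exact ⟨hr, ha', hb⟩
    have := mem_interior_iff_mem_nhds.1 (h2 a b (by rw [e, ncard_singleton]))
    filter_upwards [this] with y' hy'
    obtain ⟨r', hr'⟩ := ncard_eq_one.1 hy'
    have : r' ∈ fibre (A ∩ {p | (a : ℝ) < p.2 ∧ p.2 < b}) y' := by rw [hr']; rfl
    refine ⟨r', this.1, ?_⟩
    have h1 := this.2.1
    have h2 := this.2.2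
    simp only at h1 h2
    rw [abs_lt]; constructor <;> linarith
  obtain ⟨δ, hδ, h5⟩ := Metric.eventually_nhds_iff.1 (h3.and h4)
  refine ⟨δ, hδ, fun y' ⟨_, hy'⟩ => ?_⟩
  obtain ⟨hcard, hex⟩ := h5 hy'
  choose! g hgA hgε using hex
  have hinj : InjOn g (fibre A y) := by
    intro a ha b hb e
    refine hsep a ha b hb ?_
    have h1 := hgε a ha
    have h2 := hgε b hb
    rw [← e, abs_sub_comm] at h2
    have := abs_sub_le a (g a) b
    linarith
  -- Equal cardinalities make the injective matching surjective, so no points appear elsewhere.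
  have himg : g '' fibre A y = fibre A y' := by
    refine eq_of_subset_of_ncard_le (image_subset_iff.2 hgA) ?_ (hfin y')
    rw [hinj.ncard_image, hcard]
  refine ⟨fun r hr => ⟨g r, hgA r hr, hgε r hr, fun r'' hr'' hd => ?_⟩, fun r' hr' => ?_⟩
  · obtain ⟨a, ha, rfl⟩ := himg.ge hr''
    have : a = r := by
      refine hsep a ha r hr ?_
      have h1 := hgε a ha
      rw [abs_sub_comm] at hd
      have h2 := abs_sub_le a (g a) r
      linarith
    rw [this]
  · obtain ⟨a, ha, rfl⟩ := himg.ge hr'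
    exact ⟨a, ha, hgε a ha⟩

open Classical in
/-- Every cell has a partition into cells over which the fibres of `A` vary nicely. -/
theorem IsCell.exists_niceOn {N : ℕ} (hN : ∀ m ≤ N, S.HasCellDecomposition m) :
    ∀ d ≤ N, ∀ {n : ℕ} {C : Set (Fin n → ℝ)}, S.IsCell C d →
      ∀ {A : Set ((Fin n → ℝ) × ℝ)}, S.Def A → (∀ y, (fibre A y).Finite) →
      ∃ P, S.IsCellPartition C P ∧ ∀ c ∈ P, NiceOn A c.1 := by
  intro d
  induction d using Nat.strong_induction_on with
  | _ d ih =>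
  intro hd n C hC A hA hfin
  obtain ⟨σ, D, q, hq⟩ := hC.exists_chart
  -- The family is transported along the chart to the open cell `D`, because density of the good
  -- points is only useful on open sets.
  set A' : Set ((Fin d → ℝ) × ℝ) := {p | ∃ y : Fin n → ℝ, y ∈ C ∧ y ∘ σ = p.1 ∧ (y, p.2) ∈ A}
    with hA'
  have hA'def : S.Def A' := by
    refine Def.ex (p := fun (p : (Fin d → ℝ) × ℝ) (y : Fin n → ℝ) =>
      y ∈ C ∧ y ∘ σ = p.1 ∧ (y, p.2) ∈ A)
      (Def.and (hC.def.preimage defFun_snd) (Def.and ?_ ?_))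
    · exact def_eq_pi (defFun_pi fun i => defFun_snd.apply _) defFun_fst.fst
    · exact hA.preimage (defFun_snd.prodMk defFun_fst.snd)
  have hfib : ∀ x ∈ C, fibre A' (x ∘ σ) = fibre A x := by
    intro x hx
    ext t
    constructor
    · rintro ⟨y, hy, e, h⟩
      have : y = x := by
        rw [← hq.left_inv y hy, ← hq.left_inv x hx]; exact congrArg q e
      rw [this] at h; exact h
    · intro h
      exact ⟨x, hx, rfl, h⟩
  have hfin' : ∀ z, (fibre A' z).Finite := by
    intro z
    by_cases hz : z ∈ D
    · rw [← hq.right_inv z hz, hfib _ (hq.mapsTo z hz)]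
      exact hfin _
    · convert finite_empty
      ext t
      simp only [mem_empty_iff_false, iff_false]
      rintro ⟨y, hy, e, -⟩
      have e : y ∘ σ = z := e
      exact hz (e ▸ hq.mapsTo' y hy)
  have hpart : ∃ Q, S.IsCellPartition D Q ∧ ∀ c ∈ Q, NiceOn A' c.1 := by
    obtain ⟨P, hP, hPG⟩ := (hN d hd).exists_partition hq.isCell.def {{y | GoodAt A' y}}
      (by simpa using def_goodAt hA'def)
    have : ∀ c ∈ P, ∃ Q, S.IsCellPartition c.1 Q ∧ ∀ c' ∈ Q, NiceOn A' c'.1 := by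
      intro c hc
      have hcell := hP.isCell c hc
      rcases hcell.dim_le.lt_or_eq with hlt | heq
      -- Cells of smaller dimension fall under the induction on `d`.
      · exact ih _ hlt (by omega) hcell hA'def hfin'
      -- A cell of full dimension is open, so it meets the dense good set; by compatibility it lies
      -- inside it.
      · refine ⟨{c}, isCellPartition_singleton hcell, fun c' hc' => ?_⟩
        rw [Finset.mem_singleton.1 hc']
        refine niceOn_of_goodAt hfin' hcell.isConnected ?_
        rcases hPG c hc _ (Finset.mem_singleton_self _) with h | h
        · exact h
        · obtain ⟨x, hx, hx'⟩ := ((hN d hd).dense_goodAt hA'def hfin').inter_open_nonempty _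
            (hcell.isOpen_of_dim_eq heq) hcell.nonempty
          exact absurd hx' (disjoint_left.1 h hx)
    choose! Q hQ hQn using this
    refine ⟨P.biUnion Q, hP.refine hQ, fun c hc => ?_⟩
    obtain ⟨b, hb, hc⟩ := Finset.mem_biUnion.1 hc
    exact hQn b hb c hc
  obtain ⟨Q, hQ, hQn⟩ := hpart
  refine ⟨Q.image fun c => ({x | x ∈ C ∧ x ∘ σ ∈ c.1}, c.2), ⟨?_, ?_, ?_⟩, ?_⟩
  · intro c hc
    obtain ⟨b, hb, rfl⟩ := Finset.mem_image.1 hc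
    exact hq.isCell_preimage (hQ.isCell b hb) (hQ.subset hb)
  · intro c hc c' hc' hne
    obtain ⟨b, hb, rfl⟩ := Finset.mem_image.1 hc
    obtain ⟨b', hb', rfl⟩ := Finset.mem_image.1 hc'
    have : b ≠ b' := fun e => hne (by rw [e])
    rw [disjoint_left]
    intro x hx hx'
    exact disjoint_left.1 (hQ.disjoint b hb b' hb' this) hx.2 hx'.2
  · ext x
    simp only [Finset.mem_image, mem_iUnion, exists_prop]
    constructor
    · rintro ⟨_, ⟨b, hb, rfl⟩, hx⟩
      exact hx.1
    · intro hx
      obtain ⟨b, hb, hxb⟩ := hQ.exists_mem (hq.mapsTo' x hx)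
      exact ⟨_, ⟨b, hb, rfl⟩, hx, hxb⟩
  · intro c hc
    obtain ⟨b, hb, rfl⟩ := Finset.mem_image.1 hc
    obtain ⟨k, hk, hcont⟩ := hQn b hb
    refine ⟨k, fun y hy => ?_, fun i hi => ?_⟩
    · rw [← hfib y hy.1]
      exact hk _ hy.2
    · have hc : Continuous fun x : Fin n → ℝ => x ∘ σ := by fun_prop
      refine ((hcont i hi).comp hc.continuousOn fun x hx => hx.2).congr fun y hy => ?_
      simp only [Function.comp_def]
      rw [← hfib y hy.1]
      rfl

end OMinimalStructure

end

/-! ### Frontiers of fibres and the induction step of cell decomposition. -/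

noncomputable section

local notation "ini" => Fin.init (α := fun _ => ℝ)
local notation "snc" => Fin.snoc (α := fun _ => ℝ)

theorem IsPreconnected.nonempty_inter_frontier {X : Type*} [TopologicalSpace X] {s t : Set X}
    (hs : IsPreconnected s) (h : (s ∩ t).Nonempty) (h' : (s ∩ tᶜ).Nonempty) :
    (s ∩ frontier t).Nonempty := by
  by_contra H
  have H : ∀ x ∈ s, x ∉ frontier t := fun x hx hx' => H ⟨x, hx, hx'⟩
  have h1 : ∀ x ∈ s, x ∈ t → x ∈ interior t := fun x hx hxt => by
    by_contra hn
    exact H x hx ⟨subset_closure hxt, hn⟩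
  have h2 : ∀ x ∈ s, x ∈ tᶜ → x ∈ interior tᶜ := fun x hx hxt => by
    by_contra hn
    rw [← frontier_compl] at H
    exact H x hx ⟨subset_closure hxt, hn⟩
  obtain ⟨x, -, hx, hx'⟩ := hs (interior t) (interior tᶜ) isOpen_interior isOpen_interior
    (fun x hx => (em (x ∈ t)).imp (h1 x hx) (h2 x hx))
    (h.imp fun x hx => ⟨hx.1, h1 x hx.1 hx.2⟩) (h'.imp fun x hx => ⟨hx.1, h2 x hx.1 hx.2⟩)
  exact interior_subset hx' (interior_subset hx)

/-- There cannot be three frontier points: the middle one would lie between points of `J` near the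
other two, hence in the interior. -/
theorem Set.OrdConnected.finite_frontier {J : Set ℝ} (hJ : J.OrdConnected) :
    (frontier J).Finite := by
  have key : ∀ a ∈ frontier J, ∀ b ∈ frontier J, ∀ c ∈ frontier J, a < b → b < c → False := by
    intro a ha b hb c hc hab hbc
    obtain ⟨a', ha', haJ⟩ := mem_closure_iff.1 ha.1 (Iio b) isOpen_Iio hab
    obtain ⟨c', hc', hcJ⟩ := mem_closure_iff.1 hc.1 (Ioi b) isOpen_Ioi hbc
    refine hb.2 (mem_interior.2 ⟨Ioo a' c', ?_, isOpen_Ioo, ha', hc'⟩)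
    exact Ioo_subset_Icc_self.trans (hJ.out haJ hcJ)
  by_contra h
  have h : (frontier J).Infinite := h
  obtain ⟨x, hx⟩ := h.nonempty
  have : frontier J = (frontier J ∩ Iio x) ∪ (frontier J ∩ {x}) ∪ (frontier J ∩ Ioi x) := by
    ext y
    rcases lt_trichotomy y x with h | rfl | h
    · simp [h, h.not_gt, h.ne]
    · simp
    · simp [h, h.not_gt, h.ne']
  rw [this, infinite_union, infinite_union] at h
  rcases h with (h | h) | h
  · obtain ⟨a, ha, b, hb, hab⟩ := h.nontrivial.exists_lt
    exact key a ha.1 b hb.1 x hx hab hb.2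
  · exact h ((finite_singleton x).inter_of_right _)
  · obtain ⟨a, ha, b, hb, hab⟩ := h.nontrivial.exists_lt
    exact key x hx a ha.1 b hb.1 ha.2 hab

theorem finite_frontier_sUnion {F : Set (Set ℝ)} (hF : F.Finite) (h : ∀ J ∈ F, J.OrdConnected) :
    (frontier (⋃₀ F)).Finite := by
  induction F, hF using Set.Finite.induction_on with
  | empty => simp
  | @insert J F _ _ ih =>
    rw [sUnion_insert]
    refine Finite.subset ((h J (mem_insert _ _)).finite_frontier.union
      (ih fun K hK => h K (mem_insert_of_mem _ hK))) ?_
    refine (frontier_union_subset _ _).trans ?_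
    exact union_subset_union inter_subset_left inter_subset_right

namespace OMinimalStructure

open DefSpace

variable {S : OMinimalStructure}

theorem Def.finite_frontier {X : Set ℝ} (hX : S.Def X) : (frontier X).Finite := by
  obtain ⟨F, hF, hJ, e⟩ := S.tame hX
  have : X = ⋃₀ F := by
    rw [e]; rfl
  rw [this]
  exact finite_frontier_sUnion hF hJ

theorem def_mem_frontier {E : Type} [DefSpace E] {p : E → ℝ → Prop}
    (hp : S.Def {q : E × ℝ | p q.1 q.2}) : S.Def {q : E × ℝ | q.2 ∈ frontier {t | p q.1 t}} := by
  have key : ∀ p : E → ℝ → Prop, S.Def {q : E × ℝ | p q.1 q.2} →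
      S.Def {q : E × ℝ | q.2 ∈ closure {t | p q.1 t}} := by
    intro p hp
    have : S.Def {q : E × ℝ | ∀ ε : ℝ, 0 < ε → ∃ t, p q.1 t ∧ |q.2 - t| < ε} := by
      refine Def.all (p := fun (q : E × ℝ) (ε : ℝ) => 0 < ε → ∃ t, p q.1 t ∧ |q.2 - t| < ε)
        (Def.imp (def_lt (defFun_const 0) defFun_snd) ?_)
      refine Def.ex (p := fun (q : (E × ℝ) × ℝ) (t : ℝ) => p q.1.1 t ∧ |q.1.2 - t| < q.2)
        (Def.and ?_ ?_)
      · exact hp.preimage (φ := fun q : ((E × ℝ) × ℝ) × ℝ => (q.1.1.1, q.2))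
          (defFun_fst.fst.fst.prodMk defFun_snd)
      · exact def_abs_sub_lt defFun_fst.fst.snd defFun_snd defFun_fst.snd
    refine this.congr fun q => ?_
    simp only [mem_ofPred_eq, Metric.mem_closure_iff, Real.dist_eq]
  refine ((key p hp).and (key (fun e t => ¬ p e t) hp.not)).congr fun q => ?_
  simp only [mem_ofPred_eq, frontier_eq_closure_inter_closure, mem_inter_iff]
  exact Iff.rfl

open Classical in
theorem exists_niceOn_univ {n : ℕ} (hn : ∀ m ≤ n, S.HasCellDecomposition m)
    {A : Set ((Fin n → ℝ) × ℝ)} (hA : S.Def A) (hfin : ∀ y, (fibre A y).Finite) :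
    ∃ P, S.IsCellPartition univ P ∧ ∀ c ∈ P, NiceOn A c.1 := by
  obtain ⟨P, hP, -⟩ := hn n le_rfl ∅ (by simp)
  have : ∀ c ∈ P, ∃ Q, S.IsCellPartition c.1 Q ∧ ∀ c' ∈ Q, NiceOn A c'.1 := fun c hc =>
    (hP.isCell c hc).exists_niceOn hn _ (hP.isCell c hc).dim_le hA hfin
  choose! Q hQ hQn using this
  refine ⟨P.biUnion Q, hP.refine hQ, fun c hc => ?_⟩
  obtain ⟨b, hb, hc⟩ := Finset.mem_biUnion.1 hc
  exact hQn b hb c hc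

/-- The points of the cylinder over `C` that lie in `A` and have exactly `i` points of `A`
below. -/
def graphSlot {n : ℕ} (A : Set ((Fin n → ℝ) × ℝ)) (C : Set (Fin n → ℝ)) (i : ℕ) :
    Set (Fin (n + 1) → ℝ) :=
  {x | ini x ∈ C ∧ x (Fin.last n) ∈ fibre A (ini x) ∧
    countBelow (fibre A (ini x)) (x (Fin.last n)) = i}

/-- The points of the cylinder over `C` that lie outside `A` and have exactly `i` points of `A`
below. -/
def bandSlot {n : ℕ} (A : Set ((Fin n → ℝ) × ℝ)) (C : Set (Fin n → ℝ)) (i : ℕ) :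
    Set (Fin (n + 1) → ℝ) :=
  {x | ini x ∈ C ∧ x (Fin.last n) ∉ fibre A (ini x) ∧
    countBelow (fibre A (ini x)) (x (Fin.last n)) = i}

section Slots

variable {n d k : ℕ} {A : Set ((Fin n → ℝ) × ℝ)} {C : Set (Fin n → ℝ)}

theorem defContOn_nthPoint (hA : S.Def A) (hfin : ∀ y, (fibre A y).Finite) (hC : S.Def C)
    (hk : ∀ y ∈ C, (fibre A y).ncard = k)
    (hc : ∀ i < k, ContinuousOn (fun y => nthPoint (fibre A y) i) C) {i : ℕ} (hi : i < k) :
    S.DefContOn (fun y => nthPoint (fibre A y) i) C := by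
  refine ⟨hc i hi, ?_⟩
  have h1 : S.Def {x : Fin (n + 1) → ℝ | ini x ∈ C} := hC.preimage defFun_id.init
  have h2 : S.Def {x : Fin (n + 1) → ℝ | (ini x, x (Fin.last n)) ∈ A} :=
    hA.preimage (defFun_id.init.prodMk (defFun_id.apply _))
  have h3 : S.Def {x : Fin (n + 1) → ℝ | countBelow (fibre A (ini x)) (x (Fin.last n)) = i} :=
    (def_countBelow_eq hA hfin i).preimage
      (φ := fun x : Fin (n + 1) → ℝ => (ini x, x (Fin.last n)))
      (defFun_id.init.prodMk (defFun_id.apply _))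
  refine def_iff.1 ((h1.and (h2.and h3)).congr fun x => ?_)
  simp only [mem_ofPred_eq]
  refine and_congr_right fun hx => ?_
  exact eq_nthPoint_iff (hfin _) (by rw [hk _ hx]; exact hi)

theorem isCell_graphSlot (hA : S.Def A) (hfin : ∀ y, (fibre A y).Finite) (hC : S.IsCell C d)
    (hk : ∀ y ∈ C, (fibre A y).ncard = k)
    (hc : ∀ i < k, ContinuousOn (fun y => nthPoint (fibre A y) i) C) {i : ℕ} (hi : i < k) :
    S.IsCell (graphSlot A C i) d := by
  convert IsCell.graph _ hC (defContOn_nthPoint hA hfin hC.def hk hc hi) using 1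
  ext x
  refine and_congr_right fun hx => ?_
  exact (eq_nthPoint_iff (hfin _) (by rw [hk _ hx]; exact hi)).symm

/-- With points numbered from `0`, the slot with `i` points below lies between the points `i - 1`
and `i`. The lower bound is missing for `i = 0`, the upper one for `i = k`, so there are `k + 1`
bands. -/
theorem isCell_bandSlot (hA : S.Def A) (hfin : ∀ y, (fibre A y).Finite) (hC : S.IsCell C d)
    (hk : ∀ y ∈ C, (fibre A y).ncard = k)
    (hc : ∀ i < k, ContinuousOn (fun y => nthPoint (fibre A y) i) C) {i : ℕ} (hi : i ≤ k) :
    S.IsCell (bandSlot A C i) (d + 1) := by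
  have hlo : ∀ f ∈ (if i = 0 then none else some fun y => nthPoint (fibre A y) (i - 1)),
      i ≠ 0 ∧ f = fun y => nthPoint (fibre A y) (i - 1) := by
    intro f hf
    split_ifs at hf with h
    · simp at hf
    · exact ⟨h, by simpa using hf.symm⟩
  have hhi : ∀ f ∈ (if i = k then none else some fun y => nthPoint (fibre A y) i),
      i ≠ k ∧ f = fun y => nthPoint (fibre A y) i := by
    intro f hf
    split_ifs at hf with h
    · simp at hf
    · exact ⟨h, by simpa using hf.symm⟩
  have := IsCell.band (if i = 0 then none else some fun y => nthPoint (fibre A y) (i - 1))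
    (if i = k then none else some fun y => nthPoint (fibre A y) i) hC
    (fun f hf => by
      obtain ⟨h, rfl⟩ := hlo f hf
      exact defContOn_nthPoint hA hfin hC.def hk hc (by omega))
    (fun f hf => by
      obtain ⟨h, rfl⟩ := hhi f hf
      exact defContOn_nthPoint hA hfin hC.def hk hc (by omega))
    (fun f hf g hg y hy => by
      obtain ⟨h, rfl⟩ := hlo f hf
      obtain ⟨h', rfl⟩ := hhi g hg
      rw [nthPoint_lt_iff (hfin y) (by rw [hk y hy]; omega),
        (nthPoint_spec (hfin y) (by rw [hk y hy]; omega)).2]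
      omega)
  convert this using 1
  ext x
  refine and_congr_right fun hx => ?_
  have hk' := hk _ hx
  have e1 : (∀ f ∈ (if i = 0 then none else some fun y => nthPoint (fibre A y) (i - 1)),
      f (ini x) < x (Fin.last n)) ↔ i ≤ countBelow (fibre A (ini x)) (x (Fin.last n)) := by
    split_ifs with h
    · simp [h]
    · simp only [Option.mem_def, Option.some.injEq, forall_eq']
      rw [nthPoint_lt_iff (hfin _) (by rw [hk']; omega)]
      omega
  have e2 : (∀ f ∈ (if i = k then none else some fun y => nthPoint (fibre A y) i),
      x (Fin.last n) < f (ini x)) ↔ (i ≠ k → x (Fin.last n) < nthPoint (fibre A (ini x)) i) := by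
    split_ifs with h
    · simp [h]
    · simp [h]
  rw [e1, e2]
  have hle := countBelow_le (hfin (ini x)) (x (Fin.last n))
  rw [hk'] at hle
  constructor
  · rintro ⟨h, h'⟩
    refine ⟨h'.ge, fun h1 => ?_⟩
    refine lt_of_le_of_ne ((le_nthPoint_iff (hfin _) (by rw [hk']; omega)).2 h'.le) ?_
    intro e
    exact h (e ▸ (nthPoint_spec (hfin _) (by rw [hk']; omega)).1)
  · rintro ⟨h, h'⟩
    have hcnt : countBelow (fibre A (ini x)) (x (Fin.last n)) = i := by
      refine le_antisymm ?_ h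
      by_cases h1 : i = k
      · omega
      · exact (le_nthPoint_iff (hfin _) (by rw [hk']; omega)).1 (h' h1).le
    refine ⟨fun hmem => ?_, hcnt⟩
    have := countBelow_lt_ncard (hfin _) hmem
    have := countBelow_lt (hfin _) hmem (h' (by omega))
    rw [(nthPoint_spec (hfin _) (by rw [hk']; omega)).2] at this
    omega

open Classical in
/-- The partition of the cylinder over a cell by its slots. -/
theorem isCellPartition_slots (hA : S.Def A) (hfin : ∀ y, (fibre A y).Finite) (hC : S.IsCell C d)
    (hk : ∀ y ∈ C, (fibre A y).ncard = k)
    (hc : ∀ i < k, ContinuousOn (fun y => nthPoint (fibre A y) i) C) :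
    S.IsCellPartition {x : Fin (n + 1) → ℝ | ini x ∈ C}
      ((Finset.range k).image (fun i => (graphSlot A C i, d)) ∪
        (Finset.range (k + 1)).image (fun i => (bandSlot A C i, d + 1))) := by
  refine ⟨?_, ?_, ?_⟩
  · intro c hmem
    simp only [Finset.mem_union, Finset.mem_image, Finset.mem_range] at hmem
    rcases hmem with ⟨i, hi, rfl⟩ | ⟨i, hi, rfl⟩
    · exact isCell_graphSlot hA hfin hC hk hc hi
    · exact isCell_bandSlot hA hfin hC hk hc (by omega)
  · intro c hmem c' hmem' hne
    simp only [Finset.mem_union, Finset.mem_image, Finset.mem_range] at hmem hmem'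
    rw [disjoint_left]
    intro x hx hx'
    rcases hmem with ⟨i, hi, rfl⟩ | ⟨i, hi, rfl⟩ <;>
      rcases hmem' with ⟨j, hj, rfl⟩ | ⟨j, hj, rfl⟩
    · exact hne (by rw [show i = j from hx.2.2.symm.trans hx'.2.2])
    · exact hx'.2.1 hx.2.1
    · exact hx.2.1 hx'.2.1
    · exact hne (by rw [show i = j from hx.2.2.symm.trans hx'.2.2])
  · ext x
    simp only [mem_iUnion, Finset.mem_union, Finset.mem_image, Finset.mem_range, exists_prop]
    constructor
    · rintro ⟨_, ⟨i, -, rfl⟩ | ⟨i, -, rfl⟩, hx⟩ <;> exact hx.1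
    · intro hx
      by_cases hmem : x (Fin.last n) ∈ fibre A (ini x)
      · have := countBelow_lt_ncard (hfin _) hmem
        rw [hk _ hx] at this
        exact ⟨_, Or.inl ⟨_, this, rfl⟩, hx, hmem, rfl⟩
      · have := countBelow_le (hfin (ini x)) (x (Fin.last n))
        rw [hk _ hx] at this
        exact ⟨_, Or.inr ⟨_, Nat.lt_succ_of_le this, rfl⟩, hx, hmem, rfl⟩

end Slots

open Classical in
-- The fibres over `y ∈ ℝⁿ` of the sets of `F` have finite frontiers by tameness, and `A` collects
-- these frontier points. Over a cell where `A` is nice, its points and gaps cut the cylinder into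
-- graphs and bands. On each fibre of such a slot a set `X ∈ F` is all or nothing, so it remains to
-- refine the base until the answer is the same over the whole base cell.
theorem hasCellDecomposition_succ {n : ℕ} (hn : ∀ m ≤ n, S.HasCellDecomposition m) :
    S.HasCellDecomposition (n + 1) := by
  intro F hF
  set A : Set ((Fin n → ℝ) × ℝ) :=
    {q | ∃ X ∈ F, q.2 ∈ frontier {t | (snc q.1 t : Fin (n + 1) → ℝ) ∈ X}} with hAdef
  have hsec : ∀ X ∈ F, S.Def {q : (Fin n → ℝ) × ℝ | (snc q.1 q.2 : Fin (n + 1) → ℝ) ∈ X} :=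
    fun X hX => (hF X hX).snoc defFun_fst defFun_snd
  have hA : S.Def A := Def.bex_finset F fun X hX =>
    def_mem_frontier (p := fun y t => (snc y t : Fin (n + 1) → ℝ) ∈ X) (hsec X hX)
  have hfin : ∀ y, (fibre A y).Finite := by
    intro y
    have : fibre A y = ⋃ X ∈ F, frontier {t | (snc y t : Fin (n + 1) → ℝ) ∈ X} := by
      ext t
      simp [fibre, hAdef]
    rw [this]
    refine F.finite_toSet.biUnion fun X hX => ?_
    exact Def.finite_frontier (S := S) ((hF X hX).snoc (defFun_pi fun i => defFun_const _) defFun_id)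
  obtain ⟨P, hP, hPn⟩ := exists_niceOn_univ hn hA hfin
  -- The base points over which the `i`-th slot is contained in `X`; `true` stands for the graph
  -- slot, `false` for the band slot.
  let W : Bool → ℕ → Set (Fin (n + 1) → ℝ) → Set (Fin n → ℝ) := fun b i X =>
    {y | ∀ t : ℝ, ((b = true ↔ (y, t) ∈ A) ∧ countBelow (fibre A y) t = i) →
      (snc y t : Fin (n + 1) → ℝ) ∈ X}
  have hW : ∀ b i, ∀ X ∈ F, S.Def (W b i X) := by
    intro b i X hX
    refine Def.all (p := fun (y : Fin n → ℝ) (t : ℝ) =>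
      ((b = true ↔ (y, t) ∈ A) ∧ countBelow (fibre A y) t = i) →
        (snc y t : Fin (n + 1) → ℝ) ∈ X)
      (Def.imp (Def.and ?_ (def_countBelow_eq hA hfin i)) (hsec X hX))
    cases b with
    | true => simpa using hA
    | false => exact hA.compl.congr fun q => by simp
  have : ∀ c ∈ P, ∃ Q : Finset (Set (Fin (n + 1) → ℝ) × ℕ),
      S.IsCellPartition {x | ini x ∈ c.1} Q ∧
        ∀ c' ∈ Q, ∀ X ∈ F, c'.1 ⊆ X ∨ Disjoint c'.1 X := by
    intro c hcP
    obtain ⟨k, hk, hcont⟩ := hPn c hcP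
    let F' : Finset (Set (Fin n → ℝ)) := ((Finset.univ : Finset Bool) ×ˢ
      Finset.range (k + 1) ×ˢ F).image fun p => W p.1 p.2.1 p.2.2
    obtain ⟨P', hP', hPW⟩ := (hn n le_rfl).exists_partition (hP.isCell c hcP).def F' (by
      intro B hB
      obtain ⟨p, hp, rfl⟩ := Finset.mem_image.1 hB
      simp only [Finset.mem_product] at hp
      exact hW _ _ _ hp.2.2)
    have hPW' : ∀ c' ∈ P', ∀ b, ∀ i ≤ k, ∀ X ∈ F, c'.1 ⊆ W b i X ∨ Disjoint c'.1 (W b i X) :=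
      fun c' hc' b i hi X hX => hPW c' hc' _ (Finset.mem_image.2 ⟨(b, i, X), by
        simp only [Finset.mem_product, Finset.mem_univ, Finset.mem_range, true_and]
        exact ⟨by omega, hX⟩, rfl⟩)
    refine ⟨P'.biUnion fun c' => (Finset.range k).image (fun i => (graphSlot A c'.1 i, c'.2)) ∪
        (Finset.range (k + 1)).image (fun i => (bandSlot A c'.1 i, c'.2 + 1)), ?_, ?_⟩
    · have := IsCellPartition.biUnion (S := S) (s := P') (X := fun c' => {x | ini x ∈ c'.1})
        (fun c' hc' => isCellPartition_slots hA hfin (hP'.isCell c' hc')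
          (fun y hy => hk y (hP'.subset hc' hy))
          (fun i hi => (hcont i hi).mono (hP'.subset hc')))
        (fun c₁ h₁ c₂ h₂ hne => by
          rw [disjoint_left]
          intro x hx hx'
          exact disjoint_left.1 (hP'.disjoint c₁ h₁ c₂ h₂ hne) hx hx')
      convert this using 1
      ext x
      rw [mem_ofPred_eq, ← hP'.cover]
      simp
    · intro c'' hc'' X hX
      simp only [Finset.mem_biUnion, Finset.mem_union, Finset.mem_image, Finset.mem_range] at hc''
      obtain ⟨c', hc', ⟨i, hi, rfl⟩ | ⟨i, hi, rfl⟩⟩ := hc''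
      · rcases hPW' c' hc' true i hi.le X hX with h | h
        · left
          rintro x ⟨hx, hmem, hcnt⟩
          simpa using h hx (x (Fin.last n)) ⟨iff_of_true rfl hmem, hcnt⟩
        · right
          rw [disjoint_left]
          rintro x ⟨hx, hmem, hcnt⟩ hxX
          refine disjoint_left.1 h hx fun t ⟨ht, hcnt'⟩ => ?_
          have e : t = x (Fin.last n) :=
            countBelow_injOn (hfin _) (ht.1 rfl) hmem (hcnt'.trans hcnt.symm)
          rw [e]
          simpa using hxX
      · rcases hPW' c' hc' false i (by omega) X hX with h | h
        · left
          rintro x ⟨hx, hmem, hcnt⟩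
          simpa using h hx (x (Fin.last n)) ⟨iff_of_false (by simp) hmem, hcnt⟩
        · right
          rw [disjoint_left]
          rintro x ⟨hx, hmem, hcnt⟩ hxX
          refine disjoint_left.1 h hx fun t ⟨ht, hcnt'⟩ => ?_
          -- The fibre of the band slot is connected. If it met both `X` and its complement it would
          -- contain a frontier point, that is, a point of `A`.
          by_contra htX
          have hconn := (ordConnected_gap (hfin (ini x)) i).isPreconnected
          obtain ⟨s, hs, hs'⟩ := hconn.nonempty_inter_frontier
            (t := {t | (snc (ini x) t : Fin (n + 1) → ℝ) ∈ X})
            ⟨x (Fin.last n), ⟨hmem, hcnt⟩, by simpa using hxX⟩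
            ⟨t, ⟨fun h => by simpa using ht.2 h, hcnt'⟩, htX⟩
          exact hs.1 ⟨X, hX, hs'⟩
  choose! Q hQ hQF using this
  refine ⟨P.biUnion Q, ?_, ?_⟩
  · have := IsCellPartition.biUnion hQ fun c₁ h₁ c₂ h₂ hne => by
      rw [disjoint_left]
      intro x hx hx'
      exact disjoint_left.1 (hP.disjoint c₁ h₁ c₂ h₂ hne) hx hx'
    convert this using 1
    symm
    rw [eq_univ_iff_forall]
    intro x
    obtain ⟨c, hc, hx⟩ := hP.exists_mem (mem_univ (ini x))
    simp only [mem_iUnion, exists_prop]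
    exact ⟨c, hc, hx⟩
  · intro c' hc' X hX
    obtain ⟨c, hc, hc'⟩ := Finset.mem_biUnion.1 hc'
    exact hQF c hc c' hc' X hX

/-- The cell decomposition theorem. -/
theorem hasCellDecomposition (n : ℕ) : S.HasCellDecomposition n := by
  induction n using Nat.strong_induction_on with
  | _ n ih =>
    cases n with
    | zero => exact hasCellDecomposition_zero
    | succ n => exact hasCellDecomposition_succ fun m hm => ih m (by omega)

end OMinimalStructure

end

noncomputable section

local notation "ini" => Fin.init (α := fun _ => ℝ)
local notation "snc" => Fin.snoc (α := fun _ => ℝ)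

/-! ### The Euler characteristic does not depend on the partition -/

/-- The Euler integral of an integer-valued step function on the line. -/
def lineIntegral (f : ℝ → ℤ) : ℤ :=
  -Filter.limUnder Filter.atBot f + ∑ᶠ x, (f x - Filter.limUnder (𝓝[>] x) f)

/-- Integer-valued functions on the line that are step functions from the right. -/
structure IsStep (f : ℝ → ℤ) : Prop where
  atBot : ∃ c, Filter.Tendsto f Filter.atBot (𝓝 c)
  right : ∀ x, ∃ c, Filter.Tendsto f (𝓝[>] x) (𝓝 c)
  finite : (Function.support fun x => f x - Filter.limUnder (𝓝[>] x) f).Finite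

theorem IsStep.add {f g : ℝ → ℤ} (hf : IsStep f) (hg : IsStep g) :
    IsStep (fun x => f x + g x) ∧
      lineIntegral (fun x => f x + g x) = lineIntegral f + lineIntegral g := by
  obtain ⟨⟨a, ha⟩, hr, hfin⟩ := hf
  obtain ⟨⟨b, hb⟩, hr', hfin'⟩ := hg
  choose c hc using hr
  choose c' hc' using hr'
  simp only [(hc _).limUnder_eq] at hfin
  simp only [(hc' _).limUnder_eq] at hfin'
  have hsum : ∀ x, Filter.Tendsto (fun x => f x + g x) (𝓝[>] x) (𝓝 (c x + c' x)) :=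
    fun x => (hc x).add (hc' x)
  have e : ∀ x, f x + g x - (c x + c' x) = (f x - c x) + (g x - c' x) := fun x => by ring
  refine ⟨⟨⟨_, ha.add hb⟩, fun x => ⟨_, hsum x⟩, ?_⟩, ?_⟩
  · simp only [(hsum _).limUnder_eq, e]
    exact (hfin.union hfin').subset (Function.support_add _ _)
  · simp only [lineIntegral, (hsum _).limUnder_eq, (ha.add hb).limUnder_eq, ha.limUnder_eq,
      hb.limUnder_eq, (hc _).limUnder_eq, (hc' _).limUnder_eq, e]
    rw [finsum_add_distrib hfin hfin']
    ring

theorem IsStep.const_mul {f : ℝ → ℤ} (hf : IsStep f) (k : ℤ) :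
    IsStep (fun x => k * f x) ∧ lineIntegral (fun x => k * f x) = k * lineIntegral f := by
  obtain ⟨⟨a, ha⟩, hr, hfin⟩ := hf
  choose c hc using hr
  simp only [(hc _).limUnder_eq] at hfin
  have hmul : ∀ x, Filter.Tendsto (fun x => k * f x) (𝓝[>] x) (𝓝 (k * c x)) :=
    fun x => (hc x).const_mul k
  have e : ∀ x, k * f x - k * c x = k * (f x - c x) := fun x => by ring
  refine ⟨⟨⟨_, ha.const_mul k⟩, fun x => ⟨_, hmul x⟩, ?_⟩, ?_⟩
  · simp only [(hmul _).limUnder_eq, e]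
    exact hfin.subset fun x hx h0 => hx (by simp only at h0; simp only [h0, mul_zero])
  · simp only [lineIntegral, (hmul _).limUnder_eq, (ha.const_mul k).limUnder_eq, ha.limUnder_eq,
      (hc _).limUnder_eq, e]
    rw [← mul_finsum]
    ring

theorem isStep_zero : IsStep (fun _ => 0) ∧ lineIntegral (fun _ => 0) = 0 := by
  have h : ∀ x : ℝ, Filter.limUnder (𝓝[>] x) (fun _ : ℝ => (0 : ℤ)) = 0 := fun x =>
    tendsto_const_nhds.limUnder_eq
  have h' : Filter.limUnder Filter.atBot (fun _ : ℝ => (0 : ℤ)) = 0 := tendsto_const_nhds.limUnder_eq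
  refine ⟨⟨⟨0, tendsto_const_nhds⟩, fun x => ⟨0, tendsto_const_nhds⟩, ?_⟩, ?_⟩
  · simp [h]
  · simp [lineIntegral, h, h']

theorem IsStep.sum {ι : Type*} (s : Finset ι) {f : ι → ℝ → ℤ} (hf : ∀ i ∈ s, IsStep (f i)) :
    IsStep (fun x => ∑ i ∈ s, f i x) ∧
      lineIntegral (fun x => ∑ i ∈ s, f i x) = ∑ i ∈ s, lineIntegral (f i) := by
  classical
  induction s using Finset.induction_on with
  | empty => simpa using isStep_zero
  | insert a s ha ih =>
    obtain ⟨h1, h2⟩ := ih fun i hi => hf i (Finset.mem_insert_of_mem hi)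
    obtain ⟨h3, h4⟩ := (hf a (Finset.mem_insert_self _ _)).add h1
    simp only [Finset.sum_insert ha]
    exact ⟨h3, by rw [h4, h2]⟩

open Classical in
theorem isStep_singleton (a : ℝ) : IsStep (fun t => if t = a then 1 else 0) ∧
    lineIntegral (fun t => if t = a then 1 else 0) = 1 := by
  have h : ∀ x : ℝ, Filter.Tendsto (fun t : ℝ => if t = a then (1 : ℤ) else 0) (𝓝[>] x) (𝓝 0) := by
    intro x
    refine tendsto_const_nhds.congr' ?_
    rcases lt_or_ge x a with hx | hx
    · filter_upwards [Ioo_mem_nhdsGT hx] with t ht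
      simp [ht.2.ne]
    · filter_upwards [self_mem_nhdsWithin] with t ht
      simp [(hx.trans_lt ht).ne']
  have h' : Filter.Tendsto (fun t : ℝ => if t = a then (1 : ℤ) else 0) Filter.atBot (𝓝 0) := by
    refine tendsto_const_nhds.congr' ?_
    filter_upwards [Filter.Iio_mem_atBot a] with t ht
    simp [(show t < a from ht).ne]
  refine ⟨⟨⟨_, h'⟩, fun x => ⟨_, h x⟩, ?_⟩, ?_⟩
  · simp only [(h _).limUnder_eq]
    refine (finite_singleton a).subset fun x hx => ?_
    by_contra hxa
    simp only [mem_singleton_iff] at hxa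
    simp [hxa] at hx
  · simp only [lineIntegral, (h _).limUnder_eq, h'.limUnder_eq, sub_zero, neg_zero, zero_add]
    rw [finsum_eq_single _ a (by simp +contextual)]
    simp

open Classical in
-- Since values are compared with limits from the right, the upper end contributes nothing. The
-- lower end contributes the jump `0 - 1`; if there is none, the limit `1` at `-∞` enters with a
-- minus sign.
theorem isStep_interval (lo hi : Option ℝ) (hlt : ∀ a ∈ lo, ∀ b ∈ hi, a < b) :
    IsStep (fun t => if (∀ a ∈ lo, a < t) ∧ (∀ b ∈ hi, t < b) then 1 else 0) ∧
      lineIntegral (fun t => if (∀ a ∈ lo, a < t) ∧ (∀ b ∈ hi, t < b) then 1 else 0) = -1 := by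
  set f : ℝ → ℤ := fun t => if (∀ a ∈ lo, a < t) ∧ (∀ b ∈ hi, t < b) then 1 else 0 with hf
  have h : ∀ x : ℝ, Filter.Tendsto f (𝓝[>] x)
      (𝓝 (if (∀ a ∈ lo, a ≤ x) ∧ (∀ b ∈ hi, x < b) then 1 else 0)) := by
    intro x
    refine tendsto_const_nhds.congr' ?_
    have h1 : ∀ᶠ t in 𝓝[>] x, (∀ a ∈ lo, a ≤ x) ↔ ∀ a ∈ lo, a < t := by
      cases lo with
      | none => exact Filter.Eventually.of_forall fun t => by simp
      | some a =>
        simp only [Option.mem_def, Option.some.injEq, forall_eq']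
        rcases lt_or_ge x a with hx | hx
        · filter_upwards [Ioo_mem_nhdsGT hx] with t ht
          exact iff_of_false (not_le.2 hx) (not_lt.2 ht.2.le)
        · filter_upwards [self_mem_nhdsWithin] with t ht
          exact iff_of_true hx (hx.trans_lt ht)
    have h2 : ∀ᶠ t in 𝓝[>] x, (∀ b ∈ hi, x < b) ↔ ∀ b ∈ hi, t < b := by
      cases hi with
      | none => exact Filter.Eventually.of_forall fun t => by simp
      | some a =>
        simp only [Option.mem_def, Option.some.injEq, forall_eq']
        rcases lt_or_ge x a with hx | hx
        · filter_upwards [Ioo_mem_nhdsGT hx] with t ht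
          exact iff_of_true hx ht.2
        · filter_upwards [self_mem_nhdsWithin] with t ht
          exact iff_of_false (not_lt.2 hx) (not_lt.2 (hx.trans_lt ht).le)
    filter_upwards [h1, h2] with t h1 h2
    simp only [hf, h1, h2]
  have h' : Filter.Tendsto f Filter.atBot (𝓝 (if lo = none then 1 else 0)) := by
    refine tendsto_const_nhds.congr' ?_
    cases lo with
    | none =>
      have : ∀ᶠ t in Filter.atBot, ∀ b ∈ hi, t < b := by
        cases hi with
        | none => simp
        | some b => simpa using Filter.Iio_mem_atBot b
      filter_upwards [this] with t ht
      simp only [hf]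
      rw [if_pos trivial, if_pos ⟨by simp, ht⟩]
    | some a =>
      filter_upwards [Filter.Iio_mem_atBot a] with t ht
      simp [hf, (show t < a from ht).le]
  have hjump : ∀ x : ℝ, f x - (if (∀ a ∈ lo, a ≤ x) ∧ (∀ b ∈ hi, x < b) then 1 else 0) =
      if some x = lo then -1 else 0 := by
    intro x
    simp only [hf]
    by_cases hx : some x = lo
    · rw [if_pos hx, if_neg, if_pos]
      · simp
      · refine ⟨fun a ha => ?_, fun b hb => hlt x (by simp [← hx]) b hb⟩
        rw [← hx] at ha
        simp only [Option.mem_def, Option.some.injEq] at ha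
        exact ha.ge
      · rintro ⟨h1, -⟩
        exact lt_irrefl x (h1 x (by simp [← hx]))
    · rw [if_neg hx]
      have : (∀ a ∈ lo, a < x) ↔ ∀ a ∈ lo, a ≤ x := by
        refine ⟨fun h a ha => (h a ha).le, fun h a ha => lt_of_le_of_ne (h a ha) ?_⟩
        rintro rfl
        exact hx ha.symm
      simp only [this, sub_self]
  refine ⟨⟨⟨_, h'⟩, fun x => ⟨_, h x⟩, ?_⟩, ?_⟩
  · simp only [(h _).limUnder_eq, hjump]
    refine Set.Finite.subset (s := {x | some x = lo}) ?_ fun x hx => ?_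
    · exact Set.Subsingleton.finite fun x hx y hy => by
        simpa using (show some x = some y from hx.trans (Eq.symm hy))
    · by_contra hxa
      simp only [mem_ofPred_eq] at hxa
      simp [hxa] at hx
  · simp only [lineIntegral, (h _).limUnder_eq, h'.limUnder_eq, hjump]
    cases lo with
    | none => simp
    | some a =>
      rw [finsum_eq_single _ a (by simp +contextual)]
      simp

/-- The Euler integral of an integer-valued function on `ℝⁿ`, by iterated integration. -/
def iteratedIntegral : (n : ℕ) → ((Fin n → ℝ) → ℤ) → ℤ
  | 0, f => f Fin.elim0
  | n + 1, f => iteratedIntegral n fun y => lineIntegral fun t => f (snc y t)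

/-! ### Sums over cells as iterated integrals. -/

namespace OMinimalStructure

variable {S : OMinimalStructure}

open Classical in
-- Integrating the indicator function of a cell over the last coordinate gives `ε` times that of the
-- base, with `ε = 1` for a graph and `ε = -1` for a band. These are the signs by which `(-1) ^ dim`
-- changes.
theorem IsCell.exists_base {n d : ℕ} {C : Set (Fin (n + 1) → ℝ)} (h : S.IsCell C d) :
    ∃ (Y : Set (Fin n → ℝ)) (e : ℕ) (ε : ℤ), S.IsCell Y e ∧ (-1) ^ d = ε * (-1) ^ e ∧
      ∀ y, IsStep (fun t => if (snc y t : Fin (n + 1) → ℝ) ∈ C then 1 else 0) ∧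
        lineIntegral (fun t => if (snc y t : Fin (n + 1) → ℝ) ∈ C then 1 else 0) =
          ε * if y ∈ Y then 1 else 0 := by
  cases h with
  | @graph _ _ Y f hY hf =>
    refine ⟨Y, d, 1, hY, by simp, fun y => ?_⟩
    simp only [mem_ofPred_eq, Fin.init_snoc, Fin.snoc_last]
    by_cases hy : y ∈ Y
    · simpa [hy] using isStep_singleton (f y)
    · simpa [hy] using isStep_zero
  | @band _ d Y lo hi hY hlo hhi hlt =>
    refine ⟨Y, d, -1, hY, by ring, fun y => ?_⟩
    simp only [mem_ofPred_eq, Fin.init_snoc, Fin.snoc_last]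
    by_cases hy : y ∈ Y
    · have := isStep_interval (lo.map fun f => f y) (hi.map fun f => f y) (by
        intro a ha b hb
        obtain ⟨f, hf, rfl⟩ := Option.mem_map.1 ha
        obtain ⟨g, hg, rfl⟩ := Option.mem_map.1 hb
        exact hlt f hf g hg y hy)
      simpa only [hy, true_and, if_true, mul_one, Option.mem_map, forall_exists_index, and_imp,
        forall_apply_eq_imp_iff₂] using this
    · simpa [hy] using isStep_zero

open Classical in
-- Coefficients and repeated or overlapping cells are allowed, because both arise in the bases after
-- one integration.
theorem iteratedIntegral_cells {ι : Type*} : ∀ (n : ℕ) (s : Finset ι) (C : ι → Set (Fin n → ℝ))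
    (d : ι → ℕ) (a : ι → ℤ), (∀ i ∈ s, S.IsCell (C i) (d i)) →
    iteratedIntegral n (fun x => ∑ i ∈ s, a i * if x ∈ C i then 1 else 0) =
      ∑ i ∈ s, a i * (-1) ^ d i
  | 0, s, C, d, a, h => by
    simp only [iteratedIntegral]
    refine Finset.sum_congr rfl fun i hi => ?_
    have hC := h i hi
    have hd : d i = 0 := Nat.le_zero.1 hC.dim_le
    obtain ⟨x, hx⟩ := hC.nonempty
    rw [if_pos (by rwa [Subsingleton.elim x Fin.elim0] at hx), hd, pow_zero]
  | n + 1, s, C, d, a, h => by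
    have := fun i hi => (h i hi).exists_base
    choose! Y e ε hY hε hstep using this
    have key : (fun y => lineIntegral fun t => ∑ i ∈ s, a i *
        if (snc y t : Fin (n + 1) → ℝ) ∈ C i then 1 else 0) =
        fun y => ∑ i ∈ s, (a i * ε i) * if y ∈ Y i then 1 else 0 := by
      funext y
      rw [(IsStep.sum s fun i hi => ((hstep i hi y).1.const_mul (a i)).1).2]
      refine Finset.sum_congr rfl fun i hi => ?_
      rw [((hstep i hi y).1.const_mul (a i)).2, (hstep i hi y).2, mul_assoc]
    rw [iteratedIntegral, key, iteratedIntegral_cells n s Y e _ hY]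
    refine Finset.sum_congr rfl fun i hi => ?_
    rw [hε i hi, mul_assoc]

open Classical in
-- The right-hand side does not mention `P`; this is the independence of the partition.
theorem IsCellPartition.sum_eq_iteratedIntegral {n : ℕ} {A : Set (Fin n → ℝ)}
    {P : Finset (Set (Fin n → ℝ) × ℕ)} (hP : S.IsCellPartition A P) :
    ∑ c ∈ P, (-1) ^ c.2 = iteratedIntegral n (fun x => if x ∈ A then 1 else 0) := by
  have := iteratedIntegral_cells n P (fun c => c.1) (fun c => c.2) (fun _ => 1) hP.isCell
  simp only [one_mul] at this
  rw [← this]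
  congr 1
  funext x
  by_cases hx : x ∈ A
  · obtain ⟨c, hc, hxc⟩ := hP.exists_mem hx
    rw [if_pos hx, Finset.sum_eq_single c]
    · rw [if_pos hxc]
    · intro c' hc' hne
      rw [if_neg fun h => hne (hP.eq_of_mem hc' hc h hxc)]
    · exact fun h => absurd hc h
  · rw [if_neg hx, Finset.sum_eq_zero]
    intro c hc
    rw [if_neg fun h => hx (hP.subset hc h)]

theorem IsCellPartition.eulerChar_eq {n : ℕ} {A : Set (Fin n → ℝ)}
    {P : Finset (Set (Fin n → ℝ) × ℕ)} (hP : S.IsCellPartition A P) :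
    S.eulerChar A = ∑ c ∈ P, (-1) ^ c.2 := by
  have h : ∃ P, S.IsCellPartition A P := ⟨P, hP⟩
  rw [eulerChar, dif_pos h, h.choose_spec.sum_eq_iteratedIntegral, hP.sum_eq_iteratedIntegral]

open Classical in
/-- The Euler integral of a function that is constant on the cells of a partition. -/
theorem IsCellPartition.eulerIntegral_eq {X : Type u} {n : ℕ} {ι : X → Fin n → ℝ}
    {R : Type v} [AddCommGroup R] {f : X → R}
    {P : Finset (Set (Fin n → ℝ) × ℕ)} (hP : S.IsCellPartition (range ι) P)
    (v : Set (Fin n → ℝ) × ℕ → R) (hv : ∀ c ∈ P, ∀ x, ι x ∈ c.1 → f x = v c) :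
    S.eulerIntegral ι f = ∑ c ∈ P, (-1 : ℤ) ^ c.2 • v c := by
  have hpart : ∀ s : R, S.IsCellPartition (ι '' (f ⁻¹' {s})) (P.filter fun c => v c = s) := by
    intro s
    refine ⟨fun c hc => hP.isCell c (Finset.mem_filter.1 hc).1,
      fun c hc c' hc' => hP.disjoint c (Finset.mem_filter.1 hc).1 c' (Finset.mem_filter.1 hc').1,
      ?_⟩
    ext y
    simp only [mem_iUnion, Finset.mem_filter, exists_prop]
    constructor
    · rintro ⟨c, ⟨hc, hs⟩, hy⟩
      obtain ⟨x, rfl⟩ := hP.subset hc hy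
      exact ⟨x, (hv c hc x hy).trans hs, rfl⟩
    · rintro ⟨x, hx, rfl⟩
      obtain ⟨c, hc, hy⟩ := hP.exists_mem (mem_range_self x)
      exact ⟨c, ⟨hc, (hv c hc x hy).symm.trans hx⟩, hy⟩
  have e : ∀ s : R, S.eulerChar (ι '' (f ⁻¹' {s})) • s =
      ∑ c ∈ P.filter (fun c => v c = s), (-1 : ℤ) ^ c.2 • v c := by
    intro s
    rw [(hpart s).eulerChar_eq, Finset.sum_smul]
    exact Finset.sum_congr rfl fun c hc => by rw [(Finset.mem_filter.1 hc).2]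
  rw [eulerIntegral, finsum_congr e, finsum_eq_sum_of_support_subset (s := P.image v)]
  · exact Finset.sum_fiberwise_of_maps_to (fun c hc => Finset.mem_image_of_mem v hc) _
  · intro s hs
    obtain ⟨c, hc, -⟩ := Finset.exists_ne_zero_of_sum_ne_zero hs
    rw [Finset.mem_filter] at hc
    simpa using ⟨c.1, c.2, hc⟩

end OMinimalStructure

end

noncomputable section

/-! ### Restriction and comparison of topological groupoids -/

/-- The restriction of a quotient map to the preimage of a locally closed set is a quotient
map. -/
theorem Topology.IsQuotientMap.restrictPreimage_of_isLocallyClosed {X Y : Type*}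
    [TopologicalSpace X] [TopologicalSpace Y] {f : X → Y} (hf : IsQuotientMap f) {s : Set Y}
    (hs : IsLocallyClosed s) : IsQuotientMap (s.restrictPreimage f) := by
  rw [isQuotientMap_iff]
  refine ⟨.of_isOpen_preimage_iff_isOpen fun V => ⟨fun hV => ?_, fun hV =>
    hV.preimage hf.continuous.restrictPreimage⟩, hf.surjective.restrictPreimage s⟩
  obtain ⟨U, Z, hU, hZ, rfl⟩ := hs
  obtain ⟨O, hO, e⟩ := isOpen_induced_iff.1 hV
  -- The preimage of `V` alone is open only relative to the preimage of `U ∩ Z`. Adding `U \ Z`,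
  -- which does not meet the subspace, makes it open.
  refine isOpen_induced_iff.2 ⟨Subtype.val '' V ∪ (U \ Z), ?_, ?_⟩
  · rw [← hf.isOpen_preimage]
    have : f ⁻¹' (Subtype.val '' V ∪ (U \ Z)) = (O ∩ f ⁻¹' U) ∪ f ⁻¹' (U \ Z) := by
      ext x
      have key : ∀ hx : f x ∈ U ∩ Z, x ∈ O ↔ (⟨f x, hx⟩ : ↥(U ∩ Z)) ∈ V := fun hx =>
        Set.ext_iff.1 e ⟨x, hx⟩
      constructor
      · rintro (⟨⟨y, hy⟩, hyV, rfl⟩ | hx)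
        · exact Or.inl ⟨(key hy).2 hyV, hy.1⟩
        · exact Or.inr hx
      · rintro (⟨hxO, hxU⟩ | hx)
        · by_cases hxZ : f x ∈ Z
          · exact Or.inl ⟨⟨f x, hxU, hxZ⟩, (key ⟨hxU, hxZ⟩).1 hxO, rfl⟩
          · exact Or.inr ⟨hxU, hxZ⟩
        · exact Or.inr hx
    rw [this]
    exact (hO.inter (hU.preimage hf.continuous)).union
      ((hU.sdiff hZ).preimage hf.continuous)
  · ext y
    simp only [mem_preimage, mem_union, mem_image, Subtype.exists, exists_and_right,
      exists_eq_right, mem_sdiff]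
    exact ⟨fun h => h.elim (fun ⟨_, h⟩ => h) fun h => absurd y.2.2 h.2, fun h => Or.inl ⟨y.2, h⟩⟩

namespace TopGroupoid

variable {G H K G' H' : TopGroupoid.{u}}

theorem isQuotientMap_orbit (G : TopGroupoid.{u}) : IsQuotientMap G.orbit := isQuotientMap_quot_mk

theorem orbit_eq_iff {x y : G.Obj} : G.orbit x = G.orbit y ↔ ∃ g, G.src g = x ∧ G.tgt g = y :=
  Quotient.eq (r := G.orbitSetoid)

/-- The composition of homomorphisms. -/
def Hom.comp (Ψ : H.Hom K) (Φ : G.Hom H) : G.Hom K where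
  obj x := Ψ.obj (Φ.obj x)
  arr g := Ψ.arr (Φ.arr g)
  continuous_obj := Ψ.continuous_obj.comp Φ.continuous_obj
  continuous_arr := Ψ.continuous_arr.comp Φ.continuous_arr
  src_arr g := by rw [Ψ.src_arr, Φ.src_arr]
  tgt_arr g := by rw [Ψ.tgt_arr, Φ.tgt_arr]
  arr_unit x := by rw [Φ.arr_unit, Ψ.arr_unit]
  arr_inv g := by rw [Φ.arr_inv, Ψ.arr_inv]
  arr_mul g h e := by
    have := Ψ.arr_mul (Φ.arr g) (Φ.arr h) ((Φ.src_arr g).trans ((congrArg Φ.obj e).trans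
      (Φ.tgt_arr h).symm))
    rw [← this, Φ.arr_mul]

/-- An isomorphism of `G` with the restriction of `H` to a union of orbits. -/
structure Hom.IsSaturatedEmbedding (j : G.Hom H) : Prop where
  isEmbedding_obj : IsEmbedding j.obj
  isEmbedding_arr : IsEmbedding j.arr
  mem_range_arr : ∀ g, H.src g ∈ range j.obj → g ∈ range j.arr

theorem Hom.IsSaturatedEmbedding.mem_range_arr' {j : G.Hom H} (hj : j.IsSaturatedEmbedding)
    (g : H.Arr) (hg : H.tgt g ∈ range j.obj) : g ∈ range j.arr := by
  obtain ⟨a, ha⟩ := hj.mem_range_arr (H.inv g) (by rwa [H.src_inv])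
  refine ⟨G.inv a, ?_⟩
  rw [j.arr_inv, ha]
  -- Associativity of this product yields `inv (inv g) = g`.
  have h1 := H.mul_assoc (H.inv (H.inv g)) (H.inv g) g
    (by rw [H.src_inv]) (by rw [H.src_inv])
  rw [mul_congr (H.inv_mul (H.inv g)) rfl, mul_congr rfl (H.inv_mul g), unit_mul', mul_unit'] at h1
  exact h1.symm

theorem Hom.IsSaturatedEmbedding.comp {Ψ : H.Hom K} {Φ : G.Hom H} (hΨ : Ψ.IsSaturatedEmbedding)
    (hΦ : Φ.IsSaturatedEmbedding) : (Ψ.comp Φ).IsSaturatedEmbedding where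
  isEmbedding_obj := hΨ.isEmbedding_obj.comp hΦ.isEmbedding_obj
  isEmbedding_arr := hΨ.isEmbedding_arr.comp hΦ.isEmbedding_arr
  mem_range_arr g := by
    rintro ⟨x, hx⟩
    obtain ⟨a, rfl⟩ := hΨ.mem_range_arr g ⟨_, hx⟩
    rw [Ψ.src_arr] at hx
    obtain ⟨b, rfl⟩ := hΦ.mem_range_arr a ⟨x, hΨ.isEmbedding_obj.injective hx⟩
    exact ⟨b, rfl⟩

/-- The inclusion of a restriction. -/
def restrictHom (G : TopGroupoid.{u}) (A : Set G.Obj) : (G.restrict A).Hom G where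
  obj := Subtype.val
  arr := Subtype.val
  continuous_obj := continuous_subtype_val
  continuous_arr := continuous_subtype_val
  src_arr _ := rfl
  tgt_arr _ := rfl
  arr_unit _ := rfl
  arr_inv _ := rfl
  arr_mul _ _ _ := rfl

theorem isSaturatedEmbedding_overOrbits (G : TopGroupoid.{u}) (X : Set G.OrbitSpace) :
    (G.restrictHom (G.orbit ⁻¹' X)).IsSaturatedEmbedding where
  isEmbedding_obj := IsEmbedding.subtypeVal
  isEmbedding_arr := IsEmbedding.subtypeVal
  mem_range_arr g hg := by
    obtain ⟨x, hx⟩ := hg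
    have h1 : G.src g ∈ G.orbit ⁻¹' X := hx ▸ x.2
    refine ⟨⟨g, h1, ?_⟩, rfl⟩
    have : G.orbit (G.tgt g) = G.orbit (G.src g) := (orbit_eq_iff.2 ⟨g, rfl, rfl⟩).symm
    rw [mem_preimage, this]
    exact h1

theorem Hom.IsSaturatedEmbedding.arr_mem_range {j : G.Hom H} (hj : j.IsSaturatedEmbedding)
    (Φ : K.Hom H) (h : ∀ k, Φ.obj k ∈ range j.obj) (a : K.Arr) : Φ.arr a ∈ range j.arr :=
  hj.mem_range_arr _ (by rw [Φ.src_arr]; exact h _)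

section Lift

variable {j : G.Hom H} (hj : j.IsSaturatedEmbedding) (Φ : K.Hom H)
  (h : ∀ k, Φ.obj k ∈ range j.obj)

/-- A homomorphism into the range of a saturated embedding lifts. -/
def Hom.IsSaturatedEmbedding.lift : K.Hom G where
  obj k := (h k).choose
  arr a := (hj.arr_mem_range Φ h a).choose
  continuous_obj := hj.isEmbedding_obj.continuous_iff.2 (by
    convert Φ.continuous_obj using 1
    exact funext fun k => (h k).choose_spec)
  continuous_arr := hj.isEmbedding_arr.continuous_iff.2 (by
    convert Φ.continuous_arr using 1
    exact funext fun k => (hj.arr_mem_range Φ h k).choose_spec)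
  src_arr a := hj.isEmbedding_obj.injective (by
    rw [← j.src_arr, (hj.arr_mem_range Φ h a).choose_spec, Φ.src_arr, (h _).choose_spec])
  tgt_arr a := hj.isEmbedding_obj.injective (by
    rw [← j.tgt_arr, (hj.arr_mem_range Φ h a).choose_spec, Φ.tgt_arr, (h _).choose_spec])
  arr_unit x := hj.isEmbedding_arr.injective (by
    rw [(hj.arr_mem_range Φ h _).choose_spec, j.arr_unit, (h _).choose_spec, Φ.arr_unit])
  arr_inv a := hj.isEmbedding_arr.injective (by
    rw [(hj.arr_mem_range Φ h _).choose_spec, j.arr_inv, (hj.arr_mem_range Φ h _).choose_spec,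
      Φ.arr_inv])
  arr_mul a b e := hj.isEmbedding_arr.injective (by
    rw [(hj.arr_mem_range Φ h _).choose_spec, j.arr_mul, Φ.arr_mul]
    exact mul_congr (hj.arr_mem_range Φ h a).choose_spec.symm
      (hj.arr_mem_range Φ h b).choose_spec.symm _)

theorem Hom.IsSaturatedEmbedding.obj_lift (k : K.Obj) : j.obj ((hj.lift Φ h).obj k) = Φ.obj k :=
  (h k).choose_spec

theorem Hom.IsSaturatedEmbedding.arr_lift (a : K.Arr) : j.arr ((hj.lift Φ h).arr a) = Φ.arr a :=
  (hj.arr_mem_range Φ h a).choose_spec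

end Lift

/-- The base change of an essential equivalence along a saturated embedding. -/
theorem Hom.IsEssentialEquivalence.lift {Φ : K.Hom G} (hΦ : Φ.IsEssentialEquivalence)
    {j : G'.Hom G} (hj : j.IsSaturatedEmbedding) {B : Set K.Obj}
    (hB : ∀ k, k ∈ B ↔ Φ.obj k ∈ range j.obj) :
    (hj.lift (Φ.comp (K.restrictHom B)) fun k => (hB k.1).1 k.2).IsEssentialEquivalence := by
  set L := hj.lift (Φ.comp (K.restrictHom B)) fun k => (hB k.1).1 k.2 with hL
  have hobj : ∀ k : B, j.obj (L.obj k) = Φ.obj k.1 := fun k =>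
    hj.obj_lift (Φ.comp (K.restrictHom B)) (fun k => (hB k.1).1 k.2) k
  have harr : ∀ a, j.arr (L.arr a) = Φ.arr a.1 := fun a =>
    hj.arr_lift (Φ.comp (K.restrictHom B)) (fun k => (hB k.1).1 k.2) a
  have hsec : ∀ y : G'.Obj, ∃ U : Set G'.Obj, IsOpen U ∧ y ∈ U ∧
      ∃ σ : U → {p : G'.Arr × (K.restrict B).Obj // G'.src p.1 = L.obj p.2},
        Continuous σ ∧ ∀ z : U, G'.tgt (σ z).1.1 = z := by
    intro y
    obtain ⟨U, hU, hyU, σ, hσ, hσ'⟩ := hΦ.local_sections (j.obj y)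
    -- The arrow chosen by the section ends in the saturated range of `j`, so it comes from `G'`;
    -- hence so does its source, and the chosen object of `K` lies in `B`.
    have hr : ∀ z : j.obj ⁻¹' U, (σ ⟨j.obj z.1, z.2⟩).1.1 ∈ range j.arr := fun z =>
      hj.mem_range_arr' _ (by rw [hσ']; exact ⟨_, rfl⟩)
    choose s hs using hr
    have hk : ∀ z : j.obj ⁻¹' U, (σ ⟨j.obj z.1, z.2⟩).1.2 ∈ B := fun z => by
      rw [hB, ← (σ ⟨j.obj z.1, z.2⟩).2, ← hs, j.src_arr]
      exact ⟨_, rfl⟩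
    have hcont : Continuous fun z : j.obj ⁻¹' U => (σ ⟨j.obj z.1, z.2⟩).1 :=
      continuous_subtype_val.comp (hσ.comp
        ((j.continuous_obj.comp continuous_subtype_val).subtype_mk _))
    refine ⟨j.obj ⁻¹' U, hU.preimage j.continuous_obj, hyU,
      fun z => ⟨(s z, ⟨_, hk z⟩), ?_⟩, ?_, ?_⟩
    · apply hj.isEmbedding_obj.injective
      rw [← j.src_arr, hs, (σ ⟨j.obj z.1, z.2⟩).2, hobj]
    · refine Continuous.subtype_mk (Continuous.prodMk ?_ ?_) _
      · rw [hj.isEmbedding_arr.continuous_iff]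
        convert continuous_fst.comp hcont using 1
        exact funext hs
      · exact (continuous_snd.comp hcont).subtype_mk _
    · intro z
      apply hj.isEmbedding_obj.injective
      change j.obj (G'.tgt (s z)) = _
      rw [← j.tgt_arr, hs, hσ']
  refine ⟨fun y => ?_, hsec, ?_⟩
  · obtain ⟨U, _, hy, σ, _, hσ⟩ := hsec y
    exact ⟨σ ⟨y, hy⟩, hσ _⟩
  · have hθ := hΦ.fibred_product
    rw [isHomeomorph_iff_isEmbedding_surjective] at hθ ⊢
    constructor
    -- Followed by `m`, the comparison map for the restricted homomorphism is a restriction of the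
    -- one for `Φ`. It is therefore an embedding.
    · let m : {p : ((K.restrict B).Obj × (K.restrict B).Obj) × G'.Arr //
          G'.src p.2 = L.obj p.1.1 ∧ G'.tgt p.2 = L.obj p.1.2} →
          {p : (K.Obj × K.Obj) × G.Arr // G.src p.2 = Φ.obj p.1.1 ∧ G.tgt p.2 = Φ.obj p.1.2} :=
        fun p => ⟨((p.1.1.1.1, p.1.1.2.1), j.arr p.1.2), (j.src_arr _).trans ((congrArg j.obj p.2.1).trans
          (hobj _)), (j.tgt_arr _).trans ((congrArg j.obj p.2.2).trans (hobj _))⟩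
      have hm : Continuous m := by
        refine Continuous.subtype_mk (Continuous.prodMk (Continuous.prodMk ?_ ?_) ?_) _
        · exact continuous_subtype_val.comp (continuous_fst.comp (continuous_fst.comp
            continuous_subtype_val))
        · exact continuous_subtype_val.comp (continuous_snd.comp (continuous_fst.comp
            continuous_subtype_val))
        · exact j.continuous_arr.comp (continuous_snd.comp continuous_subtype_val)
      refine IsEmbedding.of_comp ?_ hm ?_
      · exact Continuous.subtype_mk (((K.restrict B).continuous_src.prodMk
          (K.restrict B).continuous_tgt).prodMk L.continuous_arr) _
      · have hincl : IsEmbedding (K.restrictHom B).arr := IsEmbedding.subtypeVal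
        convert hθ.1.comp hincl using 1
        funext a
        exact Subtype.ext (Prod.ext rfl (harr a))
    · rintro ⟨⟨⟨b₁, b₂⟩, g⟩, h₁, h₂⟩
      obtain ⟨a, ha⟩ := hθ.2 ⟨((b₁.1, b₂.1), j.arr g), (j.src_arr _).trans ((congrArg j.obj h₁).trans
        (hobj _)), (j.tgt_arr _).trans ((congrArg j.obj h₂).trans (hobj _))⟩
      simp only [Subtype.mk.injEq, Prod.mk.injEq] at ha
      refine ⟨⟨a, by rw [ha.1.1]; exact b₁.2, by rw [ha.1.2]; exact b₂.2⟩, ?_⟩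
      refine Subtype.ext (Prod.ext (Prod.ext (Subtype.ext ha.1.1) (Subtype.ext ha.1.2)) ?_)
      exact hj.isEmbedding_arr.injective ((harr _).trans ha.2)

/-- The base change of a Morita equivalence along saturated embeddings with corresponding
ranges. -/
theorem Hom.IsEssentialEquivalence.transfer {Φ : K.Hom G} (hΦ : Φ.IsEssentialEquivalence)
    {Ψ : K.Hom H} (hΨ : Ψ.IsEssentialEquivalence) {j : G'.Hom G} (hj : j.IsSaturatedEmbedding)
    {j' : H'.Hom H} (hj' : j'.IsSaturatedEmbedding)
    (hr : ∀ k, Φ.obj k ∈ range j.obj ↔ Ψ.obj k ∈ range j'.obj) :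
    ∃ (K' : TopGroupoid.{u}) (Φ' : K'.Hom G') (Ψ' : K'.Hom H') (i : K'.Obj → K.Obj),
      Φ'.IsEssentialEquivalence ∧ Ψ'.IsEssentialEquivalence ∧
      (∀ k, j.obj (Φ'.obj k) = Φ.obj (i k)) ∧ ∀ k, j'.obj (Ψ'.obj k) = Ψ.obj (i k) :=
  ⟨K.restrict (Φ.obj ⁻¹' range j.obj), _, _, Subtype.val, hΦ.lift hj fun _ => Iff.rfl,
    hΨ.lift hj' hr, fun k => hj.obj_lift _ _ k, fun k => hj'.obj_lift _ _ k⟩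

/-- The map of orbit spaces induced by a homomorphism. -/
def Hom.mapOrbit (Φ : G.Hom H) : G.OrbitSpace → H.OrbitSpace :=
  Quotient.map' Φ.obj fun _ _ ⟨g, h, h'⟩ =>
    ⟨Φ.arr g, (Φ.src_arr g).trans (congrArg Φ.obj h), (Φ.tgt_arr g).trans (congrArg Φ.obj h')⟩

theorem Hom.continuous_mapOrbit (Φ : G.Hom H) : Continuous Φ.mapOrbit :=
  (isQuotientMap_orbit G).continuous_iff.2
    ((isQuotientMap_orbit H).continuous.comp Φ.continuous_obj)

/-- Injectivity comes from the fibred product, surjectivity from essential surjectivity; the local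
sections make the inverse continuous after composition with the orbit map of `H`. -/
theorem Hom.IsEssentialEquivalence.isHomeomorph_mapOrbit {Φ : G.Hom H}
    (hΦ : Φ.IsEssentialEquivalence) : IsHomeomorph Φ.mapOrbit := by
  have hbij : Function.Bijective Φ.mapOrbit := by
    constructor
    · rintro ⟨x⟩ ⟨y⟩ h
      obtain ⟨g, h1, h2⟩ := orbit_eq_iff.1 h
      obtain ⟨a, ha⟩ := hΦ.fibred_product.surjective ⟨((x, y), g), h1, h2⟩
      simp only [Subtype.mk.injEq, Prod.mk.injEq] at ha
      exact orbit_eq_iff.2 ⟨a, ha.1.1, ha.1.2⟩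
    · rintro ⟨y⟩
      obtain ⟨p, hp⟩ := hΦ.surjective y
      exact ⟨G.orbit p.1.2, orbit_eq_iff.2 ⟨p.1.1, p.2, hp⟩⟩
  refine isHomeomorph_iff_exists_inverse.2 ⟨Φ.continuous_mapOrbit,
    (Equiv.ofBijective _ hbij).symm, (Equiv.ofBijective _ hbij).left_inv,
    (Equiv.ofBijective _ hbij).right_inv, ?_⟩
  rw [(isQuotientMap_orbit H).continuous_iff, continuous_iff_continuousAt]
  intro y
  obtain ⟨U, hU, hy, σ, hσ, hσ'⟩ := hΦ.local_sections y
  have : ContinuousOn ((Equiv.ofBijective _ hbij).symm ∘ H.orbit) U := by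
    rw [continuousOn_iff_continuous_domRestrict]
    convert (isQuotientMap_orbit G).continuous.comp
      (continuous_snd.comp (continuous_subtype_val.comp hσ)) using 1
    funext z
    simp only [domRestrict_apply, Function.comp_apply]
    rw [Equiv.symm_apply_eq]
    exact (orbit_eq_iff.2 ⟨(σ z).1.1, (σ z).2, hσ' z⟩).symm
  exact this.continuousAt (hU.mem_nhds hy)

/-- The product of homomorphisms. -/
def Hom.prodMap (Φ : G.Hom H) (Ψ : G'.Hom H') : (G.prod G').Hom (H.prod H') where
  obj := Prod.map Φ.obj Ψ.obj
  arr := Prod.map Φ.arr Ψ.arr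
  continuous_obj := Φ.continuous_obj.prodMap Ψ.continuous_obj
  continuous_arr := Φ.continuous_arr.prodMap Ψ.continuous_arr
  src_arr _ := Prod.ext (Φ.src_arr _) (Ψ.src_arr _)
  tgt_arr _ := Prod.ext (Φ.tgt_arr _) (Ψ.tgt_arr _)
  arr_unit _ := Prod.ext (Φ.arr_unit _) (Ψ.arr_unit _)
  arr_inv _ := Prod.ext (Φ.arr_inv _) (Ψ.arr_inv _)
  arr_mul _ _ _ := Prod.ext (Φ.arr_mul _ _ _) (Ψ.arr_mul _ _ _)

theorem Hom.IsEssentialEquivalence.prodMap {Φ : G.Hom H} (hΦ : Φ.IsEssentialEquivalence)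
    {Ψ : G'.Hom H'} (hΨ : Ψ.IsEssentialEquivalence) :
    (Φ.prodMap Ψ).IsEssentialEquivalence := by
  refine ⟨?_, ?_, ?_⟩
  · rintro ⟨y, y'⟩
    obtain ⟨p, hp⟩ := hΦ.surjective y
    obtain ⟨p', hp'⟩ := hΨ.surjective y'
    exact ⟨⟨((p.1.1, p'.1.1), (p.1.2, p'.1.2)), Prod.ext p.2 p'.2⟩, Prod.ext hp hp'⟩
  · rintro ⟨y, y'⟩
    obtain ⟨U, hU, hy, σ, hσ, hs⟩ := hΦ.local_sections y
    obtain ⟨U', hU', hy', σ', hσ', hs'⟩ := hΨ.local_sections y'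
    have h1 : Continuous fun z : ↥(U ×ˢ U') => (σ ⟨z.1.1, z.2.1⟩).1 :=
      continuous_subtype_val.comp (hσ.comp
        ((continuous_fst.comp continuous_subtype_val).subtype_mk _))
    have h2 : Continuous fun z : ↥(U ×ˢ U') => (σ' ⟨z.1.2, z.2.2⟩).1 :=
      continuous_subtype_val.comp (hσ'.comp
        ((continuous_snd.comp continuous_subtype_val).subtype_mk _))
    refine ⟨U ×ˢ U', hU.prod hU', ⟨hy, hy'⟩, fun z =>
      ⟨(((σ ⟨z.1.1, z.2.1⟩).1.1, (σ' ⟨z.1.2, z.2.2⟩).1.1),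
        ((σ ⟨z.1.1, z.2.1⟩).1.2, (σ' ⟨z.1.2, z.2.2⟩).1.2)),
        Prod.ext (σ ⟨z.1.1, z.2.1⟩).2 (σ' ⟨z.1.2, z.2.2⟩).2⟩, ?_, fun z =>
        Prod.ext (hs _) (hs' _)⟩
    exact Continuous.subtype_mk (((continuous_fst.comp h1).prodMk (continuous_fst.comp h2)).prodMk
      ((continuous_snd.comp h1).prodMk (continuous_snd.comp h2))) _
  · have h1 := hΦ.fibred_product
    have h2 := hΨ.fibred_product
    rw [isHomeomorph_iff_isEmbedding_surjective] at h1 h2 ⊢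
    constructor
    · let m : {p : ((G.prod G').Obj × (G.prod G').Obj) × (H.prod H').Arr //
          (H.prod H').src p.2 = (Φ.prodMap Ψ).obj p.1.1 ∧
            (H.prod H').tgt p.2 = (Φ.prodMap Ψ).obj p.1.2} →
          {p : (G.Obj × G.Obj) × H.Arr // H.src p.2 = Φ.obj p.1.1 ∧ H.tgt p.2 = Φ.obj p.1.2} ×
          {p : (G'.Obj × G'.Obj) × H'.Arr // H'.src p.2 = Ψ.obj p.1.1 ∧ H'.tgt p.2 = Ψ.obj p.1.2} :=
        fun p => (⟨((p.1.1.1.1, p.1.1.2.1), p.1.2.1), congrArg Prod.fst p.2.1,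
          congrArg Prod.fst p.2.2⟩, ⟨((p.1.1.1.2, p.1.1.2.2), p.1.2.2), congrArg Prod.snd p.2.1,
          congrArg Prod.snd p.2.2⟩)
      have hsrc : Continuous fun p : {p : ((G.prod G').Obj × (G.prod G').Obj) × (H.prod H').Arr //
          (H.prod H').src p.2 = (Φ.prodMap Ψ).obj p.1.1 ∧
            (H.prod H').tgt p.2 = (Φ.prodMap Ψ).obj p.1.2} => p.1.1.1 :=
        continuous_fst.comp (continuous_fst.comp continuous_subtype_val)
      have htgt : Continuous fun p : {p : ((G.prod G').Obj × (G.prod G').Obj) × (H.prod H').Arr //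
          (H.prod H').src p.2 = (Φ.prodMap Ψ).obj p.1.1 ∧
            (H.prod H').tgt p.2 = (Φ.prodMap Ψ).obj p.1.2} => p.1.1.2 :=
        continuous_snd.comp (continuous_fst.comp continuous_subtype_val)
      have harr : Continuous fun p : {p : ((G.prod G').Obj × (G.prod G').Obj) × (H.prod H').Arr //
          (H.prod H').src p.2 = (Φ.prodMap Ψ).obj p.1.1 ∧
            (H.prod H').tgt p.2 = (Φ.prodMap Ψ).obj p.1.2} => p.1.2 :=
        continuous_snd.comp continuous_subtype_val
      have hm : Continuous m := by
        refine Continuous.prodMk (Continuous.subtype_mk ?_ _) (Continuous.subtype_mk ?_ _)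
        · exact ((continuous_fst.comp hsrc).prodMk (continuous_fst.comp htgt)).prodMk
            (continuous_fst.comp harr)
        · exact ((continuous_snd.comp hsrc).prodMk (continuous_snd.comp htgt)).prodMk
            (continuous_snd.comp harr)
      refine IsEmbedding.of_comp ?_ hm ?_
      · exact Continuous.subtype_mk (((G.prod G').continuous_src.prodMk
          (G.prod G').continuous_tgt).prodMk (Φ.prodMap Ψ).continuous_arr) _
      · exact h1.1.prodMap h2.1
    · rintro ⟨⟨⟨⟨x, x'⟩, ⟨y, y'⟩⟩, ⟨g, g'⟩⟩, e, e'⟩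
      obtain ⟨a, ha⟩ := h1.2 ⟨((x, y), g), congrArg Prod.fst e, congrArg Prod.fst e'⟩
      obtain ⟨a', ha'⟩ := h2.2 ⟨((x', y'), g'), congrArg Prod.snd e, congrArg Prod.snd e'⟩
      simp only [Subtype.mk.injEq, Prod.mk.injEq] at ha ha'
      exact ⟨(a, a'), Subtype.ext (Prod.ext (Prod.ext (Prod.ext ha.1.1 ha'.1.1)
        (Prod.ext ha.1.2 ha'.1.2)) (Prod.ext ha.2 ha'.2))⟩

end TopGroupoid

end

noncomputable section

/-! ### Isotropy groups and local triviality -/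

theorem MonoidHom.nonempty_continuousMulEquiv {M N : Type*} [Group M] [TopologicalSpace M]
    [Group N] [TopologicalSpace N] (f : M →* N) (hf : IsHomeomorph f) : Nonempty (M ≃ₜ* N) :=
  ⟨{ MulEquiv.ofBijective f hf.bijective with
      continuous_toFun := hf.continuous
      continuous_invFun := (hf.homeomorph f).symm.continuous }⟩

theorem IsCompactLieGroup.congr {M N : Type u} [Group M] [TopologicalSpace M] [Group N]
    [TopologicalSpace N] (h : IsCompactLieGroup M) (e : M ≃ₜ* N) : IsCompactLieGroup N := by
  obtain ⟨_, _, E, i₁, i₂, i₃, L, i₄, i₅, i₆, hL, ⟨e'⟩⟩ := h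
  exact ⟨e.toHomeomorph.compactSpace, e.toHomeomorph.t2Space, E, i₁, i₂, i₃, L, i₄, i₅, i₆, hL,
    ⟨e.symm.trans e'⟩⟩

theorem IsCompactLieGroup.isTopologicalGroup {M : Type u} [Group M] [TopologicalSpace M]
    (h : IsCompactLieGroup M) : IsTopologicalGroup M := by
  obtain ⟨_, _, E, _, _, _, L, _, _, _, hL, ⟨e⟩⟩ := h
  have : IsTopologicalGroup L := topologicalGroup_of_lieGroup 𝓘(ℝ, E) ∞
  refine { continuous_mul := ?_, continuous_inv := ?_ }
  · have h1 : Continuous fun p : M × M => e.symm (e p.1 * e p.2) :=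
      e.symm.continuous.comp ((e.continuous.comp continuous_fst).mul
        (e.continuous.comp continuous_snd))
    simpa using h1
  · have h1 : Continuous fun p : M => e.symm (e p)⁻¹ :=
      e.symm.continuous.comp e.continuous.inv
    simpa using h1

namespace CompactLieGrp

instance (H : CompactLieGrp.{u}) : IsTopologicalGroup H.carrier := H.isCompactLie.isTopologicalGroup

instance (H : CompactLieGrp.{u}) : T2Space H.carrier := H.isCompactLie.2.1

theorem cls_eq_iff {H K : CompactLieGrp.{u}} :
    H.cls = K.cls ↔ Nonempty (H.carrier ≃ₜ* K.carrier) :=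
  Quotient.eq (r := isoSetoid)

end CompactLieGrp

namespace TopGroupoid

variable {G H K G' H' : TopGroupoid.{u}}

theorem Hom.IsSaturatedEmbedding.nonempty_isotropy {j : G.Hom H} (hj : j.IsSaturatedEmbedding)
    (x : G.Obj) : Nonempty (G.Isotropy x ≃ₜ* H.Isotropy (j.obj x)) := by
  let f : G.Isotropy x →* H.Isotropy (j.obj x) :=
    { toFun := fun a => ⟨j.arr a.1, (j.src_arr _).trans (congrArg j.obj a.2.1),
        (j.tgt_arr _).trans (congrArg j.obj a.2.2)⟩
      map_one' := Subtype.ext (j.arr_unit x)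
      map_mul' := fun a b => Subtype.ext (j.arr_mul _ _ _) }
  refine f.nonempty_continuousMulEquiv (isHomeomorph_iff_isEmbedding_surjective.2 ⟨?_, ?_⟩)
  · refine IsEmbedding.of_comp (g := (Subtype.val : H.Isotropy (j.obj x) → H.Arr)) ?_
      continuous_subtype_val ?_
    · exact (j.continuous_arr.comp continuous_subtype_val).subtype_mk _
    · exact hj.isEmbedding_arr.comp IsEmbedding.subtypeVal
  · rintro ⟨b, hb, hb'⟩
    obtain ⟨a, rfl⟩ := hj.mem_range_arr b ⟨x, hb.symm⟩
    rw [j.src_arr] at hb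
    rw [j.tgt_arr] at hb'
    exact ⟨⟨a, hj.isEmbedding_obj.injective hb, hj.isEmbedding_obj.injective hb'⟩, rfl⟩

theorem nonempty_isotropy_prod (G H : TopGroupoid.{u}) (p : (G.prod H).Obj) :
    Nonempty ((G.prod H).Isotropy p ≃ₜ* G.Isotropy p.1 × H.Isotropy p.2) := by
  have hv : Continuous (Subtype.val : (G.prod H).Isotropy p → (G.prod H).Arr) :=
    continuous_subtype_val
  have h1 : Continuous fun a : (G.prod H).Isotropy p => a.1.1 := continuous_fst.comp hv
  have h2 : Continuous fun a : (G.prod H).Isotropy p => a.1.2 := continuous_snd.comp hv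
  exact ⟨{
    toFun := fun a => (⟨a.1.1, congrArg Prod.fst a.2.1, congrArg Prod.fst a.2.2⟩,
      ⟨a.1.2, congrArg Prod.snd a.2.1, congrArg Prod.snd a.2.2⟩)
    invFun := fun a => ⟨(a.1.1, a.2.1), Prod.ext a.1.2.1 a.2.2.1, Prod.ext a.1.2.2 a.2.2.2⟩
    left_inv := fun _ => rfl
    right_inv := fun _ => rfl
    map_mul' := fun _ _ => rfl
    continuous_toFun := (h1.subtype_mk _).prodMk (h2.subtype_mk _)
    continuous_invFun := ((continuous_subtype_val.comp continuous_fst).prodMk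
      (continuous_subtype_val.comp continuous_snd)).subtype_mk _ }⟩

section TrivialAction

variable {M N : Type u} [Group M] [TopologicalSpace M] [IsTopologicalGroup M] [T2Space M]
  [Group N] [TopologicalSpace N] [IsTopologicalGroup N] [T2Space N]
  {C D : Type u} [TopologicalSpace C] [T2Space C] [TopologicalSpace D] [T2Space D]

theorem nonempty_isotropy_trivialAction (x : (trivialAction M C).Obj) :
    Nonempty ((trivialAction M C).Isotropy x ≃ₜ* M) :=
  ⟨{ toFun := fun a => a.1.1
     invFun := fun m => ⟨(m, x), rfl, rfl⟩
     left_inv := fun a => Subtype.ext (Prod.ext rfl a.2.1.symm)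
     right_inv := fun _ => rfl
     map_mul' := fun _ _ => rfl
     continuous_toFun := continuous_fst.comp continuous_subtype_val
     continuous_invFun := (continuous_id.prodMk continuous_const).subtype_mk _ }⟩

theorem isHomeomorph_orbit_trivialAction : IsHomeomorph (trivialAction M C).orbit := by
  rw [isHomeomorph_iff_isQuotientMap_injective]
  refine ⟨isQuotientMap_orbit _, fun x y h => ?_⟩
  obtain ⟨g, h1, h2⟩ := orbit_eq_iff.1 h
  exact h1.symm.trans h2

/-- The homomorphism of trivial action groupoids induced by an isomorphism of groups and a
continuous map. -/
def trivialActionHom (e : M ≃ₜ* N) (θ : C → D) (hθ : Continuous θ) :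
    (trivialAction M C).Hom (trivialAction N D) where
  obj := θ
  arr := Prod.map e θ
  continuous_obj := hθ
  continuous_arr := e.continuous.prodMap hθ
  src_arr _ := rfl
  tgt_arr _ := rfl
  arr_unit _ := Prod.ext (map_one e) rfl
  arr_inv _ := Prod.ext (map_inv e _) rfl
  arr_mul _ _ _ := Prod.ext (map_mul e _ _) rfl

theorem isSaturatedEmbedding_trivialActionHom (e : M ≃ₜ* N) {θ : C → D} (hθ : IsEmbedding θ) :
    (trivialActionHom e θ hθ.continuous).IsSaturatedEmbedding where
  isEmbedding_obj := hθ
  isEmbedding_arr := e.toHomeomorph.isEmbedding.prodMap hθ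
  mem_range_arr g := by
    rintro ⟨x, hx⟩
    exact ⟨(e.symm g.1, x), Prod.ext (e.apply_symm_apply _) hx⟩

end TrivialAction

theorem Hom.isEssentialEquivalence_id (G : TopGroupoid.{u}) :
    (⟨id, id, continuous_id, continuous_id, fun _ => rfl, fun _ => rfl, fun _ => rfl,
      fun _ => rfl, fun _ _ _ => rfl⟩ : G.Hom G).IsEssentialEquivalence := by
  refine ⟨fun y => ⟨⟨(G.unit y, y), G.src_unit y⟩, G.tgt_unit y⟩, fun y => ⟨univ, isOpen_univ,
    mem_univ _, fun z => ⟨(G.unit z.1, z.1), G.src_unit _⟩, ?_, fun z => G.tgt_unit _⟩, ?_⟩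
  · exact Continuous.subtype_mk ((G.continuous_unit.comp continuous_subtype_val).prodMk
      continuous_subtype_val) _
  · refine isHomeomorph_iff_exists_inverse.2 ⟨?_, fun p => p.1.2, fun g => rfl, ?_, ?_⟩
    · exact Continuous.subtype_mk
        ((G.continuous_src.prodMk G.continuous_tgt).prodMk continuous_id) _
    · rintro ⟨⟨⟨x, y⟩, g⟩, h, h'⟩
      exact Subtype.ext (Prod.ext (Prod.ext h h') rfl)
    · exact continuous_snd.comp continuous_subtype_val

/-- Isomorphic groupoids are Morita equivalent. -/
theorem Hom.IsSaturatedEmbedding.moritaEquivalent {j : G.Hom H} (hj : j.IsSaturatedEmbedding)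
    (hs : Function.Surjective j.obj) : G.MoritaEquivalent H := by
  have hid := Hom.isEssentialEquivalence_id H
  have hj' : (⟨id, id, continuous_id, continuous_id, fun _ => rfl, fun _ => rfl, fun _ => rfl,
      fun _ => rfl, fun _ _ _ => rfl⟩ : H.Hom H).IsSaturatedEmbedding :=
    ⟨IsEmbedding.id, IsEmbedding.id, fun g _ => ⟨g, rfl⟩⟩
  obtain ⟨K, Φ, Ψ, -, h1, h2, -⟩ := hid.transfer hid hj hj'
    fun k => iff_of_true (hs _) ⟨k, rfl⟩
  exact ⟨K, Φ, Ψ, h1, h2⟩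

theorem range_restrictOrbit (X : Set G.OrbitSpace) :
    range (G.restrictOrbit (G.orbit ⁻¹' X)) = X := by
  ext o
  constructor
  · rintro ⟨⟨x⟩, rfl⟩
    exact x.2
  · induction o using Quotient.inductionOn with
    | h x => exact fun hx => ⟨(G.overOrbits X).orbit ⟨x, hx⟩, rfl⟩

theorem restrictOrbit_injective (X : Set G.OrbitSpace) :
    Function.Injective (G.restrictOrbit (G.orbit ⁻¹' X)) := by
  rintro ⟨x⟩ ⟨y⟩ h
  obtain ⟨g, h1, h2⟩ := orbit_eq_iff.1 h
  have hx : G.src g ∈ G.orbit ⁻¹' X := h1 ▸ x.2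
  have hy : G.tgt g ∈ G.orbit ⁻¹' X := h2 ▸ y.2
  exact orbit_eq_iff.2 ⟨⟨g, hx, hy⟩, Subtype.ext h1, Subtype.ext h2⟩

/-- The orbit space of the restriction maps continuously and bijectively onto `X`, but its quotient
topology could be finer. It is the subspace topology as soon as the restricted orbit map is a
quotient map. -/
theorem isEmbedding_restrictOrbit_of_isQuotientMap {X : Set G.OrbitSpace}
    (h : IsQuotientMap (X.restrictPreimage G.orbit)) :
    IsEmbedding (G.restrictOrbit (G.orbit ⁻¹' X)) := by
  let ν : (G.overOrbits X).OrbitSpace → X := fun o =>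
    ⟨G.restrictOrbit (G.orbit ⁻¹' X) o, (range_restrictOrbit X).le (mem_range_self o)⟩
  have h1 : IsQuotientMap ν :=
    IsQuotientMap.of_comp_isQuotientMap (isQuotientMap_orbit (G.overOrbits X)) h
  have h2 : IsHomeomorph ν := isHomeomorph_iff_isQuotientMap_injective.2
    ⟨h1, fun a b e => restrictOrbit_injective X (congrArg Subtype.val e)⟩
  exact IsEmbedding.subtypeVal.comp h2.isEmbedding

theorem isEmbedding_restrictOrbit_of_isLocallyClosed {X : Set G.OrbitSpace}
    (h : IsLocallyClosed X) : IsEmbedding (G.restrictOrbit (G.orbit ⁻¹' X)) :=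
  isEmbedding_restrictOrbit_of_isQuotientMap
    ((isQuotientMap_orbit G).restrictPreimage_of_isLocallyClosed h)

/-- The groupoid `G` is trivial with isotropy group `M` over the set `C` of orbits, by means of a
Morita equivalence that induces the identity of `C`. -/
def IsTrivialOver (G : TopGroupoid.{u}) [T2Space G.OrbitSpace] (C : Set G.OrbitSpace) (M : Type u)
    [Group M] [TopologicalSpace M] [IsTopologicalGroup M] [T2Space M] : Prop :=
  ∃ (K : TopGroupoid.{u}) (Φ : K.Hom (G.overOrbits C)) (Ψ : K.Hom (trivialAction M C)),
    Φ.IsEssentialEquivalence ∧ Ψ.IsEssentialEquivalence ∧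
      ∀ k, (show C from Ψ.obj k).1 = G.orbit (show G.orbit ⁻¹' C from Φ.obj k).1

section IsTrivialOver

variable [T2Space G.OrbitSpace] {M N : Type u} [Group M] [TopologicalSpace M]
  [IsTopologicalGroup M] [T2Space M] [Group N] [TopologicalSpace N] [IsTopologicalGroup N]
  [T2Space N]

/-- A Morita equivalence induces some homeomorphism of `C`, not necessarily the identity. Twisting
the trivial action by it repairs this, and afterwards restricting both sides to the same subset of
`C` makes sense. -/
theorem MoritaEquivalent.isTrivialOver {C : Set G.OrbitSpace}
    (h : (G.overOrbits C).MoritaEquivalent (trivialAction M C))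
    (hC : IsEmbedding (G.restrictOrbit (G.orbit ⁻¹' C))) : G.IsTrivialOver C M := by
  obtain ⟨K, Φ, Ψ, hΦ, hΨ⟩ := h
  let ν : (G.overOrbits C).OrbitSpace → C := fun o =>
    ⟨G.restrictOrbit (G.orbit ⁻¹' C) o, (range_restrictOrbit C).le (mem_range_self o)⟩
  have hν : IsHomeomorph ν := by
    refine isHomeomorph_iff_isEmbedding_surjective.2 ⟨?_, fun c => ?_⟩
    · exact IsEmbedding.of_comp (hC.continuous.subtype_mk _) continuous_subtype_val hC
    · obtain ⟨o, ho⟩ := (range_restrictOrbit C).ge c.2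
      exact ⟨o, Subtype.ext ho⟩
  let τ := isHomeomorph_orbit_trivialAction (M := M) (C := C) |>.homeomorph _
  let ψ := hΨ.isHomeomorph_mapOrbit.homeomorph _
  let φ := hΦ.isHomeomorph_mapOrbit.homeomorph _
  -- From `C` to the orbit space of the trivial action, back to that of `K`, on to that of the
  -- restriction, and into `C` again.
  let Λ : C ≃ₜ C := (τ.trans (ψ.symm.trans (φ.trans (hν.homeomorph _))))
  have hΛ : ∀ k, Λ (Ψ.obj k) = ν (Φ.mapOrbit (K.orbit k)) := by
    intro k
    have h1 : τ (Ψ.obj k) = ψ (K.orbit k) := rfl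
    change hν.homeomorph _ (φ (ψ.symm (τ (Ψ.obj k)))) = _
    rw [h1, ψ.symm_apply_apply]
    rfl
  have hj' := isSaturatedEmbedding_trivialActionHom (ContinuousMulEquiv.refl M)
    (Λ.symm.isEmbedding)
  have hid : (⟨id, id, continuous_id, continuous_id, fun _ => rfl, fun _ => rfl, fun _ => rfl,
      fun _ => rfl, fun _ _ _ => rfl⟩ :
        (G.overOrbits C).Hom (G.overOrbits C)).IsSaturatedEmbedding :=
    ⟨IsEmbedding.id, IsEmbedding.id, fun g _ => ⟨g, rfl⟩⟩
  obtain ⟨K', Φ', Ψ', i, hΦ', hΨ', h1, h2⟩ := hΦ.transfer hΨ hid hj'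
    fun k => iff_of_true ⟨_, rfl⟩ (Λ.symm.surjective _)
  refine ⟨K', Φ', Ψ', hΦ', hΨ', fun k => ?_⟩
  have h3 : Ψ'.obj k = Λ (Ψ.obj (i k)) := by
    rw [← h2]
    exact (Λ.apply_symm_apply _).symm
  have h4 : Φ'.obj k = Φ.obj (i k) := h1 k
  rw [h3, h4, hΛ]
  rfl

/-- Local triviality is inherited by groupoids with a saturated embedding into `G`. -/
theorem IsTrivialOver.transfer {C : Set G.OrbitSpace} (h : G.IsTrivialOver C M) (e : N ≃ₜ* M)
    {j : G'.Hom G} (hj : j.IsSaturatedEmbedding) {D : Type u} [TopologicalSpace D] [T2Space D]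
    {θ : D → G.OrbitSpace} (hθ : IsEmbedding θ) (hθC : ∀ d, θ d ∈ C)
    (hr : ∀ x, x ∈ range j.obj ↔ G.orbit x ∈ range θ) :
    ∃ (K : TopGroupoid.{u}) (Φ : K.Hom G') (Ψ : K.Hom (trivialAction N D)),
      Φ.IsEssentialEquivalence ∧ Ψ.IsEssentialEquivalence ∧
        ∀ k, θ (Ψ.obj k) = G.orbit (j.obj (Φ.obj k)) := by
  obtain ⟨K, Φ, Ψ, hΦ, hΨ, hc⟩ := h
  have hsat := isSaturatedEmbedding_overOrbits G C
  have hjC : ∀ x, j.obj x ∈ range (G.restrictHom (G.orbit ⁻¹' C)).obj := by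
    intro x
    obtain ⟨d, hd⟩ := (hr (j.obj x)).1 ⟨x, rfl⟩
    exact ⟨⟨j.obj x, by rw [mem_preimage, ← hd]; exact hθC d⟩, rfl⟩
  -- The given span ends in the restriction to `C`, so `j` is factored through this restriction
  -- before the base change.
  let j₁ := hsat.lift j hjC
  have hj₁ : ∀ x, (show G.orbit ⁻¹' C from j₁.obj x).1 = j.obj x := hsat.obj_lift j hjC
  have hj₁a : ∀ a, (G.restrictHom (G.orbit ⁻¹' C)).arr (j₁.arr a) = j.arr a := hsat.arr_lift j hjC
  have hj₁s : j₁.IsSaturatedEmbedding := by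
    refine ⟨IsEmbedding.of_comp j₁.continuous_obj continuous_subtype_val ?_,
      IsEmbedding.of_comp j₁.continuous_arr
        (G.restrictHom (G.orbit ⁻¹' C)).continuous_arr ?_, fun g hg => ?_⟩
    · convert hj.isEmbedding_obj using 1
      exact funext hj₁
    · convert hj.isEmbedding_arr using 1
      exact funext hj₁a
    · obtain ⟨x, hx⟩ := hg
      obtain ⟨a, ha⟩ := hj.mem_range_arr g.1 ⟨x, by rw [← hj₁, hx]; rfl⟩
      exact ⟨a, Subtype.ext ((hj₁a a).trans ha)⟩
  let θ₁ : D → C := fun d => ⟨θ d, hθC d⟩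
  have hθ₁ : IsEmbedding θ₁ :=
    IsEmbedding.of_comp (hθ.continuous.subtype_mk _) continuous_subtype_val hθ
  obtain ⟨K', Φ', Ψ', i, hΦ', hΨ', h1, h2⟩ := hΦ.transfer hΨ hj₁s
    (isSaturatedEmbedding_trivialActionHom e hθ₁) (by
      intro k
      have h1 : Φ.obj k ∈ range j₁.obj ↔
          (show G.orbit ⁻¹' C from Φ.obj k).1 ∈ range j.obj := by
        constructor
        · rintro ⟨x, hx⟩
          exact ⟨x, by rw [← hx]; exact (hj₁ x).symm⟩
        · rintro ⟨x, hx⟩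
          exact ⟨x, Subtype.ext ((hj₁ x).trans hx)⟩
      have h2 : Ψ.obj k ∈ range (trivialActionHom e θ₁ hθ₁.continuous).obj ↔
          (show C from Ψ.obj k).1 ∈ range θ := by
        constructor
        · rintro ⟨d, hd⟩
          exact ⟨d, by rw [← hd]; rfl⟩
        · rintro ⟨d, hd⟩
          exact ⟨d, Subtype.ext hd⟩
      rw [h1, h2, hr, hc])
  refine ⟨K', Φ', Ψ', hΦ', hΨ', fun k => ?_⟩
  have h3 := congrArg Subtype.val (show (θ₁ (Ψ'.obj k) : C) = Ψ.obj (i k) from h2 k)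
  have h4 := congrArg Subtype.val (show (j₁.obj (Φ'.obj k) : G.orbit ⁻¹' C) = Φ.obj (i k) from h1 k)
  have h5 : θ (Ψ'.obj k) = (show C from Ψ.obj (i k)).1 := h3
  rw [h5, hc, ← hj₁]
  exact congrArg G.orbit h4.symm

theorem IsTrivialOver.mono {C X : Set G.OrbitSpace} (h : G.IsTrivialOver C M) (hX : X ⊆ C) :
    G.IsTrivialOver X M := by
  obtain ⟨K, Φ, Ψ, hΦ, hΨ, hc⟩ := h.transfer (ContinuousMulEquiv.refl M)
    (isSaturatedEmbedding_overOrbits G X) (IsEmbedding.subtypeVal (p := fun o => o ∈ X))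
    (fun d => hX d.2) (fun x => by
      rw [Subtype.range_coe]
      exact ⟨fun ⟨y, hy⟩ => hy ▸ y.2, fun hx => ⟨⟨x, hx⟩, rfl⟩⟩)
  exact ⟨K, Φ, Ψ, hΦ, hΨ, hc⟩

end IsTrivialOver

theorem orbit_mem_weakOrbitType {x y : G.Obj} :
    G.orbit y ∈ G.weakOrbitType x ↔ Nonempty (G.Isotropy y ≃ₜ* G.Isotropy x) := by
  constructor
  · rintro ⟨z, ⟨e⟩, hz⟩
    obtain ⟨g, h1, h2⟩ := orbit_eq_iff.1 hz
    exact ⟨(conjEquiv g h1 h2).symm.trans e⟩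
  · exact fun h => ⟨y, h, rfl⟩

end TopGroupoid

end

noncomputable section

/-! ### Restriction of orbit space definable groupoids -/

namespace OSDGroupoid

open OMinimalStructure TopGroupoid

variable {S : OMinimalStructure}

theorem restrict_weakOrbitType (G : OSDGroupoid.{u} S) (X : Set G.gpd.OrbitSpace)
    (x : (G.gpd.overOrbits X).Obj) :
    (G.gpd.overOrbits X).weakOrbitType x =
      G.gpd.restrictOrbit (G.gpd.orbit ⁻¹' X) ⁻¹' G.gpd.weakOrbitType x.1 := by
  ext o
  induction o using Quotient.inductionOn with
  | h y =>
    change (G.gpd.overOrbits X).orbit y ∈ (G.gpd.overOrbits X).weakOrbitType x ↔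
      G.gpd.orbit y.1 ∈ G.gpd.weakOrbitType x.1
    rw [orbit_mem_weakOrbitType, orbit_mem_weakOrbitType]
    obtain ⟨e⟩ := (isSaturatedEmbedding_overOrbits G.gpd X).nonempty_isotropy x
    obtain ⟨e'⟩ := (isSaturatedEmbedding_overOrbits G.gpd X).nonempty_isotropy y
    exact ⟨fun ⟨f⟩ => ⟨e'.symm.trans (f.trans e)⟩, fun ⟨f⟩ => ⟨e'.trans (f.trans e.symm)⟩⟩

theorem range_restrictι (G : OSDGroupoid.{u} S) (X : Set G.gpd.OrbitSpace) :
    range (G.restrictι X) = G.ι '' X := by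
  have := range_comp G.ι (G.gpd.restrictOrbit (G.gpd.orbit ⁻¹' X))
  rwa [range_restrictOrbit] at this

/-- Isotropy groups and orbit types of a restriction are inherited from `G`; the topology of its
orbit space is the only obstruction, and it is assumed away by `he`. -/
theorem isOSD_restrict (G : OSDGroupoid.{u} S) {X : Set G.gpd.OrbitSpace}
    (hX : S.Def (G.ι '' X)) (he : IsEmbedding (G.gpd.restrictOrbit (G.gpd.orbit ⁻¹' X))) :
    IsOrbitSpaceDefinable S (G.gpd.overOrbits X) (G.restrictι X) where
  isEmbedding := G.isOSD.isEmbedding.comp he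
  definable_range := by
    rw [range_restrictι]
    exact hX
  compactLie x := by
    obtain ⟨e⟩ := (isSaturatedEmbedding_overOrbits G.gpd X).nonempty_isotropy x
    exact (G.isOSD.compactLie x.1).congr e.symm
  finite_types := by
    refine (G.isOSD.finite_types.image
      (preimage (G.gpd.restrictOrbit (G.gpd.orbit ⁻¹' X)))).subset ?_
    rintro _ ⟨x, rfl⟩
    exact ⟨_, ⟨x.1, rfl⟩, (restrict_weakOrbitType G X x).symm⟩
  definable_types x := by
    have : G.restrictι X '' (G.gpd.overOrbits X).weakOrbitType x =
        G.ι '' G.gpd.weakOrbitType x.1 ∩ G.ι '' X := by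
      rw [restrict_weakOrbitType, ← image_inter G.isOSD.isEmbedding.injective]
      change (G.ι ∘ G.gpd.restrictOrbit (G.gpd.orbit ⁻¹' X)) '' _ = _
      rw [image_comp, image_preimage_eq_inter_range, range_restrictOrbit]
    rw [this]
    exact (def_iff.2 (G.isOSD.definable_types x.1)).inter hX

theorem isotropyT_orbit (G : OSDGroupoid.{u} S) (x : G.gpd.Obj) :
    G.isotropyT (G.gpd.orbit x) =
      CompactLieGrp.T (CompactLieGrp.cls ⟨G.gpd.Isotropy x, G.isOSD.compactLie x⟩) := rfl

theorem isotropyT_restrict (G : OSDGroupoid.{u} S) {X : Set G.gpd.OrbitSpace}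
    (h : IsOrbitSpaceDefinable S (G.gpd.overOrbits X) (G.restrictι X))
    (o : (G.gpd.overOrbits X).OrbitSpace) :
    OSDGroupoid.isotropyT ⟨_, _, _, h⟩ o = G.isotropyT (G.gpd.restrictOrbit _ o) := by
  induction o using Quotient.inductionOn with
  | h y =>
    refine congrArg CompactLieGrp.T ?_
    exact CompactLieGrp.cls_eq_iff.2
      ((isSaturatedEmbedding_overOrbits G.gpd X).nonempty_isotropy y)

/-- Over the set `C` of orbits the groupoid `G` has isotropy groups of one type and is trivial. -/
def IsSimpleOver (G : OSDGroupoid.{u} S) (C : Set G.gpd.OrbitSpace) : Prop :=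
  ∃ x : G.gpd.Obj, C ⊆ G.gpd.weakOrbitType x ∧ G.gpd.IsTrivialOver C (G.gpd.Isotropy x)

theorem IsSimpleOver.mono {G : OSDGroupoid.{u} S} {C X : Set G.gpd.OrbitSpace}
    (h : G.IsSimpleOver C) (hX : X ⊆ C) : G.IsSimpleOver X :=
  let ⟨x, hx, ht⟩ := h
  ⟨x, hX.trans hx, ht.mono hX⟩

theorem isotropyT_eq_of_mem_weakOrbitType {G : OSDGroupoid.{u} S} {x : G.gpd.Obj}
    {o : G.gpd.OrbitSpace} (h : o ∈ G.gpd.weakOrbitType x) :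
    G.isotropyT o = G.isotropyT (G.gpd.orbit x) := by
  induction o using Quotient.inductionOn with
  | h y => exact congrArg CompactLieGrp.T (CompactLieGrp.cls_eq_iff.2 (orbit_mem_weakOrbitType.1 h))

theorem IsSimpleOver.isotropyT_eq {G : OSDGroupoid.{u} S} {C : Set G.gpd.OrbitSpace}
    (h : G.IsSimpleOver C) {o o' : G.gpd.OrbitSpace} (ho : o ∈ C) (ho' : o' ∈ C) :
    G.isotropyT o = G.isotropyT o' := by
  obtain ⟨x, hx, -⟩ := h
  rw [isotropyT_eq_of_mem_weakOrbitType (hx ho), isotropyT_eq_of_mem_weakOrbitType (hx ho')]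

/-- Cells are locally closed, so orbit spaces over them have the subspace topology and the Morita
equivalences can be normalised to induce the identity. In this form the condition passes to subsets
of the cells. -/
theorem isotropyLocallyTrivial_iff {G : OSDGroupoid.{u} S} :
    G.IsotropyLocallyTrivial ↔ ∃ P, S.IsCellPartition (range G.ι) P ∧
      ∀ c ∈ P, G.IsSimpleOver (G.ι ⁻¹' c.1) := by
  constructor
  · rintro ⟨P, hP, h⟩
    refine ⟨P, hP, fun c hc => ?_⟩
    obtain ⟨x, hx, hm⟩ := h c hc
    exact ⟨x, hx, hm.isTrivialOver (isEmbedding_restrictOrbit_of_isLocallyClosed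
      ((hP.isCell c hc).isLocallyClosed.preimage G.isOSD.isEmbedding.continuous))⟩
  · rintro ⟨P, hP, h⟩
    refine ⟨P, hP, fun c hc => ?_⟩
    obtain ⟨x, hx, K, Φ, Ψ, hΦ, hΨ, -⟩ := h c hc
    exact ⟨x, hx, K, Φ, Ψ, hΦ, hΨ⟩

/-- An orbit in `D` is needed to supply an object of the restricted groupoid whose isotropy group
serves as the model group. -/
theorem IsSimpleOver.restrict {G : OSDGroupoid.{u} S} {C X : Set G.gpd.OrbitSpace}
    (h : G.IsSimpleOver C)
    (hX : IsOrbitSpaceDefinable S (G.gpd.overOrbits X) (G.restrictι X))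
    {D : Set (G.gpd.overOrbits X).OrbitSpace} (hD : D.Nonempty)
    (hDC : ∀ o ∈ D, G.gpd.restrictOrbit (G.gpd.orbit ⁻¹' X) o ∈ C) :
    IsSimpleOver ⟨_, _, _, hX⟩ D := by
  obtain ⟨x, hx, ht⟩ := h
  have hν : IsEmbedding (G.gpd.restrictOrbit (G.gpd.orbit ⁻¹' X)) :=
    IsEmbedding.of_comp (G.gpd.restrictHom _).continuous_mapOrbit
      G.isOSD.isEmbedding.continuous hX.isEmbedding
  have : T2Space (G.gpd.overOrbits X).OrbitSpace := hν.t2Space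
  obtain ⟨o, ho⟩ := hD
  obtain ⟨y, rfl⟩ := Quotient.exists_rep o
  have hy : G.gpd.orbit y.1 ∈ G.gpd.weakOrbitType x := hx (hDC _ ho)
  obtain ⟨e⟩ := orbit_mem_weakOrbitType.1 hy
  obtain ⟨e'⟩ := (isSaturatedEmbedding_overOrbits G.gpd X).nonempty_isotropy y
  refine ⟨y, ?_, ?_⟩
  · rw [restrict_weakOrbitType]
    intro o ho'
    have h1 := hx (hDC _ ho')
    obtain ⟨z, rfl⟩ := Quotient.exists_rep o
    obtain ⟨f⟩ := orbit_mem_weakOrbitType.1 (show G.gpd.orbit z.1 ∈ _ from h1)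
    exact orbit_mem_weakOrbitType.2 ⟨f.trans e.symm⟩
  · obtain ⟨K, Φ, Ψ, hΦ, hΨ, hc⟩ := ht.transfer (e'.trans e)
      ((isSaturatedEmbedding_overOrbits G.gpd X).comp
        (isSaturatedEmbedding_overOrbits (G.gpd.overOrbits X) D))
      (hν.comp (IsEmbedding.subtypeVal (p := fun o => o ∈ D)))
      (fun d => hDC d.1 d.2) (by
        intro z
        constructor
        · rintro ⟨w, rfl⟩
          exact ⟨⟨(G.gpd.overOrbits X).orbit w.1, w.2⟩, rfl⟩
        · rintro ⟨⟨o, ho⟩, h'⟩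
          have hz : z ∈ G.gpd.orbit ⁻¹' X := by
            rw [mem_preimage, ← h']
            exact (range_restrictOrbit X).le ⟨o, rfl⟩
          have : o = (G.gpd.overOrbits X).orbit ⟨z, hz⟩ := hν.injective h'
          have hzD : (G.gpd.overOrbits X).orbit ⟨z, hz⟩ ∈ D := this ▸ ho
          exact ⟨⟨⟨z, hz⟩, hzD⟩, rfl⟩)
    exact ⟨K, Φ, Ψ, hΦ, hΨ, fun k => hν.injective (hc k)⟩

open Classical in
/-- A definable set of orbits of an isotropy locally trivial groupoid has a partition into cells
over which the groupoid is simple. -/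
theorem IsotropyLocallyTrivial.exists_partition {G : OSDGroupoid.{u} S}
    (hG : G.IsotropyLocallyTrivial) {A : Set (Fin G.dim → ℝ)} (hA : S.Def A)
    (hAι : A ⊆ range G.ι) :
    ∃ P, S.IsCellPartition A P ∧ ∀ c ∈ P, G.IsSimpleOver (G.ι ⁻¹' c.1) := by
  obtain ⟨P, hP, h⟩ := isotropyLocallyTrivial_iff.1 hG
  obtain ⟨Q, hQ, hQP⟩ := (hasCellDecomposition G.dim).exists_partition hA (P.image Prod.fst) (by
    intro B hB
    obtain ⟨c, hc, rfl⟩ := Finset.mem_image.1 hB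
    exact (hP.isCell c hc).def)
  refine ⟨Q, hQ, fun c hc => ?_⟩
  obtain ⟨y, hy⟩ := (hQ.isCell c hc).nonempty
  obtain ⟨b, hb, hyb⟩ := hP.exists_mem (hAι (hQ.subset hc hy))
  refine (h b hb).mono (preimage_mono ?_)
  rcases hQP c hc b.1 (Finset.mem_image_of_mem _ hb) with h' | h'
  · exact h'
  · exact absurd hyb (disjoint_left.1 h' hy)

theorem IsotropyLocallyTrivial.restrict {G : OSDGroupoid.{u} S} (hG : G.IsotropyLocallyTrivial)
    {X : Set G.gpd.OrbitSpace}
    (hX : IsOrbitSpaceDefinable S (G.gpd.overOrbits X) (G.restrictι X)) :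
    IsotropyLocallyTrivial ⟨_, _, _, hX⟩ := by
  obtain ⟨P, hP, h⟩ := hG.exists_partition (def_iff.2 hX.definable_range) (by
    rw [range_restrictι]; exact image_subset_range _ _)
  refine isotropyLocallyTrivial_iff.2 ⟨P, hP, fun c hc => ?_⟩
  refine (h c hc).restrict hX ?_ fun o ho => ho
  obtain ⟨y, hy⟩ := (hP.isCell c hc).nonempty
  obtain ⟨o, rfl⟩ := hP.subset hc hy
  exact ⟨o, hy⟩

/-! ### The integral of the isotropy classes and its additivity. -/

open Classical in
/-- The value on a cell of a function that is constant there. -/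
def cellValue {X : Type u} {n : ℕ} (ι : X → Fin n → ℝ) {R : Type v} [Zero R] (f : X → R)
    (c : Set (Fin n → ℝ) × ℕ) : R :=
  if h : ∃ x, ι x ∈ c.1 then f h.choose else 0

theorem IsSimpleOver.eq_cellValue {G : OSDGroupoid.{u} S} {R : Type v} [Zero R]
    (r : CompactLieGrp.UnivRing.{u} → R) {c : Set (Fin G.dim → ℝ) × ℕ}
    (h : G.IsSimpleOver (G.ι ⁻¹' c.1)) {o : G.gpd.OrbitSpace} (ho : G.ι o ∈ c.1) :
    r (G.isotropyT o) = cellValue G.ι (fun o => r (G.isotropyT o)) c := by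
  have h' : ∃ x, G.ι x ∈ c.1 := ⟨o, ho⟩
  rw [cellValue, dif_pos h', h.isotropyT_eq ho h'.choose_spec]

variable {R : Type v} [AddCommGroup R]

/-- The integral of `r(T^[G_x^x])` over the orbit space. -/
def isotropyIntegral (r : CompactLieGrp.UnivRing.{u} → R) (G : OSDGroupoid.{u} S) : R :=
  S.eulerIntegral G.ι fun o => r (G.isotropyT o)

theorem isotropyIntegral_eq_sum (r : CompactLieGrp.UnivRing.{u} → R) {G : OSDGroupoid.{u} S}
    {P : Finset (Set (Fin G.dim → ℝ) × ℕ)} (hP : S.IsCellPartition (range G.ι) P)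
    (h : ∀ c ∈ P, G.IsSimpleOver (G.ι ⁻¹' c.1)) :
    isotropyIntegral r G =
      ∑ c ∈ P, (-1 : ℤ) ^ c.2 • cellValue G.ι (fun o => r (G.isotropyT o)) c :=
  hP.eulerIntegral_eq _ fun c hc _ ho => (h c hc).eq_cellValue r ho

open Classical in
-- Cell partitions of the images of `X` and of its complement together form one of the whole image,
-- and on each cell the integrands of `G` and of the restriction agree.
theorem isotropyIntegral_add (r : CompactLieGrp.UnivRing.{u} → R) {G : OSDGroupoid.{u} S}
    (hG : G.IsotropyLocallyTrivial) {X : Set G.gpd.OrbitSpace}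
    (h₁ : IsOrbitSpaceDefinable S (G.gpd.overOrbits X) (G.restrictι X))
    (h₂ : IsOrbitSpaceDefinable S (G.gpd.overOrbits Xᶜ) (G.restrictι Xᶜ)) :
    isotropyIntegral r G = isotropyIntegral r ⟨_, _, _, h₁⟩ + isotropyIntegral r ⟨_, _, _, h₂⟩ := by
  have key : ∀ Y : Set G.gpd.OrbitSpace,
      ∀ h : IsOrbitSpaceDefinable S (G.gpd.overOrbits Y) (G.restrictι Y),
      ∃ P, S.IsCellPartition (G.ι '' Y) P ∧ (∀ c ∈ P, G.IsSimpleOver (G.ι ⁻¹' c.1)) ∧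
        isotropyIntegral r ⟨_, _, _, h⟩ =
          ∑ c ∈ P, (-1 : ℤ) ^ c.2 • cellValue G.ι (fun o => r (G.isotropyT o)) c := by
    intro Y h
    obtain ⟨P, hP, hs⟩ := hG.exists_partition (A := G.ι '' Y)
      (by rw [← range_restrictι]; exact h.definable_range) (image_subset_range _ _)
    refine ⟨P, hP, hs, ?_⟩
    rw [← range_restrictι] at hP
    refine hP.eulerIntegral_eq _ fun c hc o ho => ?_
    rw [← (hs c hc).eq_cellValue r ho]
    exact congrArg r (isotropyT_restrict G h o)
  obtain ⟨P₁, hP₁, hs₁, e₁⟩ := key X h₁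
  obtain ⟨P₂, hP₂, hs₂, e₂⟩ := key Xᶜ h₂
  have hdisj : Disjoint (G.ι '' X) (G.ι '' Xᶜ) :=
    (disjoint_image_iff G.isOSD.isEmbedding.injective).2 disjoint_compl_right
  have hne : ∀ c ∈ P₁, ∀ c' ∈ P₂, Disjoint c.1 c'.1 := fun c hc c' hc' =>
    hdisj.mono (hP₁.subset hc) (hP₂.subset hc')
  -- Cells are nonempty, so none of them occurs in both partitions.
  have hPd : Disjoint P₁ P₂ := by
    rw [Finset.disjoint_left]
    intro c hc hc'
    obtain ⟨y, hy⟩ := (hP₁.isCell c hc).nonempty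
    exact disjoint_left.1 (hne c hc c hc') hy hy
  have hP : S.IsCellPartition (range G.ι) (P₁ ∪ P₂) := by
    refine ⟨fun c hc => ?_, fun c hc c' hc' hcc => ?_, ?_⟩
    · rcases Finset.mem_union.1 hc with hc | hc
      exacts [hP₁.isCell c hc, hP₂.isCell c hc]
    · rcases Finset.mem_union.1 hc with hc | hc <;> rcases Finset.mem_union.1 hc' with hc' | hc'
      · exact hP₁.disjoint c hc c' hc' hcc
      · exact hne c hc c' hc'
      · exact (hne c' hc' c hc).symm
      · exact hP₂.disjoint c hc c' hc' hcc
    · rw [Finset.set_biUnion_union, hP₁.cover, hP₂.cover, ← image_union, union_compl_self,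
        image_univ]
  rw [isotropyIntegral_eq_sum r hP (fun c hc => (Finset.mem_union.1 hc).elim (hs₁ c) (hs₂ c)),
    Finset.sum_union hPd, e₁, e₂]

end OSDGroupoid

end

noncomputable section

/-! ### Products -/

namespace OMinimalStructure

variable {S : OMinimalStructure}

/-- The product of two sets as a subset of `ℝᵐ⁺ⁿ`. -/
def prodSet {m n : ℕ} (A : Set (Fin m → ℝ)) (B : Set (Fin n → ℝ)) : Set (Fin (m + n) → ℝ) :=
  {z | z ∘ Fin.castAdd n ∈ A ∧ z ∘ Fin.natAdd m ∈ B}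

theorem append_mem_prodSet {m n : ℕ} {A : Set (Fin m → ℝ)} {B : Set (Fin n → ℝ)} {x : Fin m → ℝ}
    {y : Fin n → ℝ} : Fin.append x y ∈ prodSet A B ↔ x ∈ A ∧ y ∈ B := by
  have h1 : Fin.append x y ∘ Fin.castAdd n = x := funext fun i => Fin.append_left x y i
  have h2 : Fin.append x y ∘ Fin.natAdd m = y := funext fun i => Fin.append_right x y i
  simp only [prodSet, mem_ofPred_eq, h1, h2]

/-- The induction runs over the second factor, as graphs and bands are built along the last
coordinate; the bounding functions are composed with the projection to that factor. -/
theorem IsCell.prod {m n d e : ℕ} {A : Set (Fin m → ℝ)} {B : Set (Fin n → ℝ)}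
    (hA : S.IsCell A d) (hB : S.IsCell B e) : S.IsCell (prodSet A B) (d + e) := by
  have hA' : ∀ k, S.Def {z : Fin (m + k) → ℝ | z ∘ Fin.castAdd k ∈ A} := fun k =>
    hA.def.preimage (defFun_pi fun i => defFun_id.apply _)
  induction hB with
  | point =>
    have : prodSet A (univ : Set (Fin 0 → ℝ)) = A := by
      ext z
      exact ⟨fun h => h.1, fun h => ⟨h, mem_univ _⟩⟩
    rw [this]
    exact hA
  | @graph n e Y f hY hf ih =>
    have h := IsCell.graph _ ih (hf.comp_coord (σ := Fin.natAdd m) (hA' n))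
    exact Eq.subst (motive := fun C => S.IsCell C _) (Set.ext fun z => and_assoc) h
  | @band n e Y lo hi hY hlo hhi hlt ih =>
    have h := IsCell.band (lo.map fun f z => f (z ∘ Fin.natAdd m))
      (hi.map fun f z => f (z ∘ Fin.natAdd m)) ih
      (by
        intro g hg
        obtain ⟨f, hf, rfl⟩ := Option.mem_map.1 hg
        exact (hlo f hf).comp_coord (hA' n))
      (by
        intro g hg
        obtain ⟨f, hf, rfl⟩ := Option.mem_map.1 hg
        exact (hhi f hf).comp_coord (hA' n))
      (by
        intro g hg g' hg' z hz
        obtain ⟨f, hf, rfl⟩ := Option.mem_map.1 hg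
        obtain ⟨f', hf', rfl⟩ := Option.mem_map.1 hg'
        exact hlt f hf f' hf' _ hz.2)
    refine Eq.subst (motive := fun C => S.IsCell C _) (Set.ext fun z => ?_) h
    simp only [Option.mem_map, forall_exists_index, and_imp, forall_apply_eq_imp_iff₂]
    exact and_assoc

/-- The product of two cells with their dimensions. -/
def prodCell {m n : ℕ} (p : (Set (Fin m → ℝ) × ℕ) × (Set (Fin n → ℝ) × ℕ)) :
    Set (Fin (m + n) → ℝ) × ℕ := (prodSet p.1.1 p.2.1, p.1.2 + p.2.2)

section

variable {m n : ℕ} {A : Set (Fin m → ℝ)} {B : Set (Fin n → ℝ)}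
  {P : Finset (Set (Fin m → ℝ) × ℕ)} {Q : Finset (Set (Fin n → ℝ) × ℕ)}

/-- A nonempty product cell determines its factors. This allows sums over product cells to be
written as double sums. -/
theorem IsCellPartition.injOn_prodCell (hP : S.IsCellPartition A P) (hQ : S.IsCellPartition B Q) :
    Set.InjOn prodCell ((P ×ˢ Q : Finset _) :
      Set ((Set (Fin m → ℝ) × ℕ) × (Set (Fin n → ℝ) × ℕ))) := by
  rintro ⟨c, d⟩ h ⟨c', d'⟩ h' heq
  rw [Finset.mem_coe, Finset.mem_product] at h h'
  obtain ⟨x, hx⟩ := (hP.isCell c h.1).nonempty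
  obtain ⟨y, hy⟩ := (hQ.isCell d h.2).nonempty
  have h1 : Fin.append x y ∈ prodSet c'.1 d'.1 :=
    (congrArg Prod.fst heq).le (append_mem_prodSet.2 ⟨hx, hy⟩)
  rw [append_mem_prodSet] at h1
  exact Prod.ext (hP.eq_of_mem h.1 h'.1 hx h1.1) (hQ.eq_of_mem h.2 h'.2 hy h1.2)

open Classical in
theorem IsCellPartition.prod (hP : S.IsCellPartition A P) (hQ : S.IsCellPartition B Q) :
    S.IsCellPartition (prodSet A B) ((P ×ˢ Q).image prodCell) where
  isCell c hc := by
    obtain ⟨p, hp, rfl⟩ := Finset.mem_image.1 hc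
    rw [Finset.mem_product] at hp
    exact (hP.isCell _ hp.1).prod (hQ.isCell _ hp.2)
  disjoint c hc c' hc' hne := by
    obtain ⟨p, hp, rfl⟩ := Finset.mem_image.1 hc
    obtain ⟨p', hp', rfl⟩ := Finset.mem_image.1 hc'
    rw [Finset.mem_product] at hp hp'
    refine disjoint_left.2 fun z hz hz' => hne ?_
    rw [show p = p' from Prod.ext (hP.eq_of_mem hp.1 hp'.1 hz.1 hz'.1)
      (hQ.eq_of_mem hp.2 hp'.2 hz.2 hz'.2)]
  cover := by
    ext z
    simp only [mem_iUnion, Finset.mem_image, exists_prop]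
    constructor
    · rintro ⟨_, ⟨p, hp, rfl⟩, hz⟩
      rw [Finset.mem_product] at hp
      exact ⟨hP.subset hp.1 hz.1, hQ.subset hp.2 hz.2⟩
    · rintro ⟨h1, h2⟩
      obtain ⟨c, hc, hzc⟩ := hP.exists_mem h1
      obtain ⟨d, hd, hzd⟩ := hQ.exists_mem h2
      exact ⟨_, ⟨(c, d), Finset.mem_product.2 ⟨hc, hd⟩, rfl⟩, hzc, hzd⟩

end

end OMinimalStructure

/-! ### Products of locally trivial groupoids. -/

namespace TopGroupoid

variable {G H K G' H' : TopGroupoid.{u}}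

theorem continuous_fstOrbit (G H : TopGroupoid.{u}) : Continuous (G.fstOrbit H) :=
  (isQuotientMap_orbit _).continuous_iff.2
    ((isQuotientMap_orbit G).continuous.comp continuous_fst)

theorem continuous_sndOrbit (G H : TopGroupoid.{u}) : Continuous (G.sndOrbit H) :=
  (isQuotientMap_orbit _).continuous_iff.2
    ((isQuotientMap_orbit H).continuous.comp continuous_snd)

/-- The orbits of the product that lie over the sets `C` and `D` of orbits. -/
def orbitProd {G H : TopGroupoid.{u}} (C : Set G.OrbitSpace) (D : Set H.OrbitSpace) :
    Set (G.prod H).OrbitSpace := {o | G.fstOrbit H o ∈ C ∧ G.sndOrbit H o ∈ D}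

/-- The product of the two spans joins the products of the restrictions to the products of the
trivial actions. Base change along the isomorphisms `j` and `j'` brings it to the required form. The
hypothesis `he` is needed because the orbit space of a product carries its own quotient topology. -/
theorem IsTrivialOver.prod [T2Space G.OrbitSpace] [T2Space H.OrbitSpace]
    [T2Space (G.prod H).OrbitSpace] {M N L : Type u} [Group M] [TopologicalSpace M]
    [IsTopologicalGroup M] [T2Space M] [Group N] [TopologicalSpace N] [IsTopologicalGroup N]
    [T2Space N] [Group L] [TopologicalSpace L] [IsTopologicalGroup L] [T2Space L]
    {C : Set G.OrbitSpace} {D : Set H.OrbitSpace} (hC : G.IsTrivialOver C M)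
    (hD : H.IsTrivialOver D N) (e : L ≃ₜ* M × N)
    (he : IsEmbedding fun o : (G.prod H).OrbitSpace => (G.fstOrbit H o, G.sndOrbit H o)) :
    (G.prod H).IsTrivialOver (orbitProd C D) L := by
  obtain ⟨K, Φ, Ψ, hΦ, hΨ, hc⟩ := hC
  obtain ⟨K', Φ', Ψ', hΦ', hΨ', hc'⟩ := hD
  let t := (G.prod H).restrictHom ((G.prod H).orbit ⁻¹' orbitProd C D)
  let j : ((G.prod H).overOrbits (orbitProd C D)).Hom ((G.overOrbits C).prod (H.overOrbits D)) :=
    { obj := fun p => (⟨p.1.1, p.2.1⟩, ⟨p.1.2, p.2.2⟩)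
      arr := fun g => (⟨g.1.1, g.2.1.1, g.2.2.1⟩, ⟨g.1.2, g.2.1.2, g.2.2.2⟩)
      continuous_obj := ((continuous_fst.comp t.continuous_obj).subtype_mk _).prodMk
        ((continuous_snd.comp t.continuous_obj).subtype_mk _)
      continuous_arr := ((continuous_fst.comp t.continuous_arr).subtype_mk _).prodMk
        ((continuous_snd.comp t.continuous_arr).subtype_mk _)
      src_arr := fun _ => rfl
      tgt_arr := fun _ => rfl
      arr_unit := fun _ => rfl
      arr_inv := fun _ => rfl
      arr_mul := fun _ _ _ => rfl }
  let s := (G.restrictHom (G.orbit ⁻¹' C)).prodMap (H.restrictHom (H.orbit ⁻¹' D))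
  have hsj := isSaturatedEmbedding_overOrbits (G.prod H) (orbitProd C D)
  have hobj : IsEmbedding (s.obj ∘ j.obj) := hsj.isEmbedding_obj
  have harr : IsEmbedding (s.arr ∘ j.arr) := hsj.isEmbedding_arr
  have hj : j.IsSaturatedEmbedding :=
    { isEmbedding_obj := IsEmbedding.of_comp j.continuous_obj s.continuous_obj hobj
      isEmbedding_arr := IsEmbedding.of_comp j.continuous_arr s.continuous_arr harr
      mem_range_arr := fun g _ =>
        ⟨⟨(g.1.1, g.2.1), ⟨g.1.2.1, g.2.2.1⟩, ⟨g.1.2.2, g.2.2.2⟩⟩, rfl⟩ }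
  let θ : orbitProd C D → C × D := fun o => (⟨_, o.2.1⟩, ⟨_, o.2.2⟩)
  have hθ : IsEmbedding θ := by
    refine IsEmbedding.of_comp ?_ (g := Prod.map Subtype.val Subtype.val) ?_
      (he.comp IsEmbedding.subtypeVal)
    · exact (((continuous_fstOrbit G H).comp continuous_subtype_val).subtype_mk _).prodMk
        (((continuous_sndOrbit G H).comp continuous_subtype_val).subtype_mk _)
    · exact continuous_subtype_val.prodMap continuous_subtype_val
  have hθs : Function.Surjective θ := by
    rintro ⟨⟨⟨x⟩, hx⟩, ⟨⟨y⟩, hy⟩⟩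
    exact ⟨⟨(G.prod H).orbit (x, y), hx, hy⟩, rfl⟩
  have hEmb : IsEmbedding fun q : L × orbitProd C D =>
      (((e q.1).1, (θ q.2).1), ((e q.1).2, (θ q.2).2)) :=
    (Homeomorph.prodProdProdComm M N C D).isEmbedding.comp
      (e.toHomeomorph.isEmbedding.prodMap hθ)
  let j' : (trivialAction L (orbitProd C D)).Hom
      ((trivialAction M C).prod (trivialAction N D)) :=
    { obj := θ
      arr := fun q => (((e q.1).1, (θ q.2).1), ((e q.1).2, (θ q.2).2))
      continuous_obj := hθ.continuous
      continuous_arr := hEmb.continuous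
      src_arr := fun _ => rfl
      tgt_arr := fun _ => rfl
      arr_unit := fun x => by
        change (((e 1).1, _), ((e 1).2, _)) = _
        rw [map_one]
        rfl
      arr_inv := fun q => by
        change (((e q.1⁻¹).1, _), ((e q.1⁻¹).2, _)) = _
        rw [map_inv]
        rfl
      arr_mul := fun p q _ => by
        change (((e (p.1 * q.1)).1, _), ((e (p.1 * q.1)).2, _)) = _
        rw [map_mul]
        rfl }
  have hj' : j'.IsSaturatedEmbedding :=
    { isEmbedding_obj := hθ
      isEmbedding_arr := hEmb
      mem_range_arr := by
        rintro ⟨⟨a, c⟩, ⟨b, d⟩⟩ -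
        obtain ⟨o, ho⟩ := hθs (c, d)
        refine ⟨(e.symm (a, b), o), ?_⟩
        change (((e (e.symm (a, b))).1, (θ o).1), ((e (e.symm (a, b))).2, (θ o).2)) = _
        rw [e.apply_symm_apply, ho]
        rfl }
  obtain ⟨K'', Φ'', Ψ'', i, h1, h2, h3, h4⟩ := (hΦ.prodMap hΦ').transfer (hΨ.prodMap hΨ') hj hj'
    fun k => iff_of_true
      ⟨⟨((Φ.obj k.1).1, (Φ'.obj k.2).1), (Φ.obj k.1).2, (Φ'.obj k.2).2⟩, rfl⟩ (hθs _)
  -- Orbits of the product are compared through their two projections, where the given spans induce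
  -- the identity.
  refine ⟨K'', Φ'', Ψ'', h1, h2, fun k => he.injective (Prod.ext ?_ ?_)⟩
  · have e1 := congrArg (fun p => (show C from p.1).1) (h4 k)
    have e2 := congrArg (fun p => G.orbit (show G.orbit ⁻¹' C from p.1).1) (h3 k)
    exact e1.trans ((hc (i k).1).trans e2.symm)
  · have e1 := congrArg (fun p => (show D from p.2).1) (h4 k)
    have e2 := congrArg (fun p => H.orbit (show H.orbit ⁻¹' D from p.2).1) (h3 k)
    exact e1.trans ((hc' (i k).2).trans e2.symm)

end TopGroupoid

namespace CompactLieGrp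

theorem T_mul (H K : CompactLieGrp.{u}) : T H.cls * T K.cls = T (H.prod K).cls :=
  Ideal.Quotient.eq.2 (Ideal.subset_span (Or.inl ⟨H, K, rfl⟩))

theorem T_trivial : T trivial.{u}.cls = 1 :=
  Ideal.Quotient.eq.2 (Ideal.subset_span (Or.inr rfl))

end CompactLieGrp

namespace OSDGroupoid

open OMinimalStructure TopGroupoid

variable {S : OMinimalStructure} {G H : OSDGroupoid.{u} S}

/-- Followed by the product of the embeddings, this map is `prodι`, an embedding by hypothesis. -/
theorem isEmbedding_fst_snd (h : IsOrbitSpaceDefinable S (G.gpd.prod H.gpd) (G.prodι H)) :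
    IsEmbedding fun o : (G.gpd.prod H.gpd).OrbitSpace =>
      (G.gpd.fstOrbit H.gpd o, G.gpd.sndOrbit H.gpd o) := by
  refine IsEmbedding.of_comp ((continuous_fstOrbit _ _).prodMk (continuous_sndOrbit _ _))
    (g := fun p : G.gpd.OrbitSpace × H.gpd.OrbitSpace => Fin.append (G.ι p.1) (H.ι p.2)) ?_ h.isEmbedding
  refine continuous_pi fun i => ?_
  refine Fin.addCases (fun i => ?_) (fun i => ?_) i
  · simp only [Fin.append_left]
    exact (continuous_apply i).comp (G.isOSD.isEmbedding.continuous.comp continuous_fst)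
  · simp only [Fin.append_right]
    exact (continuous_apply i).comp (H.isOSD.isEmbedding.continuous.comp continuous_snd)

theorem range_prodι (G H : OSDGroupoid.{u} S) :
    range (G.prodι H) = prodSet (range G.ι) (range H.ι) := by
  ext z
  constructor
  · rintro ⟨o, rfl⟩
    exact append_mem_prodSet.2 ⟨⟨_, rfl⟩, ⟨_, rfl⟩⟩
  · rintro ⟨⟨⟨x⟩, hx⟩, ⟨⟨y⟩, hy⟩⟩
    refine ⟨(G.gpd.prod H.gpd).orbit (x, y), ?_⟩
    change Fin.append (G.ι (G.gpd.orbit x)) (H.ι (H.gpd.orbit y)) = z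
    refine funext fun i => Fin.addCases (fun i => ?_) (fun i => ?_) i
    · rw [Fin.append_left]
      exact congrFun hx i
    · rw [Fin.append_right]
      exact congrFun hy i

theorem isotropyT_prod (h : IsOrbitSpaceDefinable S (G.gpd.prod H.gpd) (G.prodι H))
    (o : (G.gpd.prod H.gpd).OrbitSpace) :
    OSDGroupoid.isotropyT ⟨_, _, _, h⟩ o =
      G.isotropyT (G.gpd.fstOrbit H.gpd o) * H.isotropyT (G.gpd.sndOrbit H.gpd o) := by
  induction o using Quotient.inductionOn with
  | h p =>
    refine Eq.trans ?_ (CompactLieGrp.T_mul ⟨G.gpd.Isotropy p.1, G.isOSD.compactLie p.1⟩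
      ⟨H.gpd.Isotropy p.2, H.isOSD.compactLie p.2⟩).symm
    exact congrArg CompactLieGrp.T (CompactLieGrp.cls_eq_iff.2 (nonempty_isotropy_prod _ _ p))

theorem IsSimpleOver.prod {C : Set G.gpd.OrbitSpace} {D : Set H.gpd.OrbitSpace}
    (hC : G.IsSimpleOver C) (hD : H.IsSimpleOver D)
    (h : IsOrbitSpaceDefinable S (G.gpd.prod H.gpd) (G.prodι H)) :
    IsSimpleOver ⟨_, _, _, h⟩ (orbitProd C D) := by
  obtain ⟨x, hx, hx'⟩ := hC
  obtain ⟨y, hy, hy'⟩ := hD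
  have : T2Space (G.gpd.prod H.gpd).OrbitSpace := h.isEmbedding.t2Space
  let p : (G.gpd.prod H.gpd).Obj := (x, y)
  obtain ⟨e⟩ := nonempty_isotropy_prod G.gpd H.gpd p
  refine ⟨p, ?_, hx'.prod hy' e (isEmbedding_fst_snd h)⟩
  rintro ⟨q⟩ ⟨hq, hq'⟩
  obtain ⟨e₁⟩ := orbit_mem_weakOrbitType.1 (show G.gpd.orbit q.1 ∈ _ from hx hq)
  obtain ⟨e₂⟩ := orbit_mem_weakOrbitType.1 (show H.gpd.orbit q.2 ∈ _ from hy hq')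
  obtain ⟨e'⟩ := nonempty_isotropy_prod G.gpd H.gpd q
  let f : G.gpd.Isotropy q.1 × H.gpd.Isotropy q.2 ≃ₜ* G.gpd.Isotropy x × H.gpd.Isotropy y :=
    { MulEquiv.prodCongr e₁.toMulEquiv e₂.toMulEquiv with
      continuous_toFun := e₁.continuous.prodMap e₂.continuous
      continuous_invFun := e₁.symm.continuous.prodMap e₂.symm.continuous }
  exact orbit_mem_weakOrbitType.2 ⟨e'.trans (f.trans e.symm)⟩

theorem preimage_prodCell (p : (Set (Fin G.dim → ℝ) × ℕ) × (Set (Fin H.dim → ℝ) × ℕ)) :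
    G.prodι H ⁻¹' (prodCell p).1 = orbitProd (G.ι ⁻¹' p.1.1) (H.ι ⁻¹' p.2.1) := by
  ext o
  exact append_mem_prodSet

open Classical in
theorem isSimpleOver_prodCell (h : IsOrbitSpaceDefinable S (G.gpd.prod H.gpd) (G.prodι H))
    {P : Finset (Set (Fin G.dim → ℝ) × ℕ)} {Q : Finset (Set (Fin H.dim → ℝ) × ℕ)}
    (hP : ∀ c ∈ P, G.IsSimpleOver (G.ι ⁻¹' c.1)) (hQ : ∀ c ∈ Q, H.IsSimpleOver (H.ι ⁻¹' c.1)) :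
    ∀ c ∈ (P ×ˢ Q).image prodCell, IsSimpleOver ⟨_, _, _, h⟩ (G.prodι H ⁻¹' c.1) := by
  intro c hc
  obtain ⟨p, hp, rfl⟩ := Finset.mem_image.1 hc
  rw [Finset.mem_product] at hp
  rw [preimage_prodCell]
  exact (hP _ hp.1).prod (hQ _ hp.2) h

theorem IsotropyLocallyTrivial.prod (hG : G.IsotropyLocallyTrivial) (hH : H.IsotropyLocallyTrivial)
    (h : IsOrbitSpaceDefinable S (G.gpd.prod H.gpd) (G.prodι H)) :
    IsotropyLocallyTrivial ⟨_, _, _, h⟩ := by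
  obtain ⟨P, hP, hP'⟩ := isotropyLocallyTrivial_iff.1 hG
  obtain ⟨Q, hQ, hQ'⟩ := isotropyLocallyTrivial_iff.1 hH
  refine isotropyLocallyTrivial_iff.2 ⟨_, ?_, isSimpleOver_prodCell h hP' hQ'⟩
  exact (range_prodι G H).symm ▸ hP.prod hQ

/-- Fubini on cells: on a product of cells the sign and the integrand are both products. The order
of the factors is kept, as `R` need not be commutative. -/
theorem isotropyIntegral_mul {R : Type v} [Ring R] {r : CompactLieGrp.UnivRing.{u} → R}
    (hr : ∀ a b, r (a * b) = r a * r b) (hG : G.IsotropyLocallyTrivial)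
    (hH : H.IsotropyLocallyTrivial)
    (h : IsOrbitSpaceDefinable S (G.gpd.prod H.gpd) (G.prodι H)) :
    isotropyIntegral r ⟨_, _, _, h⟩ = isotropyIntegral r G * isotropyIntegral r H := by
  classical
  obtain ⟨P, hP, hP'⟩ := isotropyLocallyTrivial_iff.1 hG
  obtain ⟨Q, hQ, hQ'⟩ := isotropyLocallyTrivial_iff.1 hH
  have hPQ : S.IsCellPartition (range (G.prodι H)) ((P ×ˢ Q).image prodCell) :=
    (range_prodι G H).symm ▸ hP.prod hQ
  rw [isotropyIntegral_eq_sum r hPQ (isSimpleOver_prodCell h hP' hQ'),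
    isotropyIntegral_eq_sum r hP hP', isotropyIntegral_eq_sum r hQ hQ',
    Finset.sum_image (hP.injOn_prodCell hQ), Finset.sum_mul_sum, ← Finset.sum_product']
  refine Finset.sum_congr rfl fun p hp => ?_
  have hp' := Finset.mem_product.1 hp
  obtain ⟨x, hx⟩ := (hP.isCell _ hp'.1).nonempty
  obtain ⟨y, hy⟩ := (hQ.isCell _ hp'.2).nonempty
  obtain ⟨⟨a⟩, rfl⟩ := hP.subset hp'.1 hx
  obtain ⟨⟨b⟩, rfl⟩ := hQ.subset hp'.2 hy
  have hab : G.prodι H ((G.gpd.prod H.gpd).orbit (a, b)) ∈ (prodCell p).1 :=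
    append_mem_prodSet.2 ⟨hx, hy⟩
  have e := (isSimpleOver_prodCell h hP' hQ' _
    (Finset.mem_image_of_mem _ hp)).eq_cellValue r hab
  rw [← e, ← (hP' _ hp'.1).eq_cellValue r hx, ← (hQ' _ hp'.2).eq_cellValue r hy, isotropyT_prod,
    hr, smul_mul_smul_comm, ← pow_add]
  rfl

end OSDGroupoid

end

noncomputable section

/-! ### Homomorphisms from the universal ring -/

namespace CompactLieGrp

theorem nonempty_prodCongr {M N M' N' : Type*} [Group M] [TopologicalSpace M] [Group N]
    [TopologicalSpace N] [Group M'] [TopologicalSpace M'] [Group N'] [TopologicalSpace N']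
    (e : M ≃ₜ* M') (f : N ≃ₜ* N') : Nonempty (M × N ≃ₜ* M' × N') :=
  ⟨{ MulEquiv.prodCongr e.toMulEquiv f.toMulEquiv with
      continuous_toFun := e.continuous.prodMap f.continuous
      continuous_invFun := e.symm.continuous.prodMap f.symm.continuous }⟩

instance : Mul IsoClass.{u} :=
  ⟨Quotient.map₂ prod fun _ _ ⟨e⟩ _ _ ⟨f⟩ => nonempty_prodCongr e f⟩

theorem cls_mul (H K : CompactLieGrp.{u}) : H.cls * K.cls = (H.prod K).cls := rfl

instance : One IsoClass.{u} := ⟨trivial.cls⟩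

theorem cls_trivial : trivial.{u}.cls = 1 := rfl

instance : CommMonoid IsoClass.{u} where
  mul_assoc := by
    rintro ⟨H⟩ ⟨K⟩ ⟨L⟩
    exact cls_eq_iff.2 ⟨{ MulEquiv.prodAssoc with
      continuous_toFun := (Homeomorph.prodAssoc H.carrier K.carrier L.carrier).continuous
      continuous_invFun := (Homeomorph.prodAssoc H.carrier K.carrier L.carrier).symm.continuous }⟩
  mul_comm := by
    rintro ⟨H⟩ ⟨K⟩
    exact cls_eq_iff.2 ⟨{ MulEquiv.prodComm with
      continuous_toFun := continuous_swap
      continuous_invFun := continuous_swap }⟩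
  one_mul := by
    rintro ⟨H⟩
    exact cls_eq_iff.2 ⟨{ MulEquiv.uniqueProd (N := PUnit) (M := H.carrier) with
      continuous_toFun := continuous_snd
      continuous_invFun := continuous_const.prodMk continuous_id }⟩
  mul_one := by
    rintro ⟨H⟩
    exact cls_eq_iff.2 ⟨{ MulEquiv.prodUnique (N := PUnit) (M := H.carrier) with
      continuous_toFun := continuous_fst
      continuous_invFun := continuous_id.prodMk continuous_const }⟩

theorem T_one : T (1 : IsoClass.{u}) = 1 := T_trivial

theorem T_mul_T (c d : IsoClass.{u}) : T c * T d = T (c * d) := by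
  induction c using Quotient.inductionOn with
  | h H => induction d using Quotient.inductionOn with
    | h K => exact T_mul H K

/-- A product of generators is again a generator and `1 = T^[e]`, so every monomial is a multiple of
a single `T c`. -/
theorem closure_range_T : AddSubgroup.closure (range T.{u}) = ⊤ := by
  rw [eq_top_iff]
  intro a _
  obtain ⟨p, rfl⟩ := Ideal.Quotient.mk_surjective a
  induction p using MvPolynomial.induction_on with
  | C n =>
    have h : Ideal.Quotient.mk relations.{u} (MvPolynomial.C n) = n • T 1 := by
      rw [T_one, zsmul_one, ← map_intCast (Ideal.Quotient.mk relations.{u})]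
      exact congrArg _ (map_intCast (MvPolynomial.C (σ := IsoClass.{u})) n)
    rw [h]
    exact zsmul_mem (AddSubgroup.subset_closure (mem_range_self 1)) n
  | add p q hp hq =>
    rw [map_add]
    exact add_mem (hp (AddSubgroup.mem_top _)) (hq (AddSubgroup.mem_top _))
  | mul_X p c hp =>
    rw [map_mul]
    change _ * T c ∈ _
    have hp := hp (AddSubgroup.mem_top _)
    generalize Ideal.Quotient.mk relations.{u} p = a at hp ⊢
    induction hp using AddSubgroup.closure_induction with
    | mem x hx =>
      obtain ⟨d, rfl⟩ := hx
      rw [T_mul_T]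
      exact AddSubgroup.subset_closure ⟨_, rfl⟩
    | zero => rw [zero_mul]; exact zero_mem _
    | add x y _ _ hx hy => rw [add_mul]; exact add_mem hx hy
    | neg x _ hx =>
      have : -x * T c = -(x * T c) := neg_mul x (T c)
      rw [this]
      exact neg_mem hx

/-- This starts the detour through the monoid ring of `IsoClass`. Polynomials cannot simply be
evaluated in `R`, which may be noncommutative and in which `1` may have to go to another idempotent;
`MonoidAlgebra.liftMagma` asks only for a multiplicative function. -/
theorem aeval_eq_zero_of_mem_relations {a : MvPolynomial IsoClass.{u} ℤ} (ha : a ∈ relations) :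
    MvPolynomial.aeval (MonoidAlgebra.of ℤ IsoClass.{u}) a = 0 := by
  have hX : ∀ c, MvPolynomial.aeval (MonoidAlgebra.of ℤ IsoClass.{u}) (MvPolynomial.X (R := ℤ) c) =
      MonoidAlgebra.of ℤ IsoClass.{u} c := fun c => MvPolynomial.aeval_X _ c
  rw [← AlgHom.coe_toRingHom, ← RingHom.mem_ker]
  refine (Ideal.span_le (I := RingHom.ker _)).2 ?_ ha
  rintro _ (⟨H, K, rfl⟩ | rfl)
  · change MvPolynomial.aeval _ _ = 0
    rw [map_sub, map_mul, hX, hX, hX, ← map_mul, cls_mul, sub_self]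
  · change MvPolynomial.aeval _ _ = 0
    rw [map_sub, hX, cls_trivial, map_one, map_one, sub_self]

/-- The homomorphism from the universal ring to the monoid ring of the isomorphism classes. -/
def toMonoidAlgebra : UnivRing.{u} →+* MonoidAlgebra ℤ IsoClass.{u} :=
  Ideal.Quotient.lift relations
    (MvPolynomial.aeval (MonoidAlgebra.of ℤ IsoClass.{u})).toRingHom
    fun _ ha => aeval_eq_zero_of_mem_relations ha

theorem toMonoidAlgebra_T (c : IsoClass.{u}) :
    toMonoidAlgebra (T c) = MonoidAlgebra.of ℤ IsoClass.{u} c := by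
  simp [toMonoidAlgebra, T]

variable {R : Type v} [Ring R]

/-- Additivity suffices since the `T c` span the ring additively. The general `F` covers unital and
non-unital homomorphisms alike. -/
theorem univRing_hom_ext {F : Type*} [FunLike F UnivRing.{u} R]
    [AddMonoidHomClass F UnivRing.{u} R] {r r' : F} (h : ∀ c, r (T c) = r' (T c)) : r = r' := by
  refine DFunLike.ext _ _ fun a => ?_
  have ha : a ∈ AddSubgroup.closure (range T.{u}) := closure_range_T ▸ AddSubgroup.mem_top a
  induction ha using AddSubgroup.closure_induction with
  | mem x hx =>
    obtain ⟨c, rfl⟩ := hx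
    exact h c
  | zero => rw [map_zero, map_zero]
  | add x y _ _ hx hy => rw [map_add, map_add, hx, hy]
  | neg x _ hx => rw [map_neg, map_neg, hx]

/-- The homomorphism from the universal ring given by a multiplicative function. -/
def univRingLift (φ : IsoClass.{u} →ₙ* R) : UnivRing.{u} →ₙ+* R :=
  (MonoidAlgebra.liftMagma ℤ φ : MonoidAlgebra ℤ IsoClass.{u} →ₙ+* R).comp
    (toMonoidAlgebra : UnivRing.{u} →ₙ+* MonoidAlgebra ℤ IsoClass.{u})

theorem univRingLift_T (φ : IsoClass.{u} →ₙ* R) (c : IsoClass.{u}) :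
    univRingLift φ (T c) = φ c := by
  change MonoidAlgebra.liftMagma ℤ φ (toMonoidAlgebra (T c)) = φ c
  rw [toMonoidAlgebra_T]
  simp

end CompactLieGrp

end

noncomputable section

/-! ### Additive topological invariants of definable sets -/

local notation "ini" => Fin.init (α := fun _ => ℝ)
local notation "snc" => Fin.snoc (α := fun _ => ℝ)

theorem Set.nonempty_homeomorph {X Y : Type*} [TopologicalSpace X] [TopologicalSpace Y] {A : Set X}
    {B : Set Y} {φ : X → Y} {ψ : Y → X} (hφ : ContinuousOn φ A) (hψ : ContinuousOn ψ B)
    (hAB : MapsTo φ A B) (hBA : MapsTo ψ B A) (hl : LeftInvOn ψ φ A) (hr : LeftInvOn φ ψ B) :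
    Nonempty (A ≃ₜ B) :=
  ⟨{ toFun := hAB.restrict φ A B
     invFun := hBA.restrict ψ B A
     left_inv := fun x => Subtype.ext (hl x.2)
     right_inv := fun x => Subtype.ext (hr x.2)
     continuous_toFun := hφ.mapsToRestrict hAB
     continuous_invFun := hψ.mapsToRestrict hBA }⟩

namespace OMinimalStructure

variable {S : OMinimalStructure}

theorem nonempty_homeomorph_graph {n : ℕ} {Y : Set (Fin n → ℝ)} {f : (Fin n → ℝ) → ℝ}
    (hf : ContinuousOn f Y) :
    Nonempty ({x : Fin (n + 1) → ℝ | ini x ∈ Y ∧ x (Fin.last n) = f (ini x)} ≃ₜ Y) := by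
  refine Set.nonempty_homeomorph (φ := fun x => ini x) (ψ := fun y => snc y (f y))
    continuous_fin_init.continuousOn
    (continuous_fin_snoc.comp_continuousOn (continuousOn_id.prodMk hf)) (fun x hx => hx.1)
    (fun y hy => ?_) (fun x hx => ?_) (fun y _ => Fin.init_snoc _ _)
  · simpa using hy
  · change snc (ini x) (f (ini x)) = x
    rw [← hx.2]
    exact Fin.snoc_init_self x

/-- The points above (for `ε = 1`) or below (for `ε = -1`) the graph of `f`. -/
theorem nonempty_homeomorph_halfSpace {n : ℕ} {Y : Set (Fin n → ℝ)} {f : (Fin n → ℝ) → ℝ}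
    (hf : ContinuousOn f Y) {ε : ℝ} (hε : ε * ε = 1) {B : Set (Fin (n + 1) → ℝ)}
    (hB : ∀ x, x ∈ B ↔ ini x ∈ Y ∧ 0 < ε * (x (Fin.last n) - f (ini x))) :
    Nonempty (B ≃ₜ {x : Fin (n + 1) → ℝ | ini x ∈ Y}) := by
  obtain rfl : {x | ini x ∈ Y ∧ 0 < ε * (x (Fin.last n) - f (ini x))} = B :=
    Set.ext fun x => (hB x).symm
  have hlast : Continuous fun x : Fin (n + 1) → ℝ => x (Fin.last n) := continuous_apply _
  have hcomp : ∀ A : Set (Fin (n + 1) → ℝ), (∀ x ∈ A, ini x ∈ Y) →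
      ContinuousOn (fun x : Fin (n + 1) → ℝ => f (ini x)) A := fun A hA =>
    hf.comp continuous_fin_init.continuousOn hA
  -- The logarithm turns the positive distance from the graph into an arbitrary real number. It need
  -- not be definable: only the source and target of the homeomorphism must be.
  refine Set.nonempty_homeomorph
    (φ := fun x => snc (ini x) (Real.log (ε * (x (Fin.last n) - f (ini x)))))
    (ψ := fun x => snc (ini x) (f (ini x) + ε * Real.exp (x (Fin.last n)))) ?_ ?_ ?_ ?_ ?_ ?_
  · refine continuous_fin_snoc.comp_continuousOn (continuous_fin_init.continuousOn.prodMk ?_)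
    exact ContinuousOn.log (continuousOn_const.mul
      (hlast.continuousOn.sub (hcomp _ fun x hx => hx.1))) fun x hx => hx.2.ne'
  · refine continuous_fin_snoc.comp_continuousOn (continuous_fin_init.continuousOn.prodMk ?_)
    exact (hcomp _ fun x hx => hx).add
      (continuousOn_const.mul (Real.continuous_exp.comp hlast).continuousOn)
  · intro x hx
    simpa using hx.1
  · intro x hx
    have hx' : ini x ∈ Y := hx
    simp only [mem_ofPred_eq, Fin.init_snoc, Fin.snoc_last, add_sub_cancel_left, ← mul_assoc, hε,
      one_mul]
    exact ⟨hx', Real.exp_pos _⟩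
  · intro x hx
    simp only [Fin.init_snoc, Fin.snoc_last]
    rw [Real.exp_log hx.2, ← mul_assoc, hε, one_mul, add_sub_cancel]
    exact Fin.snoc_init_self x
  · intro x hx
    simp only [Fin.init_snoc, Fin.snoc_last, add_sub_cancel_left, ← mul_assoc, hε, one_mul,
      Real.log_exp]
    exact Fin.snoc_init_self x

/-- The function `a` on definable sets is additive and invariant under homeomorphisms. -/
structure IsAdditiveInvariant (S : OMinimalStructure) {A : Type v} [AddCommGroup A]
    (a : ∀ {n : ℕ}, Set (Fin n → ℝ) → A) : Prop where
  union : ∀ {n : ℕ} {D D' : Set (Fin n → ℝ)}, S.Def D → S.Def D' → Disjoint D D' →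
    a (D ∪ D') = a D + a D'
  homeomorph : ∀ {m n : ℕ} {D : Set (Fin m → ℝ)} {D' : Set (Fin n → ℝ)}, S.Def D → S.Def D' →
    Nonempty (D ≃ₜ D') → a D = a D'

namespace IsAdditiveInvariant

variable {A : Type v} [AddCommGroup A] {a : ∀ {n : ℕ}, Set (Fin n → ℝ) → A}

theorem empty (ha : IsAdditiveInvariant S a) (n : ℕ) : a (∅ : Set (Fin n → ℝ)) = 0 := by
  have h0 : S.Def (∅ : Set (Fin n → ℝ)) := by simpa using (def_univ (E := Fin n → ℝ)).compl
  have := ha.union h0 h0 (disjoint_empty _)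
  rwa [union_empty, left_eq_add] at this

/-- The graph of `g` and the sets above and below it. -/
theorem split (ha : IsAdditiveInvariant S a) {n : ℕ} {Y : Set (Fin n → ℝ)} {d : ℕ}
    (hY : S.IsCell Y d) {B Lo Hi : Set (Fin (n + 1) → ℝ)} {g : (Fin n → ℝ) → ℝ}
    (hg : S.DefContOn g Y) (hLo : S.Def Lo) (hHi : S.Def Hi)
    (hB : ∀ x, x ∈ B ↔ ini x ∈ Y ∧ (x ∈ Lo ∨ x (Fin.last n) = g (ini x) ∨ x ∈ Hi))
    (hLo' : ∀ x ∈ Lo, ini x ∈ Y ∧ x (Fin.last n) < g (ini x))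
    (hHi' : ∀ x ∈ Hi, ini x ∈ Y ∧ g (ini x) < x (Fin.last n)) :
    a B = a Lo + (a Y + a Hi) := by
  have hgr := hY.graph g hg
  rw [← ha.homeomorph hgr.def hY.def (nonempty_homeomorph_graph hg.1), ← ha.union hgr.def hHi,
    ← ha.union hLo (hgr.def.union hHi)]
  · congr 1
    ext x
    simp only [hB x, mem_union, mem_ofPred_eq]
    have h1 := hLo' x
    have h2 := hHi' x
    tauto
  · rw [disjoint_left]
    rintro x hx (hx' | hx')
    · exact (hLo' x hx).2.ne hx'.2
    · exact lt_asymm (hLo' x hx).2 (hHi' x hx').2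
  · rw [disjoint_left]
    exact fun x hx hx' => (hHi' x hx').2.ne' hx.2

/-- A graph is homeomorphic to its base. A band has minus the value of its base, by cutting sets
into pieces homeomorphic to the whole; the four shapes of bands are reduced to the full cylinder. -/
theorem cell (ha : IsAdditiveInvariant S a) {n d : ℕ} {C : Set (Fin n → ℝ)} (hC : S.IsCell C d) :
    a C = (-1 : ℤ) ^ d • a (univ : Set (Fin 0 → ℝ)) := by
  induction hC with
  | point => simp
  | @graph n d Y f hY hf ih =>
    rw [← ih]
    exact ha.homeomorph (hY.graph f hf).def hY.def (nonempty_homeomorph_graph hf.1)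
  | @band n d Y lo hi hY hlo hhi hlt ih =>
    rw [pow_succ, mul_neg_one, neg_smul, ← ih]
    have hall : S.Def {x : Fin (n + 1) → ℝ | ini x ∈ Y} := hY.def.preimage defFun_id.init
    have hub : ∀ f, S.DefContOn f Y →
        S.Def {x : Fin (n + 1) → ℝ | ini x ∈ Y ∧ f (ini x) < x (Fin.last n)} := fun f hf =>
      (IsCell.band (some f) none hY (by simpa using hf) (by simp) (by simp)).def.congr
        fun x => by simp
    have hlb : ∀ f, S.DefContOn f Y →
        S.Def {x : Fin (n + 1) → ℝ | ini x ∈ Y ∧ x (Fin.last n) < f (ini x)} := fun f hf =>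
      (IsCell.band none (some f) hY (by simp) (by simpa using hf) (by simp)).def.congr
        fun x => by simp
    have hu : ∀ f, S.DefContOn f Y →
        a {x : Fin (n + 1) → ℝ | ini x ∈ Y ∧ f (ini x) < x (Fin.last n)} =
          a {x : Fin (n + 1) → ℝ | ini x ∈ Y} := fun f hf =>
      ha.homeomorph (hub f hf) hall
        (nonempty_homeomorph_halfSpace hf.1 (ε := 1) (by norm_num) fun x => by simp)
    have hl : ∀ f, S.DefContOn f Y →
        a {x : Fin (n + 1) → ℝ | ini x ∈ Y ∧ x (Fin.last n) < f (ini x)} =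
          a {x : Fin (n + 1) → ℝ | ini x ∈ Y} := fun f hf =>
      ha.homeomorph (hlb f hf) hall
        (nonempty_homeomorph_halfSpace hf.1 (ε := -1) (by norm_num) fun x => by simp)
    have h0 : S.DefContOn (fun _ => 0) Y := by
      refine ⟨continuousOn_const, def_iff.1 ?_⟩
      exact Def.and hall (def_eq (defFun_id.apply _) (defFun_const 0))
    -- With `t` the value of the cylinder, cutting at height `0` gives `t = t + a Y + t`.
    have ht : a {x : Fin (n + 1) → ℝ | ini x ∈ Y} = -a Y := by
      have := ha.split hY (B := {x | ini x ∈ Y}) h0 (hlb _ h0) (hub _ h0)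
        (fun x => by
          simp only [mem_ofPred_eq]
          have := lt_trichotomy (x (Fin.last n)) 0
          tauto) (fun x hx => hx) (fun x hx => hx)
      rw [hu _ h0, hl _ h0, ← add_assoc, eq_comm, add_eq_right] at this
      exact eq_neg_of_add_eq_zero_left this
    rcases lo with _ | f <;> rcases hi with _ | g
    · simpa using ht
    · simpa using (hl g (hhi g rfl)).trans ht
    · simpa using (hu f (hlo f rfl)).trans ht
    · have hf := hlo f rfl
      have hg := hhi g rfl
      have hfg := hlt f rfl g rfl
      -- The part above `f` is cut along the graph of `g`. The parts above `f` and above `g` have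
      -- the same value and cancel.
      have := ha.split hY (B := {x | ini x ∈ Y ∧ f (ini x) < x (Fin.last n)}) hg
        (IsCell.band (some f) (some g) hY hlo hhi hlt).def (hub g hg)
        (fun x => by
          simp only [mem_ofPred_eq, Option.mem_some_iff, forall_eq']
          constructor
          · rintro ⟨hx, hx'⟩
            have := lt_trichotomy (x (Fin.last n)) (g (ini x))
            tauto
          · rintro ⟨hx, h | h | h⟩
            · exact ⟨hx, h.2.1⟩
            · exact ⟨hx, h ▸ hfg _ hx⟩
            · exact ⟨hx, (hfg _ hx).trans h.2⟩)
        (fun x hx => ⟨hx.1, hx.2.2 g rfl⟩) (fun x hx => hx)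
      rw [hu f hf, hu g hg, ← add_assoc, eq_comm, add_eq_right] at this
      exact eq_neg_of_add_eq_zero_left this

/-- The cells are added one at a time; every partial union is definable, which is all that
additivity requires here. -/
theorem eq_sum (ha : IsAdditiveInvariant S a) {n : ℕ} {D : Set (Fin n → ℝ)}
    {P : Finset (Set (Fin n → ℝ) × ℕ)} (hP : S.IsCellPartition D P) :
    a D = ∑ c ∈ P, (-1 : ℤ) ^ c.2 • a (univ : Set (Fin 0 → ℝ)) := by
  classical
  rw [← hP.cover]
  have hd : ∀ Q : Finset (Set (Fin n → ℝ) × ℕ), Q ⊆ P → S.Def (⋃ c ∈ Q, c.1) := fun Q hQ =>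
    (Def.bex_finset Q (p := fun c x => x ∈ c.1) fun c hc => (hP.isCell c (hQ hc)).def).congr
      fun x => by simp
  suffices ∀ Q ⊆ P, a (⋃ c ∈ Q, c.1) = ∑ c ∈ Q, (-1 : ℤ) ^ c.2 • a (univ : Set (Fin 0 → ℝ)) from
    this P subset_rfl
  intro Q
  induction Q using Finset.induction_on with
  | empty => exact fun _ => by simpa using ha.empty n
  | insert c Q hc ih =>
    intro hQ
    have hcP := hQ (Finset.mem_insert_self c Q)
    have hQP := (Finset.subset_insert c Q).trans hQ
    rw [Finset.set_biUnion_insert, Finset.sum_insert hc, ← ih hQP, ← ha.cell (hP.isCell c hcP)]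
    refine ha.union (hP.isCell c hcP).def (hd Q hQP) ?_
    rw [disjoint_iUnion₂_right]
    exact fun c' hc' => hP.disjoint c hcP c' (hQP hc') fun h => hc (h ▸ hc')

end IsAdditiveInvariant

end OMinimalStructure

end

noncomputable section

/-! ### Groupoids of trivial actions on definable sets -/

namespace TopGroupoid

section

variable {M N : Type u} [Group M] [TopologicalSpace M] [IsTopologicalGroup M] [T2Space M]
  [Group N] [TopologicalSpace N] [IsTopologicalGroup N] [T2Space N]
  {C D : Type u} [TopologicalSpace C] [T2Space C] [TopologicalSpace D] [T2Space D]

theorem weakOrbitType_trivialAction (x : (trivialAction M C).Obj) :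
    (trivialAction M C).weakOrbitType x = univ := by
  refine eq_univ_of_forall fun o => ?_
  obtain ⟨y, rfl⟩ := Quotient.exists_rep o
  obtain ⟨e⟩ := nonempty_isotropy_trivialAction (M := M) x
  obtain ⟨f⟩ := nonempty_isotropy_trivialAction (M := M) y
  exact orbit_mem_weakOrbitType.2 ⟨f.trans e.symm⟩

/-- The orbit map of a trivial action is a homeomorphism, so the topology causes no difficulty for
any subset, locally closed or not. -/
theorem isEmbedding_restrictOrbit_trivialAction (X : Set (trivialAction M C).OrbitSpace) :
    IsEmbedding ((trivialAction M C).restrictOrbit ((trivialAction M C).orbit ⁻¹' X)) := by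
  have h := isHomeomorph_orbit_trivialAction (M := M) (C := C)
  exact isEmbedding_restrictOrbit_of_isQuotientMap ((h.isOpenMap.restrictPreimage X).isQuotientMap
    h.continuous.restrictPreimage (h.surjective.restrictPreimage X))

theorem moritaEquivalent_overOrbits_trivialAction (e : N ≃ₜ* M)
    {X : Set (trivialAction M C).OrbitSpace} {θ : D → C} (hθ : IsEmbedding θ)
    (hr : ∀ c, (trivialAction M C).orbit c ∈ X ↔ c ∈ range θ) :
    ((trivialAction M C).overOrbits X).MoritaEquivalent (trivialAction N D) := by
  have hid := Hom.isEssentialEquivalence_id (trivialAction M C)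
  obtain ⟨K, Φ, Ψ, -, h1, h2, -⟩ := hid.transfer hid
    (isSaturatedEmbedding_overOrbits (trivialAction M C) X)
    (isSaturatedEmbedding_trivialActionHom e hθ) fun k => by
      refine Iff.trans ?_ (hr k)
      constructor
      · rintro ⟨y, rfl⟩
        exact y.2
      · exact fun hk => ⟨⟨k, hk⟩, rfl⟩
  exact ⟨K, Φ, Ψ, h1, h2⟩

end

end TopGroupoid

namespace OSDGroupoid

open OMinimalStructure TopGroupoid

variable {S : OMinimalStructure} {n : ℕ}

/-- The embedding of the orbit space of the trivial action of `H` on `D`. -/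
def trivialι (H : CompactLieGrp.{u}) (D : Set (Fin n → ℝ)) :
    (trivialAction H.carrier (ULift.{u} D)).OrbitSpace → Fin n → ℝ :=
  Quotient.lift (fun x : ULift.{u} D => x.down.1) fun _ _ ⟨_, h, h'⟩ =>
    congrArg (fun x : ULift.{u} D => x.down.1) (h.symm.trans h')

theorem range_trivialι (H : CompactLieGrp.{u}) (D : Set (Fin n → ℝ)) :
    range (trivialι H D) = D := by
  ext y
  constructor
  · rintro ⟨⟨x⟩, rfl⟩
    exact x.down.2
  · exact fun hy => ⟨(trivialAction H.carrier (ULift.{u} D)).orbit ⟨⟨y, hy⟩⟩, rfl⟩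

theorem isOSD_trivialAction (H : CompactLieGrp.{u}) {D : Set (Fin n → ℝ)} (hD : S.Def D) :
    IsOrbitSpaceDefinable S (trivialAction H.carrier (ULift.{u} D)) (trivialι H D) where
  isEmbedding := by
    let τ := (isHomeomorph_orbit_trivialAction (M := H.carrier) (C := ULift.{u} D)).homeomorph _
    have h : IsEmbedding fun o => (τ.symm o).down.1 := IsEmbedding.subtypeVal.comp
      (Homeomorph.ulift.isEmbedding.comp τ.symm.isEmbedding)
    convert h using 1
    funext o
    obtain ⟨x, rfl⟩ := τ.surjective o
    rw [τ.symm_apply_apply]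
    rfl
  definable_range := by
    rw [range_trivialι]
    exact hD
  compactLie x := by
    obtain ⟨e⟩ := nonempty_isotropy_trivialAction (M := H.carrier) x
    exact H.isCompactLie.congr e.symm
  finite_types := (finite_singleton univ).subset (by
    rintro _ ⟨x, rfl⟩
    exact weakOrbitType_trivialAction x)
  definable_types x := by
    rw [weakOrbitType_trivialAction, image_univ, range_trivialι]
    exact hD

/-- The groupoid of the trivial action of a compact Lie group on a definable set. -/
def trivialOSD (H : CompactLieGrp.{u}) {D : Set (Fin n → ℝ)} (hD : S.Def D) : OSDGroupoid.{u} S :=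
  ⟨_, _, _, isOSD_trivialAction H hD⟩

theorem isotropyT_trivialOSD (H : CompactLieGrp.{u}) {D : Set (Fin n → ℝ)} (hD : S.Def D)
    (o : (trivialOSD H hD).gpd.OrbitSpace) :
    (trivialOSD H hD).isotropyT o = CompactLieGrp.T H.cls := by
  obtain ⟨x, rfl⟩ := Quotient.exists_rep o
  exact congrArg CompactLieGrp.T (CompactLieGrp.cls_eq_iff.2
    (nonempty_isotropy_trivialAction (M := H.carrier) x))

theorem isotropyLocallyTrivial_trivialOSD (H : CompactLieGrp.{u}) {D : Set (Fin n → ℝ)}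
    (hD : S.Def D) : (trivialOSD H hD).IsotropyLocallyTrivial := by
  obtain ⟨P, hP, -⟩ := (hasCellDecomposition n).exists_partition hD ∅ (by simp)
  refine ⟨P, (range_trivialι H D).symm ▸ hP, fun c hc => ?_⟩
  obtain ⟨y, hy⟩ := (hP.isCell c hc).nonempty
  let x : (trivialAction H.carrier (ULift.{u} D)).Obj := ULift.up.{u} ⟨y, hP.subset hc hy⟩
  refine ⟨x, ?_, ?_⟩
  · exact (subset_univ _).trans (weakOrbitType_trivialAction (M := H.carrier) x).ge
  · obtain ⟨e⟩ := nonempty_isotropy_trivialAction (M := H.carrier) x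
    have h := isHomeomorph_orbit_trivialAction (M := H.carrier) (C := ULift.{u} D)
    let τ := h.homeomorph _
    refine moritaEquivalent_overOrbits_trivialAction e
      (θ := fun o : (trivialOSD H hD).ι ⁻¹' c.1 => τ.symm o.1)
      (τ.symm.isEmbedding.comp IsEmbedding.subtypeVal) fun z => ?_
    exact ⟨fun hz => ⟨⟨_, hz⟩, τ.symm_apply_apply z⟩, fun ⟨o, ho⟩ => by
      rw [← ho]
      have : (trivialAction H.carrier (ULift.{u} D)).orbit (τ.symm o.1) = o.1 :=
        τ.apply_symm_apply o.1
      rw [this]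
      exact o.2⟩

theorem moritaEquivalent_trivialOSD {m : ℕ} {H K : CompactLieGrp.{u}}
    (h : Nonempty (H.carrier ≃ₜ* K.carrier)) {D : Set (Fin m → ℝ)} {D' : Set (Fin n → ℝ)}
    (f : Nonempty (D ≃ₜ D')) (hD : S.Def D) (hD' : S.Def D') :
    (trivialOSD H hD).gpd.MoritaEquivalent (trivialOSD K hD').gpd := by
  obtain ⟨e⟩ := h
  obtain ⟨f⟩ := f
  let θ : ULift.{u} D ≃ₜ ULift.{u} D' := (Homeomorph.ulift.trans f).trans Homeomorph.ulift.symm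
  exact (isSaturatedEmbedding_trivialActionHom e θ.isEmbedding).moritaEquivalent θ.surjective

/-- The set `X` is described by an equation so that the lemma also applies to a complement. -/
theorem isOSD_restrict_trivialOSD (H : CompactLieGrp.{u}) {D D' : Set (Fin n → ℝ)} (hD : S.Def D)
    (hD' : S.Def D') (h : D' ⊆ D) {X : Set (trivialOSD H hD).gpd.OrbitSpace}
    (hX : X = (trivialOSD H hD).ι ⁻¹' D') :
    IsOrbitSpaceDefinable S ((trivialOSD H hD).gpd.overOrbits X)
      ((trivialOSD H hD).restrictι X) := by
  subst hX
  refine isOSD_restrict _ ?_ (isEmbedding_restrictOrbit_trivialAction _)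
  have : trivialι H D '' (trivialι H D ⁻¹' D') = D' :=
    image_preimage_eq_of_subset (h.trans (range_trivialι H D).ge)
  exact this.symm ▸ hD'

theorem moritaEquivalent_restrict_trivialOSD (H : CompactLieGrp.{u}) {D D' : Set (Fin n → ℝ)}
    (hD : S.Def D) (hD' : S.Def D') (h : D' ⊆ D) {X : Set (trivialOSD H hD).gpd.OrbitSpace}
    (hX : X = (trivialOSD H hD).ι ⁻¹' D') :
    ((trivialOSD H hD).gpd.overOrbits X).MoritaEquivalent (trivialOSD H hD').gpd := by
  subst hX
  refine moritaEquivalent_overOrbits_trivialAction (ContinuousMulEquiv.refl _)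
    (θ := fun x : ULift.{u} D' => (⟨inclusion h x.down⟩ : ULift.{u} D)) ?_ fun c => ?_
  · exact Homeomorph.ulift.symm.isEmbedding.comp
      ((IsEmbedding.inclusion h).comp Homeomorph.ulift.isEmbedding)
  · exact ⟨fun hc => ⟨⟨⟨c.down.1, hc⟩⟩, rfl⟩, fun ⟨x, hx⟩ => hx ▸ x.down.2⟩

/-- The groupoid with one object and the group of arrows `H`. -/
def pointOSD (S : OMinimalStructure) (H : CompactLieGrp.{u}) : OSDGroupoid.{u} S :=
  trivialOSD H (D := (univ : Set (Fin 0 → ℝ))) def_univ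

theorem isotropyIntegral_pointOSD {R : Type v} [AddCommGroup R]
    (r : CompactLieGrp.UnivRing.{u} → R) (H : CompactLieGrp.{u}) :
    isotropyIntegral r (pointOSD S H) = r (CompactLieGrp.T H.cls) := by
  have hP : S.IsCellPartition (range (trivialι H univ)) {((univ : Set (Fin 0 → ℝ)), 0)} :=
    (range_trivialι H univ).symm ▸ isCellPartition_singleton IsCell.point
  refine (hP.eulerIntegral_eq (fun _ => r (CompactLieGrp.T H.cls)) fun c _ o _ =>
    congrArg r (isotropyT_trivialOSD (S := S) H def_univ o)).trans ?_
  simp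

variable {R : Type v} [Ring R] {I : OSDGroupoid.{u} S → R}

open Classical in
/-- The invariant of definable sets given by the trivial actions of `H`. -/
def trivialValue (I : OSDGroupoid.{u} S → R) (H : CompactLieGrp.{u}) {n : ℕ}
    (D : Set (Fin n → ℝ)) : R :=
  if h : S.Def D then I (trivialOSD H h) else 0

theorem trivialValue_eq (I : OSDGroupoid.{u} S → R) (H : CompactLieGrp.{u})
    {D : Set (Fin n → ℝ)} (hD : S.Def D) : trivialValue I H D = I (trivialOSD H hD) :=
  dif_pos hD

/-- For trivial actions every definable splitting of `D` gives admissible restrictions, and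
homeomorphic sets give isomorphic groupoids. -/
theorem isAdditiveInvariant_trivialValue (hI : IsTopologicalInvariant I)
    (hadd : AdditiveOn IsotropyLocallyTrivial I) (H : CompactLieGrp.{u}) :
    IsAdditiveInvariant S (trivialValue I H) where
  union {n D D'} hD hD' hdisj := by
    have hU := hD.union hD'
    rw [trivialValue_eq I H hU, trivialValue_eq I H hD, trivialValue_eq I H hD']
    let X : Set (trivialOSD H hU).gpd.OrbitSpace := (trivialOSD H hU).ι ⁻¹' D
    have hXc : Xᶜ = (trivialOSD H hU).ι ⁻¹' D' := by
      ext o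
      have h1 : (trivialOSD H hU).ι o ∈ D ∪ D' := (range_trivialι H (D ∪ D')).le (mem_range_self o)
      exact ⟨fun h => h1.resolve_left h, fun h h' => disjoint_left.1 hdisj h' h⟩
    have h₁ := isOSD_restrict_trivialOSD H hU hD subset_union_left (X := X) rfl
    have h₂ := isOSD_restrict_trivialOSD H hU hD' subset_union_right hXc
    have e₁ := hI ⟨_, _, _, h₁⟩ (trivialOSD H hD)
      (moritaEquivalent_restrict_trivialOSD H hU hD subset_union_left rfl)
    have e₂ := hI ⟨_, _, _, h₂⟩ (trivialOSD H hD')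
      (moritaEquivalent_restrict_trivialOSD H hU hD' subset_union_right hXc)
    rw [hadd _ (isotropyLocallyTrivial_trivialOSD H hU) X h₁ h₂, e₁, e₂]
  homeomorph hD hD' h := by
    rw [trivialValue_eq I H hD, trivialValue_eq I H hD']
    exact hI _ _ (moritaEquivalent_trivialOSD ⟨ContinuousMulEquiv.refl _⟩ h hD hD')

theorem isOSD_of_subsingleton {G : TopGroupoid.{u}} [Subsingleton G.Obj]
    (hG : ∀ x, IsCompactLieGroup (G.Isotropy x)) {n : ℕ} [Subsingleton (Fin n → ℝ)]
    (ι : G.OrbitSpace → Fin n → ℝ) : IsOrbitSpaceDefinable S G ι := by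
  have : Subsingleton G.OrbitSpace := inferInstanceAs (Subsingleton (Quotient _))
  have hd : ∀ A : Set (Fin n → ℝ), S.Def A := fun A => by
    rcases Subsingleton.eq_empty_or_singleton A.subsingleton_of_subsingleton with h | ⟨x, rfl⟩
    · rw [h]
      simpa using (def_univ (E := Fin n → ℝ)).compl
    · rw [Subsingleton.eq_univ_of_nonempty (singleton_nonempty x)]
      exact def_univ
  exact ⟨.of_subsingleton ι, def_iff.1 (hd _), hG, toFinite _, fun x => def_iff.1 (hd _)⟩

/-- The groupoid of `H × K` over a point is isomorphic to the product of those of `H` and `K`, by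
the diagonal on the point. -/
theorem pointOSD_prod (hI : IsTopologicalInvariant I)
    (hmul : MultiplicativeOn IsotropyLocallyTrivial I) (H K : CompactLieGrp.{u}) :
    I (pointOSD S (H.prod K)) = I (pointOSD S H) * I (pointOSD S K) := by
  have : Subsingleton (pointOSD S H).gpd.Obj :=
    inferInstanceAs (Subsingleton (ULift.{u} (univ : Set (Fin 0 → ℝ))))
  have : Subsingleton (pointOSD S K).gpd.Obj :=
    inferInstanceAs (Subsingleton (ULift.{u} (univ : Set (Fin 0 → ℝ))))
  have : Subsingleton ((pointOSD S H).gpd.prod (pointOSD S K).gpd).Obj :=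
    inferInstanceAs (Subsingleton (_ × _))
  have : Subsingleton (Fin ((pointOSD S H).dim + (pointOSD S K).dim) → ℝ) :=
    inferInstanceAs (Subsingleton (Fin 0 → ℝ))
  have h : IsOrbitSpaceDefinable S ((pointOSD S H).gpd.prod (pointOSD S K).gpd)
      ((pointOSD S H).prodι (pointOSD S K)) := by
    refine isOSD_of_subsingleton (fun p => ?_) _
    obtain ⟨e⟩ := nonempty_isotropy_prod _ _ p
    exact (((pointOSD S H).isOSD.compactLie p.1).prod
      ((pointOSD S K).isOSD.compactLie p.2)).congr e.symm
  refine Eq.trans (hI _ ⟨_, _, _, h⟩ ?_) (hmul (pointOSD S H) (pointOSD S K)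
    (isotropyLocallyTrivial_trivialOSD H _) (isotropyLocallyTrivial_trivialOSD K _) h)
  let j : (pointOSD S (H.prod K)).gpd.Hom ((pointOSD S H).gpd.prod (pointOSD S K).gpd) :=
    { obj := fun x => (x, x)
      arr := fun g => ((g.1.1, g.2), (g.1.2, g.2))
      continuous_obj := continuous_id.prodMk continuous_id
      continuous_arr := ((continuous_fst.comp continuous_fst).prodMk continuous_snd).prodMk
        ((continuous_snd.comp continuous_fst).prodMk continuous_snd)
      src_arr := fun _ => rfl
      tgt_arr := fun _ => rfl
      arr_unit := fun _ => rfl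
      arr_inv := fun _ => rfl
      arr_mul := fun _ _ _ => rfl }
  have hj : j.IsSaturatedEmbedding :=
    { isEmbedding_obj := Function.LeftInverse.isEmbedding (f := Prod.fst) (fun _ => rfl)
        continuous_fst j.continuous_obj
      isEmbedding_arr := Function.LeftInverse.isEmbedding
        (f := fun q : (H.carrier × ULift.{u} (univ : Set (Fin 0 → ℝ))) ×
          (K.carrier × ULift.{u} (univ : Set (Fin 0 → ℝ))) => ((q.1.1, q.2.1), q.1.2)) (fun _ => rfl)
        (((continuous_fst.comp continuous_fst).prodMk
          (continuous_fst.comp continuous_snd)).prodMk (continuous_snd.comp continuous_fst))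
        j.continuous_arr
      mem_range_arr := fun g _ => ⟨((g.1.1, g.2.1), g.1.2), Prod.ext rfl (Prod.ext rfl
        (Subsingleton.elim (α := ULift.{u} (univ : Set (Fin 0 → ℝ))) _ _))⟩ }
  exact hj.moritaEquivalent fun p => ⟨p.1, Subsingleton.elim _ _⟩

end OSDGroupoid

end

noncomputable section

/-! ### Additive and multiplicative invariants are integrals -/

namespace OSDGroupoid

open OMinimalStructure TopGroupoid

variable {S : OMinimalStructure} {R : Type v} [Ring R] {I : OSDGroupoid.{u} S → R}

/-- The function on isomorphism classes of compact Lie groups given by a multiplicative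
invariant. -/
def pointValue (hI : IsTopologicalInvariant I)
    (hmul : MultiplicativeOn IsotropyLocallyTrivial I) : CompactLieGrp.IsoClass.{u} →ₙ* R where
  toFun := Quotient.lift (fun H => I (pointOSD S H)) fun _ _ h =>
    hI _ _ (moritaEquivalent_trivialOSD h ⟨Homeomorph.refl _⟩ _ _)
  map_mul' := by
    rintro ⟨H⟩ ⟨K⟩
    exact pointOSD_prod hI hmul H K

/-- The trivial action lives on the abstract orbit space; the embedding `ι` carries it to the
definable set `range ι`. -/
theorem IsSimpleOver.exists_trivialOSD {G : OSDGroupoid.{u} S} (h : G.IsSimpleOver univ) :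
    ∃ H : CompactLieGrp.{u}, (∀ o, G.isotropyT o = CompactLieGrp.T H.cls) ∧
      G.gpd.MoritaEquivalent (trivialOSD H (def_iff.2 G.isOSD.definable_range)).gpd := by
  obtain ⟨x, hx, ht⟩ := h
  refine ⟨⟨G.gpd.Isotropy x, G.isOSD.compactLie x⟩, fun o => ?_, ?_⟩
  · rw [isotropyT_eq_of_mem_weakOrbitType (hx (mem_univ o)), isotropyT_orbit]
  · let τ := G.isOSD.isEmbedding.toHomeomorph
    let j : G.gpd.Hom G.gpd := ⟨id, id, continuous_id, continuous_id, fun _ => rfl, fun _ => rfl,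
      fun _ => rfl, fun _ => rfl, fun _ _ _ => rfl⟩
    have hj : j.IsSaturatedEmbedding := ⟨IsEmbedding.id, IsEmbedding.id, fun g _ => ⟨g, rfl⟩⟩
    obtain ⟨K, Φ, Ψ, hΦ, hΨ, -⟩ := ht.transfer (ContinuousMulEquiv.refl _) hj
      (θ := fun d : ULift.{u} (range G.ι) => τ.symm d.down)
      (τ.symm.isEmbedding.comp Homeomorph.ulift.isEmbedding) (fun _ => mem_univ _)
      fun y => iff_of_true ⟨y, rfl⟩ ⟨⟨τ (G.gpd.orbit y)⟩, τ.symm_apply_apply _⟩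
    exact ⟨K, Φ, Ψ, hΦ, hΨ⟩

/-- Both sides are the alternating sum over the cells of `range ι`, weighted by the value on `H`
over a point. -/
theorem eq_isotropyIntegral_of_isSimpleOver (hI : IsTopologicalInvariant I)
    (hadd : AdditiveOn IsotropyLocallyTrivial I) {r : CompactLieGrp.UnivRing.{u} → R}
    (hr : ∀ H : CompactLieGrp.{u}, r (CompactLieGrp.T H.cls) = I (pointOSD S H))
    {G : OSDGroupoid.{u} S} (h : G.IsSimpleOver univ) : I G = isotropyIntegral r G := by
  obtain ⟨H, hH, hm⟩ := h.exists_trivialOSD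
  have hD := def_iff.2 G.isOSD.definable_range
  obtain ⟨P, hP, -⟩ := (hasCellDecomposition G.dim).exists_partition hD ∅ (by simp)
  rw [hI _ _ hm, ← trivialValue_eq I H hD, (isAdditiveInvariant_trivialValue hI hadd H).eq_sum hP,
    isotropyIntegral, hP.eulerIntegral_eq (fun _ => r (CompactLieGrp.T H.cls))
      fun c _ o _ => congrArg r (hH o), hr, trivialValue_eq I H def_univ]
  rfl

/-- An empty groupoid splits into two copies of itself, so `I G = I G + I G` and both sides vanish.
This case is separate because it offers no object whose isotropy group could be the model. -/
theorem eq_isotropyIntegral_of_isEmpty (hI : IsTopologicalInvariant I)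
    (hadd : AdditiveOn IsotropyLocallyTrivial I) (r : CompactLieGrp.UnivRing.{u} → R)
    {G : OSDGroupoid.{u} S} (hG : G.IsotropyLocallyTrivial) [IsEmpty G.gpd.OrbitSpace] :
    I G = isotropyIntegral r G := by
  have hO : IsEmpty G.gpd.Obj := ⟨fun x => isEmptyElim (G.gpd.orbit x)⟩
  have h : ∀ X : Set G.gpd.OrbitSpace,
      IsOrbitSpaceDefinable S (G.gpd.overOrbits X) (G.restrictι X) := fun X => by
    rw [Subsingleton.elim X univ]
    refine isOSD_restrict G ?_ (isEmbedding_restrictOrbit_of_isLocallyClosed isOpen_univ.isLocallyClosed)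
    rw [image_univ]
    exact G.isOSD.definable_range
  have h' : ∀ X, I ⟨_, _, _, h X⟩ = I G := fun X =>
    hI _ _ ((isSaturatedEmbedding_overOrbits G.gpd X).moritaEquivalent fun x => isEmptyElim x)
  have h1 := hadd G hG ∅ (h _) (h _)
  rw [h', h', left_eq_add] at h1
  have hP : S.IsCellPartition (range G.ι) ∅ := ⟨by simp, by simp, by simp [range_eq_empty]⟩
  rw [h1, isotropyIntegral, hP.eulerIntegral_eq (fun _ => 0) (by simp), Finset.sum_empty]

/-- Two points of `ℝⁿ` lie in the same sets of the list `L`. -/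
def SamePattern {n : ℕ} (L : List (Set (Fin n → ℝ))) (x y : Fin n → ℝ) : Prop :=
  ∀ O ∈ L, x ∈ O ↔ y ∈ O

/-- Induction on `L`: cutting along the first open set gives an open and a closed set of orbits,
both locally closed, so the restrictions are admissible. Within each piece the membership in that
set is constant and it can be removed from the list. The ambient `ℝⁿ` stays fixed, as restrictions
keep the embedding. -/
theorem eq_isotropyIntegral_of_pattern (hI : IsTopologicalInvariant I)
    (hadd : AdditiveOn IsotropyLocallyTrivial I) {r : CompactLieGrp.UnivRing.{u} → R}
    (hr : ∀ H : CompactLieGrp.{u}, r (CompactLieGrp.T H.cls) = I (pointOSD S H)) {n : ℕ} :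
    ∀ (L : List (Set (Fin n → ℝ))), (∀ O ∈ L, IsOpen O ∧ S.Def O) →
      ∀ (g : TopGroupoid.{u}) (ι : g.OrbitSpace → Fin n → ℝ) (h : IsOrbitSpaceDefinable S g ι),
      IsotropyLocallyTrivial ⟨g, n, ι, h⟩ →
      (∀ o, IsSimpleOver ⟨g, n, ι, h⟩ {o' | SamePattern L (ι o') (ι o)}) →
      I ⟨g, n, ι, h⟩ = isotropyIntegral r ⟨g, n, ι, h⟩
  | [], _, g, ι, h, hG, hs => by
    rcases isEmpty_or_nonempty g.OrbitSpace with he | ⟨⟨o⟩⟩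
    · have : IsEmpty (OSDGroupoid.gpd (S := S) ⟨g, n, ι, h⟩).OrbitSpace := he
      exact eq_isotropyIntegral_of_isEmpty hI hadd r hG
    · refine eq_isotropyIntegral_of_isSimpleOver hI hadd hr ((hs o).mono fun o' _ => ?_)
      exact fun O hO => absurd hO List.not_mem_nil
  | O :: L, hL, g, ι, h, hG, hs => by
    obtain ⟨hO, hO'⟩ := hL O List.mem_cons_self
    let G : OSDGroupoid.{u} S := ⟨g, n, ι, h⟩
    have hGι : S.Def (range G.ι) := def_iff.2 h.definable_range
    let X : Set G.gpd.OrbitSpace := G.ι ⁻¹' O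
    have hXo : IsOpen X := hO.preimage h.isEmbedding.continuous
    have h₁ : IsOrbitSpaceDefinable S (G.gpd.overOrbits X) (G.restrictι X) := by
      refine isOSD_restrict G ?_
        (isEmbedding_restrictOrbit_of_isLocallyClosed hXo.isLocallyClosed)
      rw [image_preimage_eq_inter_range]
      exact hO'.inter hGι
    have h₂ : IsOrbitSpaceDefinable S (G.gpd.overOrbits Xᶜ) (G.restrictι Xᶜ) := by
      refine isOSD_restrict G ?_
        (isEmbedding_restrictOrbit_of_isLocallyClosed hXo.isClosed_compl.isLocallyClosed)
      rw [← preimage_compl, image_preimage_eq_inter_range]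
      exact hO'.compl.inter hGι
    have hL' : ∀ O ∈ L, IsOpen O ∧ S.Def O := fun O' hO' => hL O' (List.mem_cons_of_mem _ hO')
    rw [hadd G hG X h₁ h₂, isotropyIntegral_add r hG h₁ h₂]
    congr 1
    · refine eq_isotropyIntegral_of_pattern hI hadd hr L hL' _ _ h₁ (hG.restrict h₁) fun o => ?_
      refine (hs (G.gpd.restrictOrbit _ o)).restrict (G := G) h₁ ⟨o, fun _ _ => Iff.rfl⟩
        fun o' ho' => ?_
      have hX : ∀ p, G.gpd.restrictOrbit (G.gpd.orbit ⁻¹' X) p ∈ X := fun p =>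
        (range_restrictOrbit X).le (mem_range_self p)
      intro O' hO'
      rcases List.mem_cons.1 hO' with rfl | hO'
      · exact iff_of_true (hX o') (hX o)
      · exact ho' O' hO'
    · refine eq_isotropyIntegral_of_pattern hI hadd hr L hL' _ _ h₂ (hG.restrict h₂) fun o => ?_
      refine (hs (G.gpd.restrictOrbit _ o)).restrict (G := G) h₂ ⟨o, fun _ _ => Iff.rfl⟩
        fun o' ho' => ?_
      have hX : ∀ p, G.gpd.restrictOrbit (G.gpd.orbit ⁻¹' Xᶜ) p ∈ Xᶜ := fun p =>
        (range_restrictOrbit Xᶜ).le (mem_range_self p)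
      intro O' hO'
      rcases List.mem_cons.1 hO' with rfl | hO'
      · exact iff_of_false (hX o') (hX o)
      · exact ho' O' hO'

/-- An additive invariant of isotropy locally trivial groupoids is the integral of its values on
groups. -/
theorem eq_isotropyIntegral (hI : IsTopologicalInvariant I)
    (hadd : AdditiveOn IsotropyLocallyTrivial I) {r : CompactLieGrp.UnivRing.{u} → R}
    (hr : ∀ H : CompactLieGrp.{u}, r (CompactLieGrp.T H.cls) = I (pointOSD S H))
    {G : OSDGroupoid.{u} S} (hG : G.IsotropyLocallyTrivial) : I G = isotropyIntegral r G := by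
  classical
  obtain ⟨P, hP, hs⟩ := isotropyLocallyTrivial_iff.1 hG
  -- A locally closed set is the intersection of its closure and its coborder, which is open; so
  -- membership in a cell is determined by membership in these definable open sets.
  let L : List (Set (Fin G.dim → ℝ)) :=
    (P.image fun c => (closure c.1)ᶜ).toList ++ (P.image fun c => coborder c.1).toList
  refine eq_isotropyIntegral_of_pattern hI hadd hr L (fun O hO => ?_) G.gpd G.ι G.isOSD hG
    fun o => ?_
  · simp only [L, List.mem_append, Finset.mem_toList, Finset.mem_image] at hO
    obtain ⟨c, hc, rfl⟩ | ⟨c, hc, rfl⟩ := hO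
    · exact ⟨isClosed_closure.isOpen_compl, (hP.isCell c hc).def.closure.compl⟩
    · exact ⟨(hP.isCell c hc).isLocallyClosed.isOpen_coborder,
        ((hP.isCell c hc).def.closure.diff (hP.isCell c hc).def).compl⟩
  · obtain ⟨c, hc, hoc⟩ := hP.exists_mem (mem_range_self o)
    refine (hs c hc).mono fun o' ho' => ?_
    have h1 := ho' (closure c.1)ᶜ (List.mem_append_left _
      (Finset.mem_toList.2 (Finset.mem_image_of_mem _ hc)))
    have h2 := ho' (coborder c.1) (List.mem_append_right _
      (Finset.mem_toList.2 (Finset.mem_image_of_mem _ hc)))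
    have h3 : G.ι o' ∈ closure c.1 ∩ coborder c.1 :=
      ⟨not_not.1 (mt h1.1 (not_not.2 (subset_closure hoc))), h2.2 (subset_coborder hoc)⟩
    rw [closure_inter_coborder] at h3
    exact h3

theorem moritaEquivalent_pointOSD_of_subsingleton {G : OSDGroupoid.{u} S}
    (h : Nonempty G.gpd.Obj) (hA : Subsingleton G.gpd.Arr) :
    G.gpd.MoritaEquivalent (pointOSD S CompactLieGrp.trivial).gpd := by
  obtain ⟨x⟩ := h
  have hO : Subsingleton G.gpd.Obj := ⟨fun y z => by
    rw [← G.gpd.src_unit y, ← G.gpd.src_unit z, hA.elim (G.gpd.unit y)]⟩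
  let pt : ULift.{u} (univ : Set (Fin 0 → ℝ)) := ⟨⟨0, mem_univ _⟩⟩
  have hpt : Subsingleton (pointOSD S CompactLieGrp.trivial.{u}).gpd.Obj :=
    inferInstanceAs (Subsingleton (ULift.{u} (univ : Set (Fin 0 → ℝ))))
  have hpa : Subsingleton (pointOSD S CompactLieGrp.trivial.{u}).gpd.Arr :=
    inferInstanceAs (Subsingleton (PUnit.{u + 1} × ULift.{u} (univ : Set (Fin 0 → ℝ))))
  let j : G.gpd.Hom (pointOSD S CompactLieGrp.trivial).gpd :=
    { obj := fun _ => pt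
      arr := fun _ => (1, pt)
      continuous_obj := continuous_const
      continuous_arr := continuous_const
      src_arr := fun _ => rfl
      tgt_arr := fun _ => rfl
      arr_unit := fun _ => rfl
      arr_inv := fun _ => hpa.elim _ _
      arr_mul := fun _ _ _ => hpa.elim _ _ }
  have hj : j.IsSaturatedEmbedding :=
    ⟨.of_subsingleton _, .of_subsingleton _, fun g _ => ⟨G.gpd.unit x, hpa.elim _ _⟩⟩
  exact hj.moritaEquivalent fun y => ⟨x, hpt.elim _ _⟩

theorem additiveOn_of_eq_isotropyIntegral {r : CompactLieGrp.UnivRing.{u} → R}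
    (h : ∀ G : OSDGroupoid.{u} S, G.IsotropyLocallyTrivial → I G = isotropyIntegral r G) :
    AdditiveOn IsotropyLocallyTrivial I := fun G hG X h₁ h₂ => by
  rw [h G hG, h _ (hG.restrict h₁), h _ (hG.restrict h₂)]
  exact isotropyIntegral_add r hG h₁ h₂

theorem multiplicativeOn_of_eq_isotropyIntegral {r : CompactLieGrp.UnivRing.{u} → R}
    (hr : ∀ a b, r (a * b) = r a * r b)
    (h : ∀ G : OSDGroupoid.{u} S, G.IsotropyLocallyTrivial → I G = isotropyIntegral r G) :
    MultiplicativeOn IsotropyLocallyTrivial I := fun G H hG hH hGH => by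
  rw [h G hG, h H hH, h _ (hG.prod hH hGH)]
  exact isotropyIntegral_mul hr hG hH hGH

/-- Evaluating the integral formula on one-object groupoids recovers `r` on the generators, which
gives the uniqueness of `r`. -/
theorem apply_T_of_eq_isotropyIntegral {r : CompactLieGrp.UnivRing.{u} → R}
    (h : ∀ G : OSDGroupoid.{u} S, G.IsotropyLocallyTrivial → I G = isotropyIntegral r G)
    (H : CompactLieGrp.{u}) : r (CompactLieGrp.T H.cls) = I (pointOSD S H) := by
  rw [h (pointOSD S H) (isotropyLocallyTrivial_trivialOSD H _)]
  exact (isotropyIntegral_pointOSD r H).symm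

theorem univRing_hom_unique {F : Type*} [FunLike F CompactLieGrp.UnivRing.{u} R]
    [AddMonoidHomClass F CompactLieGrp.UnivRing.{u} R] {r r' : F}
    (h : ∀ G : OSDGroupoid.{u} S, G.IsotropyLocallyTrivial → I G = isotropyIntegral r G)
    (h' : ∀ G : OSDGroupoid.{u} S, G.IsotropyLocallyTrivial → I G = isotropyIntegral r' G) :
    r = r' := by
  refine CompactLieGrp.univRing_hom_ext fun c => ?_
  obtain ⟨H, rfl⟩ := Quotient.exists_rep c
  exact (apply_T_of_eq_isotropyIntegral h H).trans (apply_T_of_eq_isotropyIntegral h' H).symm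

end OSDGroupoid

end

theorem mainTheorem2 (S : OMinimalStructure) {R : Type v} [Ring R]
    (I : OSDGroupoid.{u} S → R) (hI : OSDGroupoid.IsTopologicalInvariant I) :
    (OSDGroupoid.AdditiveOn OSDGroupoid.IsotropyLocallyTrivial I ∧
        OSDGroupoid.MultiplicativeOn OSDGroupoid.IsotropyLocallyTrivial I ↔
      ∃! r : CompactLieGrp.UnivRing.{u} →ₙ+* R,
        ∀ G : OSDGroupoid.{u} S, G.IsotropyLocallyTrivial →
          I G = S.eulerIntegral G.ι fun o => r (G.isotropyT o)) ∧
    (OSDGroupoid.AdditiveOn OSDGroupoid.IsotropyLocallyTrivial I ∧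
        OSDGroupoid.MultiplicativeOn OSDGroupoid.IsotropyLocallyTrivial I ∧
        OSDGroupoid.Normalized I ↔
      ∃! r : CompactLieGrp.UnivRing.{u} →+* R,
        ∀ G : OSDGroupoid.{u} S, G.IsotropyLocallyTrivial →
          I G = S.eulerIntegral G.ι fun o => r (G.isotropyT o)) := by
  have exists_hom : OSDGroupoid.AdditiveOn OSDGroupoid.IsotropyLocallyTrivial I →
      OSDGroupoid.MultiplicativeOn OSDGroupoid.IsotropyLocallyTrivial I →
      ∃ r : CompactLieGrp.UnivRing.{u} →ₙ+* R, ∀ G : OSDGroupoid.{u} S,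
        G.IsotropyLocallyTrivial → I G = OSDGroupoid.isotropyIntegral r G := fun hadd hmul =>
    ⟨CompactLieGrp.univRingLift (OSDGroupoid.pointValue hI hmul), fun G hG =>
      OSDGroupoid.eq_isotropyIntegral hI hadd (fun H => CompactLieGrp.univRingLift_T _ _) hG⟩
  refine ⟨⟨fun ⟨hadd, hmul⟩ => ?_, fun ⟨r, hr, _⟩ => ?_⟩,
    ⟨fun ⟨hadd, hmul, hone⟩ => ?_, fun ⟨r, hr, _⟩ => ?_⟩⟩
  · obtain ⟨r, hr⟩ := exists_hom hadd hmul
    exact ⟨r, hr, fun r' hr' => OSDGroupoid.univRing_hom_unique hr' hr⟩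
  · exact ⟨OSDGroupoid.additiveOn_of_eq_isotropyIntegral hr,
      OSDGroupoid.multiplicativeOn_of_eq_isotropyIntegral (map_mul r) hr⟩
  · obtain ⟨r, hr⟩ := exists_hom hadd hmul
    -- The unit is `T^[e]`, and the corresponding groupoid has one object and one arrow.
    have h1 : r 1 = 1 := by
      rw [← CompactLieGrp.T_trivial, OSDGroupoid.apply_T_of_eq_isotropyIntegral hr]
      exact hone _ (inferInstanceAs (Nonempty (ULift (univ : Set (Fin 0 → ℝ)))))
        (inferInstanceAs (Subsingleton (PUnit × ULift (univ : Set (Fin 0 → ℝ)))))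
    exact ⟨{ r with map_one' := h1 }, hr, fun r' hr' => OSDGroupoid.univRing_hom_unique hr' hr⟩
  · refine ⟨OSDGroupoid.additiveOn_of_eq_isotropyIntegral hr,
      OSDGroupoid.multiplicativeOn_of_eq_isotropyIntegral (map_mul r) hr, fun G hO hA => ?_⟩
    rw [hI _ _ (OSDGroupoid.moritaEquivalent_pointOSD_of_subsingleton hO hA),
      ← OSDGroupoid.apply_T_of_eq_isotropyIntegral hr, CompactLieGrp.T_trivial, map_one]
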